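/- **Setting.** Let $M$ be a smooth supermanifold of dimension $n|m$ (Hausdorff, second countable reduced manifold) with local coordinates $x^a$ of parity $\tilde a$, and let $\Pi T^*M$ be its anticotangent bundle, with the Darboux coordinates $(x^a, x^*_a)$ induced by charts of $M$, where $x^*_a$ has parity $\tilde a+1$ and $x'^*_a=\frac{\partial x^b}{\partial x'^a}x^*_b$. All derivatives are left derivatives, repeated indices are summed. The canonical Schouten bracket of $F,G\in C^\infty(\Pi T^*M)$ is $$[[F,G]] = (-1)^{(\tilde a+1)(\tilde F+1)}\frac{\partial F}{\partial x^*_a}\frac{\partial G}{\partial x^a}-(-1)^{\tilde a(\tilde F+1)}\frac{\partial F}{\partial x^a}\frac{\partial G}{\partial x^*_a}.$$ A Q-manifold $(N,Q)$ is a supermanifold with an odd vector field $Q$ with $Q^2=0$; its standard cohomology is $\ker Q/\operatorname{im}Q$ on $C^\infty(N)$. A Berezin volume $\rho$ on $N$ is an even Berezin form given in local coordinates $z^A$ by $D[z]\,\rho(z)$ with $\rho(z)$ invertible, where $D[z']=D[z]\operatorname{Ber}(\partial z'/\partial z)$. The divergence of a vector field $X=X^A\partial/\partial z^A$ is defined by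 $\rho\operatorname{Div}_\rho X=L_X\rho$, i.e. $\operatorname{Div}_\rho X=(-1)^{\tilde A(\tilde X+1)}\frac1\rho\frac{\partial}{\partial z^A}(X^A\rho)$. The modular class of $(N,Q)$ is the standard cohomology class $\operatorname{Mod}(Q)=[\operatorname{Div}_\rho Q]$, for any choice of Berezin volume $\rho$. Let $(M,P)$ be a higher Poisson manifold: $P\in C^\infty(\Pi T^*M)$ is even and $[[P,P]]=0$. Put $Q_P=[[P,\cdot\,]]$. The modular class of $(M,P)$ is defined to be $\tfrac12\operatorname{Mod}(Q_P)$, half the modular class of $(\Pi T^*M,Q_P)$. **Theorem.** $(\Pi T^*M, Q_P)$ is a Q-manifold, and for every Berezin volume $\rho$ on $\Pi T^*M$ the function $$\Delta_\rho P:=\tfrac12\operatorname{Div}_\rho Q_P$$ is $Q_P$-closed and its standard cohomology class is the modular class of the higher Poisson manifold $(M,P)$ (in particular the class does not depend on $\rho$). In Darboux coordinates, in which $\rho$ also denotes the coefficient of the Berezin volume, $$\Delta_\rho P=\sum_a(-1)^{\tilde a+1}\frac{\partial^2P}{\partial x^a\,\partial x^*_a}+[[P,\log\sqrt{|\rho|}\,]],$$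 where $|\rho|=\pm\rho$ according to the sign of the body of $\rho$ (so $|\rho|=\rho$ for a positive volume). -/

import Mathlib

open scoped ContDiff

universe u v

noncomputable section

namespace Super

/-! ### Grassmann algebras and superfunctions of `ℝ^{p|q}` -/

/-- The real Grassmann algebra on the generators `ξ_b`, `b : β`. -/
abbrev Grass (β : Type) : Type := ExteriorAlgebra ℝ (β → ℝ)

/-- The basis of ordered monomials in the generators. -/
def grassBasis (β : Type) [Fintype β] :
    Module.Basis (Finset (Fin (Fintype.card β))) ℝ (Grass β) :=
  ((Pi.basisFun ℝ β).reindex (Fintype.equivFin β)).ExteriorAlgebra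

/-- A norm on the finite-dimensional space `Grass β`. Only its topology is used, and that does
not depend on the norm. -/
instance grassNormed (β : Type) [Fintype β] : NormedAddCommGroup (Grass β) :=
  NormedAddCommGroup.induced (Grass β) (Finset (Fin (Fintype.card β)) → ℝ)
    (grassBasis β).equivFun (grassBasis β).equivFun.injective

instance grassNormedSpace (β : Type) [Fintype β] : NormedSpace ℝ (Grass β) :=
  NormedSpace.induced ℝ (Grass β) (Finset (Fin (Fintype.card β)) → ℝ)
    (grassBasis β).equivFun.toLinearMap

/-- The body (the part of degree zero) of an element of a Grassmann algebra. -/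
def body {β : Type} : Grass β →ₐ[ℝ] ℝ := ExteriorAlgebra.algebraMapInv

/-- `g` has Grassmann parity `ε` (mod 2). -/
def HasParity {β : Type} (ε : ℕ) (g : Grass β) : Prop :=
  g ∈ CliffordAlgebra.evenOdd (0 : QuadraticForm ℝ (β → ℝ)) (ε : ZMod 2)

/-- Local superfunctions: a function `F(x, ξ)` on a domain of `ℝ^{α|β}` is a map from a domain of
`ℝ^α` to the Grassmann algebra on `β`, smooth on that domain. Values outside the domain are
irrelevant. -/
abbrev SFun (α β : Type) : Type := (α → ℝ) → Grass β

/-- The parity of the coordinate with a given index: `α` indexes the even coordinates and `β` the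
odd ones. -/
def par {α β : Type} : α ⊕ β → ℕ
  | Sum.inl _ => 0
  | Sum.inr _ => 1

section Local

variable {α β α' β' : Type} [Fintype α] [Fintype β] [DecidableEq α] [DecidableEq β]
  [Fintype α'] [Fintype β'] [DecidableEq α'] [DecidableEq β']

/-- The coordinate functions of `ℝ^{α|β}`. -/
def coordFn {α β : Type} [DecidableEq β] : α ⊕ β → SFun α β
  | Sum.inl a => fun x => algebraMap ℝ (Grass β) (x a)
  | Sum.inr b => fun _ => ExteriorAlgebra.ι ℝ (Pi.single b (1 : ℝ))

/-- The partial derivatives; those in the odd directions are left derivatives. -/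
def pd : α ⊕ β → SFun α β → SFun α β
  | Sum.inl a => fun F x => fderiv ℝ F x (Pi.single a 1)
  | Sum.inr b => fun F x =>
      CliffordAlgebra.contractLeft (Q := (0 : QuadraticForm ℝ (β → ℝ)))
        (LinearMap.proj b : (β → ℝ) →ₗ[ℝ] ℝ) (F x)

open Classical in
/-- The algebra homomorphism `Grass β' → Grass β` with `ξ'_b ↦ η b`; the condition that makes it
exist (all linear combinations of the `η b` square to zero) holds when the `η b` are odd. -/
def subst (η : β' → Grass β) : Grass β' →ₐ[ℝ] Grass β :=
  if h : ∀ v : β' → ℝ, Fintype.linearCombination ℝ η v * Fintype.linearCombination ℝ η v = 0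
  then ExteriorAlgebra.lift ℝ ⟨Fintype.linearCombination ℝ η, h⟩
  else (Algebra.ofId ℝ (Grass β)).comp body

/-- The body of the even components of a map of superdomains. -/
def bodyMap (φ : α' ⊕ β' → SFun α β) (x : α → ℝ) : α' → ℝ :=
  fun a => body (φ (Sum.inl a) x)

/-- The pullback `F(φ(x, ξ))` of a superfunction along the map of superdomains in which the
coordinate with index `A` of the target is `φ A`: substitution in the odd variables, and the
(finite) Taylor expansion about the body in the even ones. -/
def pullback (φ : α' ⊕ β' → SFun α β) (F : SFun α' β') : SFun α β := fun x =>
  ∑ k ∈ Finset.range (Fintype.card β + 1), (1 / (k.factorial : ℝ)) • ∑ μ : Fin k → α',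
    (List.ofFn fun j : Fin k =>
        φ (Sum.inl (μ j)) x - algebraMap ℝ (Grass β) (bodyMap φ x (μ j))).prod *
      subst (fun b => φ (Sum.inr b) x)
        (iteratedFDeriv ℝ k F (bodyMap φ x) (fun j => Pi.single (μ j) 1))

/-- `g ∘ f` for an even superfunction `f` and a function `g` on the real line that is smooth at
the values of the body of `f`. -/
def applyFn (g : ℝ → ℝ) (f : SFun α β) : SFun α β := fun x =>
  ∑ k ∈ Finset.range (Fintype.card β + 1),
    (1 / (k.factorial : ℝ) * iteratedDeriv k g (body (f x))) •
      (f x - algebraMap ℝ (Grass β) (body (f x))) ^ k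

/-- The vector field with components `X A` acting on a superfunction. -/
def actLocal (X : α ⊕ β → SFun α β) (f : SFun α β) : SFun α β := fun x =>
  ∑ A, X A x * pd A f x

/-- `s ↦ L_X (D[x] s)`, for a vector field `X` of parity `ε`, as a coefficient of `D[x]`. -/
def lieLocal (ε : ℕ) (X : α ⊕ β → SFun α β) (s : SFun α β) : SFun α β := fun x =>
  ∑ A : α ⊕ β, ((-1 : ℝ) ^ (par A * (ε + 1))) • pd A (fun y => X A y * s y) x

/-! ### The Berezinian -/

/-- The even part of a Grassmann algebra is a commutative ring. -/
theorem even_mul_comm {β : Type} (x y : Grass β)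
    (hx : x ∈ CliffordAlgebra.evenOdd (0 : QuadraticForm ℝ (β → ℝ)) 0) : x * y = y * x := by
  have hswap : ∀ a b : β → ℝ, ExteriorAlgebra.ι ℝ a * ExteriorAlgebra.ι ℝ b
      = -(ExteriorAlgebra.ι ℝ b * ExteriorAlgebra.ι ℝ a) := fun a b =>
    eq_neg_of_add_eq_zero_left (ExteriorAlgebra.ι_add_mul_swap a b)
  have key : ∀ a b c : β → ℝ,
      (ExteriorAlgebra.ι ℝ a * ExteriorAlgebra.ι ℝ b) * ExteriorAlgebra.ι ℝ c
      = ExteriorAlgebra.ι ℝ c * (ExteriorAlgebra.ι ℝ a * ExteriorAlgebra.ι ℝ b) := by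
    intro a b c
    rw [mul_assoc, hswap b c, mul_neg, ← mul_assoc, hswap a c, neg_mul, neg_neg, mul_assoc]
  have key2 : ∀ (a b : β → ℝ) (z : Grass β),
      (ExteriorAlgebra.ι ℝ a * ExteriorAlgebra.ι ℝ b) * z
      = z * (ExteriorAlgebra.ι ℝ a * ExteriorAlgebra.ι ℝ b) := by
    intro a b z
    induction z using ExteriorAlgebra.induction with
    | algebraMap r => exact (Algebra.commutes r _).symm
    | ι c => exact key a b c
    | mul p q hp hq => rw [← mul_assoc, hp, mul_assoc, hq, mul_assoc]
    | add p q hp hq => rw [mul_add, add_mul, hp, hq]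
  induction x, hx using CliffordAlgebra.even_induction with
  | algebraMap r => exact Algebra.commutes r _
  | add p q _ _ hp hq => rw [add_mul, mul_add, hp, hq]
  | ι_mul_ι_mul a b p _ hp =>
    have h2 := key2 a b y
    change (ExteriorAlgebra.ι ℝ a * ExteriorAlgebra.ι ℝ b) * p * y
      = y * ((ExteriorAlgebra.ι ℝ a * ExteriorAlgebra.ι ℝ b) * p)
    rw [mul_assoc, hp, ← mul_assoc, h2, mul_assoc]

/-- The even subalgebra of a Grassmann algebra. -/
abbrev EvenGrass (β : Type) : Type := CliffordAlgebra.even (0 : QuadraticForm ℝ (β → ℝ))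

instance evenGrassCommRing (β : Type) : CommRing (EvenGrass β) :=
  { (inferInstance : Ring (EvenGrass β)) with
    mul_comm := fun a b => Subtype.ext (even_mul_comm a.1 b.1 a.2) }

open Classical in
/-- An even element, as an element of the even subalgebra. -/
def toEven {β : Type} (g : Grass β) : EvenGrass β :=
  if h : g ∈ CliffordAlgebra.even (0 : QuadraticForm ℝ (β → ℝ)) then ⟨g, h⟩ else 0

/-- The determinant of a square matrix with even entries. -/
def evenDet {ι : Type} [Fintype ι] [DecidableEq ι] (A : Matrix ι ι (Grass β)) : Grass β :=
  ((A.map toEven).det : EvenGrass β)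

/-- The Berezinian `det (A - B D⁻¹ C) (det D)⁻¹` of an invertible even supermatrix with blocks
`A, B, C, D`. -/
def Ber (J : Matrix (α ⊕ β) (α ⊕ β) (Grass β')) : Grass β' :=
  evenDet (J.toBlocks₁₁ - J.toBlocks₁₂ * Ring.inverse J.toBlocks₂₂ * J.toBlocks₂₁) *
    Ring.inverse (evenDet J.toBlocks₂₂)

/-- The Jacobian supermatrix `∂x'^B / ∂x^A` (row `A`, column `B`). -/
def jacobian (φ : α ⊕ β → SFun α β) (x : α → ℝ) : Matrix (α ⊕ β) (α ⊕ β) (Grass β) :=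
  Matrix.of fun A B => pd A (φ B) x

end Local

/-! ### Gluing data, functions, vector fields, Berezin volumes -/

/-- Superdomains together with coordinate changes: `trans i j A` is the `A`-th coordinate of the
`j`-th chart as a function of the coordinates of the `i`-th chart, on the part `ovl i j` of the
`i`-th chart that overlaps with the `j`-th one. -/
structure SuperAtlas (α β : Type) where
  Idx : Type u
  dom : Idx → Set (α → ℝ)
  isOpen_dom : ∀ i, IsOpen (dom i)
  ovl : Idx → Idx → Set (α → ℝ)
  ovl_subset : ∀ i j, ovl i j ⊆ dom i
  trans : Idx → Idx → α ⊕ β → SFun α β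
  body_mem : ∀ i j, ∀ x ∈ ovl i j, bodyMap (trans i j) x ∈ dom j

section Global

variable {α β : Type} [Fintype α] [Fintype β] [DecidableEq α] [DecidableEq β]

/-- A family of local expressions, one in each chart. -/
abbrev Fam (N : SuperAtlas.{u} α β) : Type u := N.Idx → SFun α β

/-- A family of components of a vector field, in each chart. -/
abbrev VFam (N : SuperAtlas.{u} α β) : Type u := N.Idx → α ⊕ β → SFun α β

theorem pullback_add_smul {N : SuperAtlas.{u} α β} (c : ℝ) {F G : Fam N}
    (hF : ∀ i, ContDiffOn ℝ ∞ (F i) (N.dom i)) (hG : ∀ i, ContDiffOn ℝ ∞ (G i) (N.dom i))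
    (i j : N.Idx) {x : α → ℝ} (hx : x ∈ N.ovl i j) :
    pullback (N.trans i j) (F j + c • G j) x =
      pullback (N.trans i j) (F j) x + c • pullback (N.trans i j) (G j) x := by
  have hy := N.body_mem i j x hx
  have hF' : ContDiffAt ℝ ∞ (F j) (bodyMap (N.trans i j) x) :=
    (hF j).contDiffAt ((N.isOpen_dom j).mem_nhds hy)
  have hG' : ContDiffAt ℝ ∞ (G j) (bodyMap (N.trans i j) x) :=
    (hG j).contDiffAt ((N.isOpen_dom j).mem_nhds hy)
  have key : ∀ k : ℕ, iteratedFDeriv ℝ k (F j + c • G j) (bodyMap (N.trans i j) x) =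
      iteratedFDeriv ℝ k (F j) (bodyMap (N.trans i j) x) +
        c • iteratedFDeriv ℝ k (G j) (bodyMap (N.trans i j) x) := by
    intro k
    have hk : ((k : ℕ∞) : WithTop ℕ∞) ≤ (∞ : WithTop ℕ∞) := by exact_mod_cast le_top
    have h1 := hF'.of_le hk
    have h2 := hG'.of_le hk
    have h3 : ContDiffAt ℝ k (c • G j) (bodyMap (N.trans i j) x) := h2.const_smul c
    rw [iteratedFDeriv_add_apply h1 h3, iteratedFDeriv_const_smul_apply h2]
  unfold pullback
  simp only [key, _root_.add_apply, _root_.smul_apply,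
    map_add, map_smul, mul_add, mul_smul_comm, Finset.sum_add_distrib, smul_add, Finset.smul_sum]
  congr 1
  refine Finset.sum_congr rfl fun k _ => Finset.sum_congr rfl fun μ _ => ?_
  rw [smul_comm]

theorem pd_add_smul (A : α ⊕ β) (c : ℝ) {F G : SFun α β} {x : α → ℝ}
    (hF : DifferentiableAt ℝ F x) (hG : DifferentiableAt ℝ G x) :
    pd A (F + c • G) x = pd A F x + c • pd A G x := by
  cases A with
  | inl a =>
    simp only [pd]
    rw [fderiv_add hF (hG.const_smul c), fderiv_const_smul hG]
    rfl
  | inr b => simp [pd]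

/-- The space `C^∞(N)` of (global) functions. -/
def functions (N : SuperAtlas.{u} α β) : Submodule ℝ (Fam N) where
  carrier := {F | (∀ i, ContDiffOn ℝ ∞ (F i) (N.dom i)) ∧
    ∀ i j, ∀ x ∈ N.ovl i j, F i x = pullback (N.trans i j) (F j) x}
  zero_mem' := by
    refine ⟨fun i => contDiffOn_const, fun i j x _ => ?_⟩
    have h : ∀ k : ℕ, iteratedFDeriv ℝ k (0 : SFun α β) = 0 := fun k =>
      iteratedFDeriv_fun_zero
    simp [pullback, h]
  add_mem' := by
    rintro F G ⟨hF, hF'⟩ ⟨hG, hG'⟩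
    refine ⟨fun i => (hF i).add (hG i), fun i j x hx => ?_⟩
    have := pullback_add_smul 1 hF hG i j hx
    simp only [one_smul] at this
    simp only [Pi.add_apply]
    rw [this, hF' i j x hx, hG' i j x hx]
  smul_mem' := by
    rintro c F ⟨hF, hF'⟩
    refine ⟨fun i => (hF i).const_smul c, fun i j x hx => ?_⟩
    have h0 : ∀ i, ContDiffOn ℝ ∞ ((0 : Fam N) i) (N.dom i) := fun i => contDiffOn_const
    have h := pullback_add_smul c h0 hF i j hx
    have h2 := pullback_add_smul (-1) hF hF i j hx
    have e : F j + (-1 : ℝ) • F j = (0 : Fam N) j := by simp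
    rw [e] at h2
    have e2 : (0 : Fam N) j + c • F j = (c • F) j := by simp
    rw [e2, h2] at h
    rw [h]
    simp [hF' i j x hx]

/-- The action of a vector field on (families of) functions. -/
def act {N : SuperAtlas.{u} α β} (X : VFam N) (F : Fam N) : Fam N :=
  fun i => actLocal (X i) (F i)

theorem act_add_smul {N : SuperAtlas.{u} α β} (X : VFam N) (c : ℝ) {F G : Fam N}
    (hF : F ∈ functions N) (hG : G ∈ functions N) (i : N.Idx) {x : α → ℝ} (hx : x ∈ N.dom i) :
    act X (F + c • G) i x = act X F i x + c • act X G i x := by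
  have hn := (N.isOpen_dom i).mem_nhds hx
  have h1 : DifferentiableAt ℝ (F i) x := ((hF.1 i).contDiffAt hn).differentiableAt (by simp)
  have h2 : DifferentiableAt ℝ (G i) x := ((hG.1 i).contDiffAt hn).differentiableAt (by simp)
  simp only [act, actLocal, Pi.add_apply, Pi.smul_apply]
  rw [Finset.smul_sum, ← Finset.sum_add_distrib]
  refine Finset.sum_congr rfl fun A _ => ?_
  rw [pd_add_smul A c h1 h2, mul_add, mul_smul_comm]

/-- `X` is a vector field of parity `ε`. -/
structure IsVectorField (N : SuperAtlas.{u} α β) (ε : ℕ) (X : VFam N) : Prop where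
  smooth : ∀ i A, ContDiffOn ℝ ∞ (X i A) (N.dom i)
  parity : ∀ i A, ∀ x ∈ N.dom i, HasParity (par A + ε) (X i A x)
  compat : ∀ i j B, ∀ x ∈ N.ovl i j,
    actLocal (X i) (N.trans i j B) x = pullback (N.trans i j) (X j B) x

/-- `Q` is a homological vector field: an odd vector field with `Q ∘ Q = 0`. -/
structure IsHomological (N : SuperAtlas.{u} α β) (Q : VFam N) : Prop where
  isVectorField : IsVectorField N 1 Q
  sq_zero : ∀ i (f : SFun α β), ContDiffOn ℝ ∞ f (N.dom i) →
    ∀ x ∈ N.dom i, actLocal (Q i) (actLocal (Q i) f) x = 0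

/-! ### Standard cohomology -/

/-- The cocycles `ker Q` of the standard complex `(C^∞(N), Q)`. -/
def cocycles (N : SuperAtlas.{u} α β) (Q : VFam N) : Submodule ℝ (Fam N) where
  carrier := {F | F ∈ functions N ∧ ∀ i, ∀ x ∈ N.dom i, act Q F i x = 0}
  zero_mem' := by
    refine ⟨(functions N).zero_mem, fun i x hx => ?_⟩
    have h := act_add_smul Q (-1) (functions N).zero_mem (functions N).zero_mem i hx
    simpa using h
  add_mem' := by
    rintro F G ⟨hF, hF'⟩ ⟨hG, hG'⟩
    refine ⟨(functions N).add_mem hF hG, fun i x hx => ?_⟩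
    have h := act_add_smul Q 1 hF hG i hx
    rw [one_smul] at h
    rw [h, hF' i x hx, hG' i x hx]
    simp
  smul_mem' := by
    rintro c F ⟨hF, hF'⟩
    refine ⟨(functions N).smul_mem c hF, fun i x hx => ?_⟩
    have h := act_add_smul Q (c - 1) hF hF i hx
    have e : F + (c - 1) • F = c • F := by rw [sub_smul, one_smul]; abel
    rw [e] at h
    rw [h, hF' i x hx]
    simp

/-- The coboundaries `im Q` of the standard complex. -/
def coboundaries (N : SuperAtlas.{u} α β) (Q : VFam N) : Submodule ℝ (Fam N) where
  carrier := {F | F ∈ functions N ∧ ∃ G ∈ functions N, ∀ i, ∀ x ∈ N.dom i, F i x = act Q G i x}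
  zero_mem' := by
    refine ⟨(functions N).zero_mem, 0, (functions N).zero_mem, fun i x hx => ?_⟩
    exact ((cocycles N Q).zero_mem.2 i x hx).symm
  add_mem' := by
    rintro F G ⟨hF, F', hF', hF''⟩ ⟨hG, G', hG', hG''⟩
    refine ⟨(functions N).add_mem hF hG, F' + G', (functions N).add_mem hF' hG', fun i x hx => ?_⟩
    have h := act_add_smul Q 1 hF' hG' i hx
    rw [one_smul, one_smul] at h
    rw [h, ← hF'' i x hx, ← hG'' i x hx]
    rfl
  smul_mem' := by
    rintro c F ⟨hF, F', hF', hF''⟩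
    refine ⟨(functions N).smul_mem c hF, c • F', (functions N).smul_mem c hF', fun i x hx => ?_⟩
    have h := act_add_smul Q (c - 1) hF' hF' i hx
    have e : F' + (c - 1) • F' = c • F' := by rw [sub_smul, one_smul]; abel
    rw [e] at h
    rw [h, ← hF'' i x hx]
    simp only [Pi.smul_apply]
    rw [sub_smul, one_smul]
    abel

/-- The standard cohomology `ker Q / im Q` (the sum of its even and its odd part). -/
abbrev StdCohomology (N : SuperAtlas.{u} α β) (Q : VFam N) : Type u :=
  cocycles N Q ⧸ (coboundaries N Q).submoduleOf (cocycles N Q)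

/-- The cohomology class of a cocycle. -/
def stdClass (N : SuperAtlas.{u} α β) (Q : VFam N) (F : Fam N) (hF : F ∈ cocycles N Q) :
    StdCohomology N Q :=
  Submodule.Quotient.mk ⟨F, hF⟩

/-! ### Divergence and modular class -/

/-- `ρ` is the family of coefficients of a Berezin volume `D[x] ρ(x)`: an even Berezin form with
invertible coefficients. -/
structure IsBerezinVolume (N : SuperAtlas.{u} α β) (ρ : Fam N) : Prop where
  smooth : ∀ i, ContDiffOn ℝ ∞ (ρ i) (N.dom i)
  even : ∀ i, ∀ x ∈ N.dom i, HasParity 0 (ρ i x)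
  invertible : ∀ i, ∀ x ∈ N.dom i, IsUnit (ρ i x)
  compat : ∀ i j, ∀ x ∈ N.ovl i j,
    ρ i x = Ber (jacobian (N.trans i j) x) * pullback (N.trans i j) (ρ j) x

/-- The divergence of a vector field of parity `ε`, given by `ρ Div_ρ X = L_X ρ`. -/
def divergence {N : SuperAtlas.{u} α β} (ε : ℕ) (ρ : Fam N) (X : VFam N) : Fam N :=
  fun i x => Ring.inverse (ρ i x) * lieLocal ε (X i) (ρ i) x

open Classical in
/-- The modular class of a Q-manifold: the class of `Div_ρ Q` for any Berezin volume `ρ`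
(`0` is a dummy value for the cases in which this makes no sense). -/
def modularClass (N : SuperAtlas.{u} α β) (Q : VFam N) : StdCohomology N Q :=
  if h : ∃ ρ : Fam N, IsBerezinVolume N ρ then
    if h' : divergence 1 h.choose Q ∈ cocycles N Q then stdClass N Q _ h' else 0
  else 0

end Global

/-! ### Supermanifolds -/

/-- A supermanifold of dimension `n|m`, given by an atlas: a Hausdorff second countable space
(the reduced manifold) with charts, and coordinate changes in even and odd variables whose bodies
are those of the charts and which satisfy the cocycle condition. -/
structure Supermanifold (n m : ℕ) where
  carrier : Type u
  [top : TopologicalSpace carrier]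
  [t2 : T2Space carrier]
  [sc : SecondCountableTopology carrier]
  Idx : Type v
  chart : Idx → OpenPartialHomeomorph carrier (Fin n → ℝ)
  cover : ∀ p, ∃ i, p ∈ (chart i).source
  trans : Idx → Idx → Fin n ⊕ Fin m → SFun (Fin n) (Fin m)
  smooth : ∀ i j A, ContDiffOn ℝ ∞ (trans i j A) ((chart i).symm.trans (chart j)).source
  parity : ∀ i j A, ∀ x ∈ ((chart i).symm.trans (chart j)).source,
    HasParity (par A) (trans i j A x)
  body_eq : ∀ i j, ∀ x ∈ ((chart i).symm.trans (chart j)).source,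
    bodyMap (trans i j) x = (chart i).symm.trans (chart j) x
  refl : ∀ i A, ∀ x ∈ (chart i).target, trans i i A x = coordFn A x
  cocycle : ∀ i j k A, ∀ x ∈ ((chart i).symm.trans (chart j)).source,
    x ∈ ((chart i).symm.trans (chart k)).source →
      trans i k A x = pullback (trans i j) (trans j k A) x

attribute [instance] Supermanifold.top Supermanifold.t2 Supermanifold.sc

/-- The gluing data of a supermanifold. -/
def Supermanifold.toAtlas {n m : ℕ} (M : Supermanifold.{u, v} n m) :
    SuperAtlas.{v} (Fin n) (Fin m) where
  Idx := M.Idx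
  dom i := (M.chart i).target
  isOpen_dom i := (M.chart i).open_target
  ovl i j := ((M.chart i).symm.trans (M.chart j)).source
  ovl_subset i j := fun x hx => by
    rw [OpenPartialHomeomorph.trans_source] at hx
    exact hx.1
  trans := M.trans
  body_mem i j x hx := by
    rw [M.body_eq i j x hx]
    have h := ((M.chart i).symm.trans (M.chart j)).map_source hx
    rw [OpenPartialHomeomorph.trans_target] at h
    exact h.1

/-! ### The anticotangent bundle -/

section Anticotangent

variable {α β : Type} [Fintype α] [Fintype β] [DecidableEq α] [DecidableEq β]

/-- Index of the coordinate `x^a` of `ΠT*M`. The even coordinates of `ΠT*M` are the even `x^a` and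
the antimomenta `x*_a` of the odd `x^a`; its odd coordinates are the odd `x^a` and the antimomenta
of the even `x^a`. -/
def ix {α β : Type} : α ⊕ β → (α ⊕ β) ⊕ (β ⊕ α)
  | Sum.inl a => Sum.inl (Sum.inl a)
  | Sum.inr b => Sum.inr (Sum.inl b)

/-- Index of the antimomentum `x*_a`. -/
def ixs {α β : Type} : α ⊕ β → (α ⊕ β) ⊕ (β ⊕ α)
  | Sum.inl a => Sum.inr (Sum.inr a)
  | Sum.inr b => Sum.inl (Sum.inr b)

/-- The base part of the body of a point of a chart of `ΠT*M`. -/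
def basePt {α β : Type} (z : α ⊕ β → ℝ) : α → ℝ := fun a => z (Sum.inl a)

/-- The pullback to `ΠT*M` of a local function on `M`. -/
def lift (F : SFun α β) : SFun (α ⊕ β) (β ⊕ α) := fun z =>
  ExteriorAlgebra.map
    (LinearMap.pi (Sum.elim (fun b => LinearMap.proj b) fun _ => 0) :
      (β → ℝ) →ₗ[ℝ] (β ⊕ α → ℝ)) (F (basePt z))

theorem body_lift (F : SFun α β) (z : α ⊕ β → ℝ) : body (lift F z) = body (F (basePt z)) := by
  have h : (body (β := β ⊕ α)).comp (ExteriorAlgebra.map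
      (LinearMap.pi (Sum.elim (fun b => LinearMap.proj b) fun _ => 0) :
        (β → ℝ) →ₗ[ℝ] (β ⊕ α → ℝ))) = body := by
    apply ExteriorAlgebra.hom_ext
    ext
    simp [body, ExteriorAlgebra.algebraMapInv]
  exact DFunLike.congr_fun h (F (basePt z))

/-- The coordinate changes of `ΠT*M`: those of `M` for the `x^a`, and
`x'*_a = (∂x^b / ∂x'^a) x*_b` for the antimomenta, where `∂x^b / ∂x'^a` is expressed in the
coordinates `x`. -/
def cotangentTrans (N : SuperAtlas.{u} α β) (i j : N.Idx) :
    (α ⊕ β) ⊕ (β ⊕ α) → SFun (α ⊕ β) (β ⊕ α) :=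
  let base : α ⊕ β → SFun (α ⊕ β) (β ⊕ α) := fun A => lift (N.trans i j A)
  let fibre : α ⊕ β → SFun (α ⊕ β) (β ⊕ α) := fun A z =>
    ∑ B, lift (pullback (N.trans i j) (pd A (N.trans j i B))) z * coordFn (ixs B) z
  Sum.elim (Sum.elim (fun a => base (Sum.inl a)) (fun b => fibre (Sum.inr b)))
    (Sum.elim (fun b => base (Sum.inr b)) (fun a => fibre (Sum.inl a)))

/-- The gluing data of `ΠT*M`, in the Darboux coordinates `(x^a, x*_a)` over the charts of `M`. -/
def anticotangent (N : SuperAtlas.{u} α β) : SuperAtlas.{u} (α ⊕ β) (β ⊕ α) where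
  Idx := N.Idx
  dom i := {z | basePt z ∈ N.dom i}
  isOpen_dom i := (N.isOpen_dom i).preimage (by unfold basePt; fun_prop)
  ovl i j := {z | basePt z ∈ N.ovl i j}
  ovl_subset i j := fun z hz => N.ovl_subset i j hz
  trans := cotangentTrans N
  body_mem i j z hz := by
    have h := N.body_mem i j _ hz
    have e : basePt (bodyMap (cotangentTrans N i j) z) = bodyMap (N.trans i j) (basePt z) := by
      funext a
      exact body_lift _ z
    change basePt _ ∈ N.dom j
    rw [e]
    exact h

/-- The canonical Schouten bracket of `F`, of parity `ε`, with `G` in Darboux coordinates. -/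
def schouten (ε : ℕ) (F G : SFun (α ⊕ β) (β ⊕ α)) : SFun (α ⊕ β) (β ⊕ α) := fun z =>
  ∑ a : α ⊕ β,
    (((-1 : ℝ) ^ ((par a + 1) * (ε + 1))) • (pd (ixs a) F z * pd (ix a) G z) -
      ((-1 : ℝ) ^ (par a * (ε + 1))) • (pd (ix a) F z * pd (ixs a) G z))

end Anticotangent

/-! ### Higher Poisson manifolds -/

section HigherPoisson

variable {n m : ℕ}

/-- The supermanifold `ΠT*M`. -/
abbrev PiTstar (M : Supermanifold.{u, v} n m) :
    SuperAtlas.{v} (Fin n ⊕ Fin m) (Fin m ⊕ Fin n) :=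
  anticotangent M.toAtlas

/-- `P` is a homotopy Poisson structure on `M`: an even function on `ΠT*M` with `[[P, P]] = 0`. -/
structure IsHigherPoisson (M : Supermanifold.{u, v} n m) (P : Fam (PiTstar M)) : Prop where
  mem : P ∈ functions (PiTstar M)
  even : ∀ i, ∀ z ∈ (PiTstar M).dom i, HasParity 0 (P i z)
  bracket : ∀ i, ∀ z ∈ (PiTstar M).dom i, schouten 0 (P i) (P i) z = 0

/-- The vector field `Q_P = [[P, ·]]` for even `P`, through its components `[[P, z^A]]`. -/
def hamiltonian (M : Supermanifold.{u, v} n m) (P : Fam (PiTstar M)) : VFam (PiTstar M) :=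
  fun i A => schouten 0 (P i) (coordFn A)

/-- The modular class of a higher Poisson manifold: half that of the Q-manifold `(ΠT*M, Q_P)`. -/
def poissonModularClass (M : Supermanifold.{u, v} n m) (P : Fam (PiTstar M)) :
    StdCohomology (PiTstar M) (hamiltonian M P) :=
  (1 / 2 : ℝ) • modularClass (PiTstar M) (hamiltonian M P)

/-- The BV-Laplacian of `P`: half of the divergence of `Q_P`. -/
def bvLaplacian (M : Supermanifold.{u, v} n m) (ρ P : Fam (PiTstar M)) : Fam (PiTstar M) :=
  (1 / 2 : ℝ) • divergence 1 ρ (hamiltonian M P)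

end HigherPoisson

end Super

end

/-! In Darboux coordinates $Q=Q_P$ is an odd vector field whose components are, up to sign, the
first derivatives of $P$. For an odd field $X$ with components $X^A$, the second-order part of $X^2$
cancels by the graded symmetry of second derivatives, so $X^2$ is the first-order operator with
components $X(X^A)$. For $Q$ these are, up to sign, the brackets $[[P,\partial_Z P]]$.
Differentiating $[[P,P]]=0$ along $z^Z$ gives $\pm 2[[P,\partial_Z P]]=0$, so $Q^2=0$ follows
without the general Jacobi identity (`actLocal_actLocal`, `actLocal_hamLocal_hamLocal`).

The divergence splits as $\operatorname{Div}_\rho Q=\sum_A\partial_A Q^A+Q(\log|\rho|)$. In the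
first summand $x^a$ and $x^*_a$ contribute equally, which produces twice the second-order expression
in $P$ and explains the factor $\frac12$ (`sdiv_hamLocal`). This is the local formula. The first
summand is closed: the equations $Q(Q^A)=0$, differentiated along $z^A$ and summed with signs, leave
$Q(\sum_A\partial_A Q^A)$ together with a supertrace of the square of an odd matrix, which vanishes
(`actLocal_sdiv`). The second summand is closed because $Q^2=0$.

Two global facts remain. First, $Q$ and its divergence are well defined on $\Pi T^*M$. The cotangent
lift of a coordinate change preserves the Schouten bracket; the terms containing second derivatives
of the inverse change cancel by symmetry (`IsCoordChange.actLocal_hamLocal_cotMap`). The coordinate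
divergence changes by the logarithmic derivative of the Berezinian, which is a supertrace
(`actLocal_Ber`, `IsSuperMap.sdiv_eq`), and this is compensated by the transformation law of $\rho$
(`IsSuperMap.pullback_divergence`). Second, the quotient $f$ of two volumes is a global even
invertible function, and the two divergences differ by $Q(\log|f|)$
(`IsHigherPoisson.divergence_sub_mem`).

All of this needs pullback along a map of superdomains, defined by a finite Taylor expansion, to be
an algebra homomorphism obeying the chain rule. Both facts have one proof: an element of a Grassmann
algebra is determined by its body and its odd derivatives, so an identity can be checked to higher
and higher order in the odd generators until the order exceeds their number (`Van.eq_zero`,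
`pullback_mul`, `IsSuperMap.pd_pullback`). Functions such as $\log|\rho|$ are pullbacks from the
line and inherit their calculus from the same results. -/

set_option linter.unusedSectionVars false

noncomputable section

namespace Super

/-! ### Algebra of Grassmann algebras -/

section GrassAlgebra

variable {β β' : Type}

/-- The parity involution of a Grassmann algebra. -/
abbrev gi : Grass β →ₐ[ℝ] Grass β := CliffordAlgebra.involute

theorem gi_gi (g : Grass β) : gi (gi g) = g := CliffordAlgebra.involute_involute g

theorem gi_ι (v : β → ℝ) : gi (ExteriorAlgebra.ι ℝ v) = -ExteriorAlgebra.ι ℝ v :=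
  CliffordAlgebra.involute_ι v

/-- The algebra is the sum of its even and odd parts, on which the involution is $1$ and $-1$. If it
fixes $g$, the odd part equals its own negative and vanishes over $\mathbb R$. -/
theorem hasParity_zero_iff {g : Grass β} : HasParity 0 g ↔ gi g = g := by
  constructor
  · intro h
    exact CliffordAlgebra.involute_eq_of_mem_even (by simpa [HasParity] using h)
  · intro h
    have hc := CliffordAlgebra.evenOdd_isCompl (Q := (0 : QuadraticForm ℝ (β → ℝ)))
    obtain ⟨x, hx, y, hy, rfl⟩ := Submodule.mem_sup.1
      (hc.sup_eq_top ▸ Submodule.mem_top : g ∈ _ ⊔ _)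
    rw [map_add, CliffordAlgebra.involute_eq_of_mem_even hx,
      CliffordAlgebra.involute_eq_of_mem_odd hy] at h
    have hy0 : y = 0 := by
      have h2 : (2 : ℝ) • y = 0 := by
        rw [two_smul]
        have := add_left_cancel h
        nth_rewrite 1 [← this]
        simp
      simpa using h2
    subst hy0
    simpa [HasParity] using hx

theorem hasParity_one_iff {g : Grass β} : HasParity 1 g ↔ gi g = -g := by
  constructor
  · intro h
    exact CliffordAlgebra.involute_eq_of_mem_odd (by simpa [HasParity] using h)
  · intro h
    have hc := CliffordAlgebra.evenOdd_isCompl (Q := (0 : QuadraticForm ℝ (β → ℝ)))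
    obtain ⟨x, hx, y, hy, rfl⟩ := Submodule.mem_sup.1
      (hc.sup_eq_top ▸ Submodule.mem_top : g ∈ _ ⊔ _)
    rw [map_add, CliffordAlgebra.involute_eq_of_mem_even hx,
      CliffordAlgebra.involute_eq_of_mem_odd hy, neg_add] at h
    have hx0 : x = 0 := by
      have h2 : (2 : ℝ) • x = 0 := by
        rw [two_smul]
        have := add_right_cancel h
        nth_rewrite 1 [this]
        simp
      simpa using h2
    subst hx0
    simpa [HasParity] using hy

theorem hasParity_add_two {e : ℕ} {g : Grass β} : HasParity (e + 2) g ↔ HasParity e g := by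
  unfold HasParity
  have : ((e + 2 : ℕ) : ZMod 2) = (e : ZMod 2) := by
    push_cast
    rw [show (2 : ZMod 2) = 0 from rfl, add_zero]
  rw [this]

/-- Parity becomes an eigenvalue equation for an algebra automorphism, from which the closure
properties below are read off. -/
theorem hasParity_iff {e : ℕ} {g : Grass β} : HasParity e g ↔ gi g = (-1 : ℝ) ^ e • g := by
  induction e using Nat.twoStepInduction with
  | zero => simpa using hasParity_zero_iff
  | one => simpa using hasParity_one_iff
  | more e h _ => rw [hasParity_add_two, h, pow_add]; simp

theorem HasParity.zero {e : ℕ} : HasParity e (0 : Grass β) := by simp [hasParity_iff]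

theorem HasParity.add {e : ℕ} {g h : Grass β} (hg : HasParity e g) (hh : HasParity e h) :
    HasParity e (g + h) := by
  rw [hasParity_iff] at *
  rw [map_add, hg, hh, smul_add]

theorem HasParity.neg {e : ℕ} {g : Grass β} (hg : HasParity e g) : HasParity e (-g) := by
  rw [hasParity_iff] at *
  rw [map_neg, hg, smul_neg]

theorem HasParity.sub {e : ℕ} {g h : Grass β} (hg : HasParity e g) (hh : HasParity e h) :
    HasParity e (g - h) := by
  rw [sub_eq_add_neg]
  exact hg.add hh.neg

theorem HasParity.smul {e : ℕ} {g : Grass β} (c : ℝ) (hg : HasParity e g) :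
    HasParity e (c • g) := by
  rw [hasParity_iff] at *
  rw [map_smul, hg, smul_comm]

theorem HasParity.mul {e f : ℕ} {g h : Grass β} (hg : HasParity e g) (hh : HasParity f h) :
    HasParity (e + f) (g * h) := by
  rw [hasParity_iff] at *
  rw [map_mul, hg, hh, pow_add, smul_mul_smul_comm]

theorem HasParity.sum {ι : Type*} {s : Finset ι} {e : ℕ} {f : ι → Grass β}
    (h : ∀ i ∈ s, HasParity e (f i)) : HasParity e (∑ i ∈ s, f i) := by
  rw [hasParity_iff, map_sum, Finset.smul_sum]
  exact Finset.sum_congr rfl fun i hi => hasParity_iff.1 (h i hi)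

theorem HasParity.congr {e f : ℕ} {g : Grass β} (hg : HasParity e g)
    (h : (e : ZMod 2) = (f : ZMod 2)) : HasParity f g := by
  unfold HasParity at *
  rwa [← h]

theorem hasParity_algebraMap (r : ℝ) : HasParity 0 (algebraMap ℝ (Grass β) r) := by
  simp [hasParity_iff]

theorem hasParity_ι (v : β → ℝ) : HasParity 1 (ExteriorAlgebra.ι ℝ v : Grass β) := by
  rw [hasParity_iff, gi_ι]
  simp

/-- The `e`-th power of the parity involution. -/
def sp (e : ℕ) : Grass β →ₐ[ℝ] Grass β := gi ^ e

theorem sp_zero (g : Grass β) : sp 0 g = g := rfl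

theorem sp_one (g : Grass β) : sp 1 g = gi g := by simp [sp]

theorem sp_add (e f : ℕ) (g : Grass β) : sp (e + f) g = sp e (sp f g) := by
  simp [sp, pow_add]

theorem sp_succ (e : ℕ) (g : Grass β) : sp (e + 1) g = sp e (gi g) := by
  rw [sp_add, sp_one]

theorem sp_sp (e : ℕ) (g : Grass β) : sp e (sp e g) = g := by
  induction e with
  | zero => rfl
  | succ e ih =>
    have h : gi (sp e (gi g)) = sp e (gi (gi g)) := by
      rw [← sp_one, ← sp_add, add_comm, sp_add, sp_one]
    rw [sp_succ, sp_succ, h, gi_gi, ih]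

theorem sp_add_two (e : ℕ) (g : Grass β) : sp (e + 2) g = sp e g := by
  rw [sp_succ, sp_succ, gi_gi]

theorem HasParity.sp_eq {e p : ℕ} {g : Grass β} (hg : HasParity p g) :
    sp e g = (-1 : ℝ) ^ (e * p) • g := by
  induction e with
  | zero => simp [sp_zero]
  | succ e ih =>
    rw [sp_succ, hasParity_iff.1 hg, map_smul, ih, smul_smul, ← pow_add]
    congr 2
    ring

theorem ι_mul_eq (v : β → ℝ) (h : Grass β) :
    ExteriorAlgebra.ι ℝ v * h = gi h * ExteriorAlgebra.ι ℝ v := by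
  induction h using ExteriorAlgebra.induction with
  | algebraMap r => simp [Algebra.commutes]
  | ι w =>
    rw [gi_ι, neg_mul]
    exact eq_neg_of_add_eq_zero_left (ExteriorAlgebra.ι_add_mul_swap v w)
  | mul p q hp hq => rw [← mul_assoc, hp, mul_assoc, hq, map_mul, mul_assoc]
  | add p q hp hq => rw [mul_add, hp, hq, map_add, add_mul]

/-- The sign rule when only one factor is homogeneous: moving a generator across any element applies
the parity involution to that element, so an element of parity $e$ applies its $e$-th power. -/
theorem HasParity.mul_eq_sp_mul {e : ℕ} {w : Grass β} (hw : HasParity e w) (h : Grass β) :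
    w * h = Super.sp e h * w := by
  induction e using Nat.twoStepInduction generalizing h with
  | zero => exact even_mul_comm w h (by simpa [HasParity] using hw)
  | one =>
    rw [sp_one]
    have hw' : w ∈ CliffordAlgebra.evenOdd (0 : QuadraticForm ℝ (β → ℝ)) 1 := by
      simpa [HasParity] using hw
    clear hw
    induction w, hw' using CliffordAlgebra.odd_induction with
    | ι v => exact ι_mul_eq v h
    | add x y _ _ hx hy => rw [add_mul, mul_add, hx, hy]
    | ι_mul_ι_mul a b x _ hx =>
      change (ExteriorAlgebra.ι ℝ a * ExteriorAlgebra.ι ℝ b) * x * h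
        = gi h * ((ExteriorAlgebra.ι ℝ a * ExteriorAlgebra.ι ℝ b) * x)
      rw [mul_assoc, hx, ← mul_assoc, mul_assoc (ExteriorAlgebra.ι ℝ a), ι_mul_eq b, gi_gi,
        ← mul_assoc, ι_mul_eq a, mul_assoc, mul_assoc, mul_assoc]
  | more e h1 _ => rw [sp_add_two]; exact h1 (hasParity_add_two.1 hw) h

theorem HasParity.mul_comm_of_even {w : Grass β} (hw : HasParity 0 w) (h : Grass β) :
    w * h = h * w := hw.mul_eq_sp_mul h

theorem HasParity.mul_swap {e f : ℕ} {g h : Grass β} (hg : HasParity e g) (hh : HasParity f h) :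
    g * h = (-1 : ℝ) ^ (e * f) • (h * g) := by
  rw [hg.mul_eq_sp_mul, hh.sp_eq, smul_mul_assoc]

/-! ### The odd derivatives -/

/-- The left derivative of a Grassmann algebra along the generator with index `b`. -/
def dl (b : β) : Grass β →ₗ[ℝ] Grass β :=
  CliffordAlgebra.contractLeft (Q := (0 : QuadraticForm ℝ (β → ℝ)))
    (LinearMap.proj b : (β → ℝ) →ₗ[ℝ] ℝ)

theorem dl_ι_mul (b : β) (v : β → ℝ) (g : Grass β) :
    dl b (ExteriorAlgebra.ι ℝ v * g) = v b • g - ExteriorAlgebra.ι ℝ v * dl b g :=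
  CliffordAlgebra.contractLeft_ι_mul _ _ _

theorem dl_algebraMap (b : β) (r : ℝ) : dl b (algebraMap ℝ (Grass β) r) = 0 :=
  CliffordAlgebra.contractLeft_algebraMap _ _ _

theorem dl_one (b : β) : dl b (1 : Grass β) = 0 :=
  CliffordAlgebra.contractLeft_one _ _

theorem dl_ι (b : β) (v : β → ℝ) :
    dl b (ExteriorAlgebra.ι ℝ v) = algebraMap ℝ (Grass β) (v b) :=
  CliffordAlgebra.contractLeft_ι _ _ _

theorem dl_dl (b c : β) (g : Grass β) : dl b (dl c g) = -dl c (dl b g) :=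
  CliffordAlgebra.contractLeft_comm _ _ _

theorem dl_dl_self (b : β) (g : Grass β) : dl b (dl b g) = 0 :=
  CliffordAlgebra.contractLeft_contractLeft _ _

@[elab_as_elim]
theorem Grass.left_induction {motive : Grass β → Prop}
    (algebraMap : ∀ r, motive (algebraMap ℝ (Grass β) r))
    (add : ∀ x y, motive x → motive y → motive (x + y))
    (ι_mul : ∀ x v, motive x → motive (ExteriorAlgebra.ι ℝ v * x)) (g : Grass β) : motive g :=
  CliffordAlgebra.left_induction (Q := (0 : QuadraticForm ℝ (β → ℝ))) algebraMap add ι_mul g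

/-- Peeling generators off $g$ reduces this to the defining rule for a generator; each generator
passed contributes a sign, and these signs assemble into the involution. -/
theorem dl_mul (b : β) (g h : Grass β) : dl b (g * h) = dl b g * h + gi g * dl b h := by
  induction g using Grass.left_induction with
  | algebraMap r => simp [dl_algebraMap, ← Algebra.smul_def]
  | add x y hx hy => simp only [add_mul, map_add, hx, hy]; abel
  | ι_mul x v hx =>
    rw [mul_assoc, dl_ι_mul, dl_ι_mul, hx, map_mul, gi_ι, mul_add, sub_mul, smul_mul_assoc,
      mul_assoc, neg_mul, neg_mul, mul_assoc]
    abel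

theorem dl_gi (b : β) (g : Grass β) : dl b (gi g) = -gi (dl b g) := by
  induction g using Grass.left_induction with
  | algebraMap r => simp [dl_algebraMap]
  | add x y hx hy => simp only [map_add, hx, hy, neg_add]
  | ι_mul x v hx =>
    rw [map_mul, gi_ι, neg_mul, map_neg, dl_ι_mul, hx, dl_ι_mul, map_sub, map_mul, gi_ι, map_smul]
    simp

theorem HasParity.dl {e : ℕ} {g : Grass β} (b : β) (hg : HasParity e g) :
    HasParity (e + 1) (dl b g) := by
  rw [hasParity_iff] at *
  have h := dl_gi b g
  rw [hg, map_smul] at h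
  rw [pow_succ, mul_neg_one, neg_smul, h, neg_neg]

/-! ### The body -/

theorem body_algebraMap (r : ℝ) : body (algebraMap ℝ (Grass β) r) = r := by simp

theorem body_ι (v : β → ℝ) : body (ExteriorAlgebra.ι ℝ v : Grass β) = 0 := by
  simp [body, ExteriorAlgebra.algebraMapInv]

theorem body_gi (g : Grass β) : body (gi g) = body g := by
  induction g using Grass.left_induction with
  | algebraMap r => simp
  | add x y hx hy => simp [hx, hy]
  | ι_mul x v hx => simp only [map_mul, gi_ι, map_neg, body_ι]; simp

theorem HasParity.body_eq_zero {g : Grass β} (hg : HasParity 1 g) : body g = 0 := by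
  have h := body_gi g
  rw [hasParity_one_iff.1 hg, map_neg] at h
  linarith

/-! ### Elements killed by all odd derivatives -/

variable [Fintype β] [DecidableEq β]

/-- The Euler vector field of a Grassmann algebra. -/
def euler : Grass β →ₗ[ℝ] Grass β :=
  ∑ b, (LinearMap.mulLeft ℝ (ExteriorAlgebra.ι ℝ (Pi.single b (1 : ℝ)) : Grass β)) ∘ₗ dl b

theorem sum_smul_ι (v : β → ℝ) :
    ∑ b, v b • (ExteriorAlgebra.ι ℝ (Pi.single b (1 : ℝ)) : Grass β) = ExteriorAlgebra.ι ℝ v := by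
  simp_rw [← map_smul, ← map_sum]
  congr 1
  ext c
  simp [Finset.sum_apply, Pi.single_apply]

theorem euler_ι_mul (v : β → ℝ) (g : Grass β) :
    euler (ExteriorAlgebra.ι ℝ v * g)
      = ExteriorAlgebra.ι ℝ v * g + ExteriorAlgebra.ι ℝ v * euler g := by
  simp only [euler, LinearMap.sum_apply, LinearMap.comp_apply, LinearMap.mulLeft_apply, dl_ι_mul,
    mul_sub, Finset.sum_sub_distrib]
  nth_rewrite 2 [← sum_smul_ι v]
  rw [Finset.sum_mul, Finset.mul_sum, sub_eq_add_neg, ← Finset.sum_neg_distrib]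
  congr 1
  · refine Finset.sum_congr rfl fun b _ => ?_
    rw [mul_smul_comm, smul_mul_assoc]
  · refine Finset.sum_congr rfl fun b _ => ?_
    rw [← mul_assoc, ← mul_assoc, ← neg_mul]
    congr 1
    exact (eq_neg_of_add_eq_zero_left (ExteriorAlgebra.ι_add_mul_swap _ _)).symm

theorem euler_of_mem {p : ℕ} {g : Grass β} (hg : g ∈ ⋀[ℝ]^p (β → ℝ)) : euler g = (p : ℝ) • g := by
  induction hg using Submodule.pow_induction_on_left' with
  | algebraMap r => simp [euler, dl_algebraMap]
  | add x y i _ _ hx hy => rw [map_add, hx, hy, smul_add]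
  | mem_mul m hm i x _ hx =>
    obtain ⟨v, rfl⟩ := hm
    rw [euler_ι_mul, hx, mul_smul_comm]
    push_cast
    rw [add_smul, one_smul, add_comm]

/-- The Euler field $\sum_b\xi_b\partial_b$ multiplies the degree $p$ component by $p$. If all odd
derivatives vanish, so does the Euler field on $g$, and only degree zero survives. -/
theorem eq_algebraMap_of_dl_eq_zero {g : Grass β} (hg : ∀ b, dl b g = 0) :
    g = algebraMap ℝ (Grass β) (body g) := by
  classical
  have hE : euler g = 0 := by simp [euler, hg]
  let 𝒜 : ℕ → Submodule ℝ (Grass β) := fun p => ⋀[ℝ]^p (β → ℝ)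
  have hcomp : ∀ h : Grass β, ∀ p,
      (DirectSum.decompose 𝒜 (euler h) p : Grass β)
        = (p : ℝ) • (DirectSum.decompose 𝒜 h p : Grass β) := by
    intro h p
    induction h using DirectSum.Decomposition.inductionOn 𝒜 with
    | zero => simp
    | @homogeneous i m =>
      rw [euler_of_mem m.2, DirectSum.decompose_smul, DirectSum.decompose_coe]
      by_cases hip : i = p
      · subst hip; rw [DirectSum.smul_apply]; simp
      · rw [DirectSum.smul_apply, DirectSum.of_eq_of_ne _ _ _ (Ne.symm hip)]; simp
    | add x y hx hy =>
      rw [map_add, DirectSum.decompose_add, DirectSum.decompose_add, DirectSum.add_apply,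
        DirectSum.add_apply, Submodule.coe_add, Submodule.coe_add, hx, hy, smul_add]
  have hz : ∀ p, p ≠ 0 → (DirectSum.decompose 𝒜 g p : Grass β) = 0 := by
    intro p hp
    have h := hcomp g p
    rw [hE] at h
    simpa [hp] using h.symm
  have hg0 : g = (DirectSum.decompose 𝒜 g 0 : Grass β) := by
    conv_lhs => rw [← DirectSum.sum_support_decompose 𝒜 g]
    refine Finset.sum_eq_single 0 (fun p _ hp => hz p hp) fun h => ?_
    simpa using h
  have hmem : g ∈ 𝒜 0 := hg0 ▸ (DirectSum.decompose 𝒜 g 0).2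
  have h1 : g ∈ (1 : Submodule ℝ (Grass β)) := by simpa [𝒜] using hmem
  obtain ⟨r, rfl⟩ := Submodule.mem_one.1 h1
  rw [body_algebraMap]

/-- `Van k g` means that `g` vanishes to order `k` in the odd generators. -/
def Van : ℕ → Grass β → Prop
  | 0 => fun _ => True
  | k + 1 => fun g => body g = 0 ∧ ∀ b, Van k (dl b g)

theorem Van.pred {k : ℕ} {g : Grass β} (h : Van (k + 1) g) : Van k g := by
  induction k generalizing g with
  | zero => trivial
  | succ k ih => exact ⟨h.1, fun b => ih (h.2 b)⟩

theorem Van.zero (k : ℕ) : Van k (0 : Grass β) := by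
  induction k with
  | zero => trivial
  | succ k ih => exact ⟨map_zero _, fun b => by rw [map_zero]; exact ih⟩

theorem Van.add {k : ℕ} {g h : Grass β} (hg : Van k g) (hh : Van k h) : Van k (g + h) := by
  induction k generalizing g h with
  | zero => trivial
  | succ k ih =>
    exact ⟨by rw [map_add, hg.1, hh.1, add_zero], fun b => by
      rw [map_add]; exact ih (hg.2 b) (hh.2 b)⟩

theorem Van.neg {k : ℕ} {g : Grass β} (hg : Van k g) : Van k (-g) := by
  induction k generalizing g with
  | zero => trivial
  | succ k ih =>
    exact ⟨by rw [map_neg, hg.1, neg_zero], fun b => by rw [map_neg]; exact ih (hg.2 b)⟩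

theorem Van.sum {ι : Type*} {s : Finset ι} {k : ℕ} {f : ι → Grass β}
    (h : ∀ i ∈ s, Van k (f i)) : Van k (∑ i ∈ s, f i) :=
  Finset.sum_induction f (Van k) (fun _ _ => Van.add) (Van.zero k) h

theorem Van.gi {k : ℕ} {g : Grass β} (hg : Van k g) : Van k (gi g) := by
  induction k generalizing g with
  | zero => trivial
  | succ k ih =>
    exact ⟨by rw [body_gi, hg.1], fun b => by rw [dl_gi]; exact (ih (hg.2 b)).neg⟩

theorem Van.mul_left {k : ℕ} {g : Grass β} (h : Grass β) (hg : Van k g) : Van k (h * g) := by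
  induction k generalizing g h with
  | zero => trivial
  | succ k ih =>
    refine ⟨by rw [map_mul, hg.1, mul_zero], fun b => ?_⟩
    rw [dl_mul]
    exact (ih _ hg.pred).add (ih _ (hg.2 b))

theorem Van.mul_right {k : ℕ} {g : Grass β} (hg : Van k g) (h : Grass β) : Van k (g * h) := by
  induction k generalizing g h with
  | zero => trivial
  | succ k ih =>
    refine ⟨by rw [map_mul, hg.1, zero_mul], fun b => ?_⟩
    rw [dl_mul]
    exact (ih (hg.2 b) _).add (ih hg.pred.gi _)

/-- Induction on $k+l$: each term of the Leibniz rule lowers the order of one factor only. If that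
factor has order zero, the term keeps the full order of the other one. -/
theorem Van.mul {k l : ℕ} {g h : Grass β} (hg : Van k g) (hh : Van l h) : Van (k + l) (g * h) := by
  obtain ⟨n, hn⟩ : ∃ n, n = k + l := ⟨_, rfl⟩
  induction n generalizing k l g h with
  | zero => rw [← hn]; trivial
  | succ n ih =>
    rw [← hn]
    have hb : body (g * h) = 0 := by
      rw [map_mul]
      cases k with
      | zero =>
        cases l with
        | zero => omega
        | succ l => rw [hh.1, mul_zero]
      | succ k => rw [hg.1, zero_mul]
    refine ⟨hb, fun b => ?_⟩
    rw [dl_mul]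
    refine Van.add ?_ ?_
    · cases k with
      | zero =>
        cases l with
        | zero => omega
        | succ l => rw [show n = l by omega]; exact hh.pred.mul_left _
      | succ k => rw [show n = k + l by omega]; exact ih (hg.2 b) hh (by omega)
    · cases l with
      | zero =>
        cases k with
        | zero => omega
        | succ k => rw [show n = k by omega]; exact hg.pred.gi.mul_right _
      | succ l => rw [show n = k + l by omega]; exact ih hg.gi (hh.2 b) (by omega)

theorem Van.one_of_body_eq_zero {g : Grass β} (h : body g = 0) : Van 1 g := ⟨h, fun _ => trivial⟩

theorem Van.pow {g : Grass β} (h : body g = 0) (k : ℕ) : Van k (g ^ k) := by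
  induction k with
  | zero => trivial
  | succ k ih => rw [pow_succ]; exact ih.mul (Van.one_of_body_eq_zero h)

/-- There are only `Fintype.card β` odd directions. The induction is over a set $T$ outside of which
all derivatives of the element vanish: $\partial_c g$ is killed by $\partial_c$ as well, so it is
handled with one direction fewer, and once it is zero so is $g$. -/
theorem Van.eq_zero {g : Grass β} (h : Van (Fintype.card β + 1) g) : g = 0 := by
  have key : ∀ (T : Finset β) (g : Grass β), (∀ b ∉ T, dl b g = 0) → Van (T.card + 1) g →
      g = 0 := by
    intro T
    induction T using Finset.induction_on with
    | empty =>
      intro g hg h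
      rw [eq_algebraMap_of_dl_eq_zero fun b => hg b (Finset.notMem_empty b), h.1, map_zero]
    | insert c T hc ih =>
      intro g hg h
      rw [Finset.card_insert_of_notMem hc] at h
      have hcg : dl c g = 0 := by
        refine ih _ (fun b hb => ?_) (h.2 c)
        by_cases hbc : b = c
        · rw [hbc, dl_dl_self]
        · rw [dl_dl, hg b (by simp [hb, hbc]), map_zero, neg_zero]
      refine ih g (fun b hb => ?_) h.pred
      by_cases hbc : b = c
      · rw [hbc, hcg]
      · exact hg b (by simp [hb, hbc])
  exact key Finset.univ g (fun b hb => absurd (Finset.mem_univ b) hb) h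

theorem eq_of_body_eq_of_dl_eq {g h : Grass β} (hb : body g = body h)
    (hd : ∀ b, dl b g = dl b h) : g = h := by
  have := eq_algebraMap_of_dl_eq_zero (g := g - h) fun b => by rw [map_sub, hd b, sub_self]
  rw [map_sub, hb, sub_self, map_zero] at this
  exact sub_eq_zero.1 this

/-- An element is its body plus a nilpotent soul, and the body is central. -/
theorem isUnit_iff_body_ne_zero {g : Grass β} : IsUnit g ↔ body g ≠ 0 := by
  constructor
  · intro h
    exact (h.map (body (β := β))).ne_zero
  · intro h
    have hn : IsNilpotent (g - algebraMap ℝ (Grass β) (body g)) :=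
      ⟨Fintype.card β + 1, (Van.pow (by simp) _).eq_zero⟩
    have hu : IsUnit (algebraMap ℝ (Grass β) (body g)) := (IsUnit.mk0 _ h).map _
    have hc : Commute (g - algebraMap ℝ (Grass β) (body g)) (algebraMap ℝ (Grass β) (body g)) :=
      (Algebra.commutes _ _).symm
    simpa using hn.isUnit_add_left_of_commute hu hc

theorem HasParity.ringInverse {g : Grass β} (hg : HasParity 0 g) :
    HasParity 0 (Ring.inverse g) := by
  by_cases h : IsUnit g
  · rw [hasParity_zero_iff]
    have h1 : gi (Ring.inverse g) * g = 1 := by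
      nth_rewrite 2 [← hasParity_zero_iff.1 hg]
      rw [← map_mul, Ring.inverse_mul_cancel _ h, map_one]
    rw [← Ring.inverse_mul_cancel _ h] at h1
    exact h.mul_right_cancel h1
  · rw [Ring.inverse_non_unit _ h]
    exact HasParity.zero

/-! ### Substitution -/

variable [Fintype β'] [DecidableEq β']

/-- Odd elements anticommute with themselves, hence square to zero; so the first branch of the
definition of `subst` applies, and the dummy branch never occurs for odd arguments. -/
theorem subst_ι {η : β' → Grass β} (hη : ∀ b, HasParity 1 (η b)) (v : β' → ℝ) :
    subst η (ExteriorAlgebra.ι ℝ v) = ∑ b, v b • η b := by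
  have h : ∀ v : β' → ℝ,
      Fintype.linearCombination ℝ η v * Fintype.linearCombination ℝ η v = 0 := by
    intro v
    have hp : HasParity 1 (Fintype.linearCombination ℝ η v) := by
      rw [Fintype.linearCombination_apply]
      exact HasParity.sum fun i _ => (hη i).smul _
    have h1 := hp.mul_swap hp
    have h2 : (2 : ℝ) • (Fintype.linearCombination ℝ η v * Fintype.linearCombination ℝ η v) = 0 := by
      rw [two_smul]
      nth_rewrite 1 [h1]
      simp
    simpa using h2
  rw [subst, dif_pos h, ExteriorAlgebra.lift_ι_apply, Fintype.linearCombination_apply]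

theorem body_subst {η : β' → Grass β} (hη : ∀ b, HasParity 1 (η b)) (g : Grass β') :
    body (subst η g) = body g := by
  induction g using Grass.left_induction with
  | algebraMap r => simp
  | add x y hx hy => simp [hx, hy]
  | ι_mul x v hx =>
    rw [map_mul, map_mul, map_mul, subst_ι hη, body_ι, zero_mul, map_sum]
    simp [(hη _).body_eq_zero]

theorem gi_subst {η : β' → Grass β} (hη : ∀ b, HasParity 1 (η b)) (g : Grass β') :
    gi (subst η g) = subst η (gi g) := by
  induction g using Grass.left_induction with
  | algebraMap r => simp
  | add x y hx hy => simp only [map_add, hx, hy]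
  | ι_mul x v hx =>
    simp only [map_mul, hx, subst_ι hη, gi_ι, map_neg, map_sum, map_smul,
      hasParity_one_iff.1 (hη _), smul_neg, Finset.sum_neg_distrib]

/-- The chain rule for a purely odd substitution. Here $\partial_b\eta_c$ is even, so it moves past
the other factors without a sign. -/
theorem dl_subst {η : β' → Grass β} (hη : ∀ b, HasParity 1 (η b)) (b : β) (g : Grass β') :
    dl b (subst η g) = ∑ c, dl b (η c) * subst η (dl c g) := by
  induction g using Grass.left_induction with
  | algebraMap r => simp [dl_algebraMap]
  | add x y hx hy => simp only [map_add, hx, hy, mul_add, Finset.sum_add_distrib]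
  | ι_mul x v hx =>
    have hp : HasParity 1 (subst η (ExteriorAlgebra.ι ℝ v)) := by
      rw [subst_ι hη]
      exact HasParity.sum fun i _ => (hη i).smul _
    rw [map_mul, dl_mul, hx, hasParity_one_iff.1 hp]
    simp only [dl_ι_mul, map_sub, map_smul, map_mul, mul_sub, Finset.sum_sub_distrib]
    rw [neg_mul, sub_eq_add_neg]
    congr 1
    · rw [subst_ι hη, map_sum, Finset.sum_mul]
      refine Finset.sum_congr rfl fun c _ => ?_
      rw [map_smul, smul_mul_assoc, mul_smul_comm]
    · rw [Finset.mul_sum]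
      congr 1
      refine Finset.sum_congr rfl fun c _ => ?_
      have he : HasParity 0 (dl b (η c)) := hasParity_add_two.1 ((hη c).dl b)
      rw [← mul_assoc, ← he.mul_comm_of_even, mul_assoc]

end GrassAlgebra

/-! ### Calculus of superfunctions -/

section Calculus

open Filter Topology

variable {α β : Type} [Fintype α] [Fintype β] [DecidableEq α] [DecidableEq β]

instance grassFiniteDimensional (β : Type) [Fintype β] : FiniteDimensional ℝ (Grass β) :=
  Module.Basis.finiteDimensional_of_finite (grassBasis β)

/-- The multiplication of a Grassmann algebra as a continuous bilinear map. -/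
def mulCLM (β : Type) [Fintype β] : Grass β →L[ℝ] Grass β →L[ℝ] Grass β :=
  LinearMap.toContinuousLinearMap
    ((LinearMap.toContinuousLinearMap : (Grass β →ₗ[ℝ] Grass β) ≃ₗ[ℝ] _).toLinearMap ∘ₗ
      LinearMap.mul ℝ (Grass β))

theorem mulCLM_apply (g h : Grass β) : mulCLM β g h = g * h := rfl

/-! ### Smoothness of maps into a Grassmann algebra. -/

section Smooth

variable {E : Type*} [NormedAddCommGroup E] [NormedSpace ℝ E] {f g : E → Grass β} {x : E}
  {n : WithTop ℕ∞}

theorem contDiffAt_gmul (hf : ContDiffAt ℝ n f x) (hg : ContDiffAt ℝ n g x) :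
    ContDiffAt ℝ n (fun y => f y * g y) x :=
  (mulCLM β).isBoundedBilinearMap.contDiff.contDiffAt.comp x (hf.prodMk hg)

theorem differentiableAt_gmul (hf : DifferentiableAt ℝ f x) (hg : DifferentiableAt ℝ g x) :
    DifferentiableAt ℝ (fun y => f y * g y) x :=
  DifferentiableAt.comp (g := fun p : Grass β × Grass β => mulCLM β p.1 p.2) x
    ((mulCLM β).isBoundedBilinearMap.differentiableAt (f x, g x)) (hf.prodMk hg)

theorem fderiv_gmul (hf : DifferentiableAt ℝ f x) (hg : DifferentiableAt ℝ g x) (v : E) :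
    fderiv ℝ (fun y => f y * g y) x v = fderiv ℝ f x v * g x + f x * fderiv ℝ g x v := by
  have h := (mulCLM β).fderiv_of_bilinear hf hg
  have h2 := congrArg (fun L => L v) h
  simp only [mulCLM_apply] at h2
  rw [h2]
  simp [mulCLM_apply, ContinuousLinearMap.precompR, ContinuousLinearMap.precompL, add_comm]

theorem contDiffAt_linear {V : Type*} [NormedAddCommGroup V] [NormedSpace ℝ V]
    (L : Grass β →ₗ[ℝ] V) (hf : ContDiffAt ℝ n f x) : ContDiffAt ℝ n (fun y => L (f y)) x :=
  (LinearMap.toContinuousLinearMap L).contDiff.contDiffAt.comp x hf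

theorem differentiableAt_linear {V : Type*} [NormedAddCommGroup V] [NormedSpace ℝ V]
    (L : Grass β →ₗ[ℝ] V) (hf : DifferentiableAt ℝ f x) : DifferentiableAt ℝ (fun y => L (f y)) x :=
  (LinearMap.toContinuousLinearMap L).differentiableAt.comp x hf

theorem fderiv_linear {V : Type*} [NormedAddCommGroup V] [NormedSpace ℝ V]
    (L : Grass β →ₗ[ℝ] V) (hf : DifferentiableAt ℝ f x) (v : E) :
    fderiv ℝ (fun y => L (f y)) x v = L (fderiv ℝ f x v) := by
  have h := (LinearMap.toContinuousLinearMap L).hasFDerivAt.comp x hf.hasFDerivAt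
  have h2 : HasFDerivAt (fun y => L (f y))
    ((LinearMap.toContinuousLinearMap L).comp (fderiv ℝ f x)) x := h
  rw [h2.fderiv]
  rfl

theorem contDiffAt_algebraMap {h : E → ℝ} (hh : ContDiffAt ℝ n h x) :
    ContDiffAt ℝ n (fun y => algebraMap ℝ (Grass β) (h y)) x :=
  (LinearMap.toContinuousLinearMap (Algebra.linearMap ℝ (Grass β))).contDiff.contDiffAt.comp x hh

/-- The norm on the Grassmann algebra is only a vector space norm. Left multiplication embeds the
algebra into its continuous endomorphisms, a Banach algebra in which inversion is smooth, and
evaluation at $1$ recovers the inverse. Units are detected by the body, so they form a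
neighbourhood. -/
theorem contDiffAt_ringInverse (hf : ContDiffAt ℝ n f x) (hu : IsUnit (f x)) :
    ContDiffAt ℝ n (fun y => Ring.inverse (f y)) x := by
  set L : Grass β → (Grass β →L[ℝ] Grass β) := fun g => mulCLM β g
  have hinv : ∀ g : Grass β, IsUnit g → Ring.inverse g = Ring.inverse (L g) 1 := by
    intro g hg
    have h1 : L g * L (Ring.inverse g) = 1 := by
      ext h
      change g * (Ring.inverse g * h) = h
      rw [← mul_assoc, Ring.mul_inverse_cancel _ hg, one_mul]
    have h2 : L (Ring.inverse g) * L g = 1 := by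
      ext h
      change Ring.inverse g * (g * h) = h
      rw [← mul_assoc, Ring.inverse_mul_cancel _ hg, one_mul]
    have h3 : Ring.inverse (L g) = L (Ring.inverse g) :=
      Ring.inverse_unit (⟨L g, L (Ring.inverse g), h1, h2⟩ : (Grass β →L[ℝ] Grass β)ˣ)
    rw [h3]
    exact (mul_one _).symm
  have hLu : IsUnit (L (f x)) :=
    ⟨⟨L (f x), L (Ring.inverse (f x)), by
      ext h
      change f x * (Ring.inverse (f x) * h) = h
      rw [← mul_assoc, Ring.mul_inverse_cancel _ hu, one_mul], by
      ext h
      change Ring.inverse (f x) * (f x * h) = h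
      rw [← mul_assoc, Ring.inverse_mul_cancel _ hu, one_mul]⟩, rfl⟩
  have hL : ContDiffAt ℝ n (fun y => L (f y)) x := (mulCLM β).contDiff.contDiffAt.comp x hf
  have h1 : ContDiffAt ℝ n (fun y => Ring.inverse (L (f y)) 1) x := by
    obtain ⟨w, hw⟩ := hLu
    have h0 : ContDiffAt ℝ n Ring.inverse (L (f x)) := by
      rw [← hw]
      exact _root_.contDiffAt_ringInverse ℝ w
    exact (h0.comp x hL).clm_apply contDiffAt_const
  refine h1.congr_of_eventuallyEq ?_
  have hb : ContinuousAt (fun y => body (f y)) x :=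
    (LinearMap.toContinuousLinearMap
      (body (β := β)).toLinearMap).continuous.continuousAt.comp hf.continuousAt
  filter_upwards [hb.eventually_ne (isUnit_iff_body_ne_zero.1 hu)] with y hy
  exact hinv _ (isUnit_iff_body_ne_zero.2 hy)

end Smooth

/-! ### Partial derivatives of superfunctions and their sign rules. -/

variable {F G : SFun α β} {x : α → ℝ}

theorem _root_.ContDiffAt.sDiff (hF : ContDiffAt ℝ ∞ F x) : DifferentiableAt ℝ F x :=
  hF.differentiableAt (by simp)

theorem contDiffAt_pd (A : α ⊕ β) (hF : ContDiffAt ℝ ∞ F x) : ContDiffAt ℝ ∞ (pd A F) x := by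
  cases A with
  | inl a =>
    have h : ContDiffAt ℝ ∞ (fderiv ℝ F) x := hF.fderiv_right (by simp)
    exact h.clm_apply contDiffAt_const
  | inr b => exact contDiffAt_linear (dl b) hF

theorem pd_inr (b : β) (F : SFun α β) (x : α → ℝ) : pd (Sum.inr b) F x = dl b (F x) := rfl

theorem pd_eventuallyEq (A : α ⊕ β) (h : F =ᶠ[𝓝 x] G) : pd A F =ᶠ[𝓝 x] pd A G := by
  cases A with
  | inl a => exact (h.fderiv (𝕜 := ℝ)).mono fun y hy => by simp only [pd, hy]
  | inr b => exact h.mono fun y hy => by simp only [pd, hy]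

theorem pd_congr (A : α ⊕ β) (h : F =ᶠ[𝓝 x] G) : pd A F x = pd A G x :=
  (pd_eventuallyEq A h).self_of_nhds

theorem pd_mul (A : α ⊕ β) (hF : DifferentiableAt ℝ F x) (hG : DifferentiableAt ℝ G x) :
    pd A (fun y => F y * G y) x = pd A F x * G x + sp (par A) (F x) * pd A G x := by
  cases A with
  | inl a => exact fderiv_gmul hF hG _
  | inr b => rw [pd_inr, dl_mul, par, sp_one, pd_inr, pd_inr]

theorem pd_add (A : α ⊕ β) (hF : DifferentiableAt ℝ F x) (hG : DifferentiableAt ℝ G x) :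
    pd A (fun y => F y + G y) x = pd A F x + pd A G x := by
  cases A with
  | inl a => simp only [pd]; rw [fderiv_fun_add hF hG]; rfl
  | inr b => simp only [pd_inr, map_add]

theorem pd_sub (A : α ⊕ β) (hF : DifferentiableAt ℝ F x) (hG : DifferentiableAt ℝ G x) :
    pd A (fun y => F y - G y) x = pd A F x - pd A G x := by
  cases A with
  | inl a => simp only [pd]; rw [fderiv_fun_sub hF hG]; rfl
  | inr b => simp only [pd_inr, map_sub]

theorem pd_smul (A : α ⊕ β) (c : ℝ) (hF : DifferentiableAt ℝ F x) :
    pd A (fun y => c • F y) x = c • pd A F x := by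
  cases A with
  | inl a => simp only [pd]; rw [fderiv_fun_const_smul hF]; rfl
  | inr b => simp only [pd_inr, map_smul]

theorem pd_sum (A : α ⊕ β) {ι : Type*} {s : Finset ι} {f : ι → SFun α β}
    (hf : ∀ i ∈ s, DifferentiableAt ℝ (f i) x) :
    pd A (fun y => ∑ i ∈ s, f i y) x = ∑ i ∈ s, pd A (f i) x := by
  cases A with
  | inl a => simp only [pd]; rw [fderiv_fun_sum hf]; simp
  | inr b => simp only [pd_inr, map_sum]

theorem pd_linear_inl (a : α) (L : Grass β →ₗ[ℝ] Grass β) (hF : DifferentiableAt ℝ F x) :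
    pd (Sum.inl a) (fun y => L (F y)) x = L (pd (Sum.inl a) F x) :=
  fderiv_linear L hF _

theorem pd_zero (A : α ⊕ β) : pd A (fun _ => (0 : Grass β)) x = 0 := by
  cases A with
  | inl a => simp [pd]
  | inr b => simp [pd_inr]

theorem pd_coordFn (A B : α ⊕ β) : pd A (coordFn B) x = if A = B then 1 else 0 := by
  cases A with
  | inl a =>
    cases B with
    | inl a' =>
      have h : coordFn (β := β) (Sum.inl a' : α ⊕ β) = fun y => (LinearMap.toContinuousLinearMap
        (Algebra.linearMap ℝ (Grass β) ∘ₗ (LinearMap.proj a' : (α → ℝ) →ₗ[ℝ] ℝ))) y := rfl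
      simp only [pd]
      rw [h, ContinuousLinearMap.fderiv]
      by_cases haa : a = a'
      · subst haa; simp
      · simp [haa, Ne.symm haa]
    | inr b => simp [pd, coordFn]
  | inr b =>
    cases B with
    | inl a => simp [pd_inr, coordFn, dl_algebraMap]
    | inr b' =>
      rw [pd_inr, coordFn, dl_ι]
      by_cases hbb : b = b'
      · subst hbb; simp
      · simp [hbb]

theorem contDiffAt_coordFn (A : α ⊕ β) : ContDiffAt ℝ ∞ (coordFn A) x := by
  cases A with
  | inl a => exact contDiffAt_algebraMap ((contDiff_apply ℝ ℝ a).contDiffAt)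
  | inr b => exact contDiffAt_const

theorem hasParity_coordFn (A : α ⊕ β) : HasParity (par A) (coordFn A x) := by
  cases A with
  | inl a => exact hasParity_algebraMap _
  | inr b => exact hasParity_ι _

theorem pd_sp (A : α ⊕ β) (e : ℕ) (hF : DifferentiableAt ℝ F x) :
    pd A (fun y => sp e (F y)) x = (-1 : ℝ) ^ (e * par A) • sp e (pd A F x) := by
  cases A with
  | inl a => simpa [par] using pd_linear_inl a (sp e).toLinearMap hF
  | inr b =>
    simp only [pd_inr, par, mul_one]
    induction e with
    | zero => simp [sp_zero]
    | succ e ih =>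
      have h2 : ∀ g : Grass β, dl b (sp e g) = (-1 : ℝ) ^ e • sp e (dl b g) := by
        intro g
        clear ih
        induction e generalizing g with
        | zero => simp [sp_zero]
        | succ e ih => rw [sp_succ, ih, dl_gi, sp_succ, map_neg, pow_succ]; simp
      rw [sp_succ, h2, dl_gi, sp_succ, map_neg, pow_succ]
      simp

theorem hasParity_pd {e : ℕ} (A : α ⊕ β) (hF : ∀ᶠ y in 𝓝 x, HasParity e (F y)) :
    HasParity (e + par A) (pd A F x) := by
  cases A with
  | inl a =>
    by_cases hd : DifferentiableAt ℝ F x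
    · have h1 : (fun y => gi (F y)) =ᶠ[𝓝 x] fun y => (-1 : ℝ) ^ e • F y :=
        hF.mono fun y hy => hasParity_iff.1 hy
      have h2 := pd_congr (Sum.inl a : α ⊕ β) h1
      rw [pd_smul _ _ hd] at h2
      rw [par, add_zero, hasParity_iff, ← h2]
      exact (pd_linear_inl a (gi (β := β)).toLinearMap hd).symm
    -- Where $F$ is not differentiable, `fderiv` is zero by convention, and zero has every parity.
    · simp only [pd]
      rw [fderiv_zero_of_not_differentiableAt hd]
      exact HasParity.zero
  | inr b => exact hF.self_of_nhds.dl b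

/-- Two even derivatives commute by the symmetry of the second derivative, two odd ones anticommute
as contractions, and a mixed pair commutes because contraction is a fixed linear map. -/
theorem pd_comm (A B : α ⊕ β) (hF : ContDiffAt ℝ ∞ F x) :
    pd A (pd B F) x = (-1 : ℝ) ^ (par A * par B) • pd B (pd A F) x := by
  have hd : ContDiffAt ℝ ∞ (fderiv ℝ F) x := hF.fderiv_right (by simp)
  cases A with
  | inl a =>
    cases B with
    | inl a' =>
      have hs : IsSymmSndFDerivAt ℝ F x := hF.isSymmSndFDerivAt (by
        rw [minSmoothness_of_isRCLikeNormedField]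
        exact WithTop.coe_le_coe.2 le_top)
      have key : ∀ a a' : α, pd (Sum.inl a : α ⊕ β) (pd (Sum.inl a') F) x
          = fderiv ℝ (fderiv ℝ F) x (Pi.single a 1) (Pi.single a' 1) := by
        intro a a'
        simp only [pd]
        rw [fderiv_clm_apply (hd.differentiableAt (by simp)) (differentiableAt_const _)]
        simp
      rw [key, key]
      simpa [par] using hs _ _
    | inr b =>
      rw [par, par, zero_mul, pow_zero, one_smul]
      exact pd_linear_inl a (dl b) hF.sDiff
  | inr b =>
    cases B with
    | inl a =>
      rw [par, par, mul_zero, pow_zero, one_smul]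
      exact (pd_linear_inl a (dl b) hF.sDiff).symm
    | inr b' =>
      simp only [pd_inr, par]
      simpa using dl_dl b b' (F x)

/-- `F` is smooth in a neighbourhood of `x`. -/
def Sm (F : SFun α β) (x : α → ℝ) : Prop := ∀ᶠ y in 𝓝 x, ContDiffAt ℝ ∞ F y

theorem Sm.contDiffAt (h : Sm F x) : ContDiffAt ℝ ∞ F x := h.self_of_nhds

theorem Sm.differentiableAt (h : Sm F x) : DifferentiableAt ℝ F x := h.contDiffAt.sDiff

theorem Sm.of_contDiffOn {U : Set (α → ℝ)} (hU : IsOpen U) (h : ContDiffOn ℝ ∞ F U) (hx : x ∈ U) :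
    Sm F x :=
  (hU.eventually_mem hx).mono fun _ hy => h.contDiffAt (hU.mem_nhds hy)

theorem Sm.pd (A : α ⊕ β) (h : Sm F x) : Sm (pd A F) x := h.mono fun _ hy => contDiffAt_pd A hy

theorem Sm.mul (hF : Sm F x) (hG : Sm G x) : Sm (fun y => F y * G y) x :=
  (hF.and hG).mono fun _ hy => contDiffAt_gmul hy.1 hy.2

theorem Sm.add (hF : Sm F x) (hG : Sm G x) : Sm (fun y => F y + G y) x :=
  (hF.and hG).mono fun _ hy => hy.1.add hy.2

theorem Sm.sub (hF : Sm F x) (hG : Sm G x) : Sm (fun y => F y - G y) x :=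
  (hF.and hG).mono fun _ hy => hy.1.sub hy.2

theorem Sm.smul (c : ℝ) (hF : Sm F x) : Sm (fun y => c • F y) x :=
  hF.mono fun _ hy => hy.const_smul c

theorem Sm.sum {ι : Type*} {s : Finset ι} {f : ι → SFun α β} (h : ∀ i ∈ s, Sm (f i) x) :
    Sm (fun y => ∑ i ∈ s, f i y) x :=
  ((Filter.eventually_all_finset s).2 h).mono fun _ hy => ContDiffAt.sum fun i hi => hy i hi

theorem Sm.sp (e : ℕ) (hF : Sm F x) : Sm (fun y => sp e (F y)) x :=
  hF.mono fun _ hy => contDiffAt_linear (Super.sp e).toLinearMap hy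

theorem Sm.congr (hF : Sm F x) (h : G =ᶠ[𝓝 x] F) : Sm G x :=
  (hF.and h.eventually_nhds).mono fun _ hy => hy.1.congr_of_eventuallyEq hy.2

theorem Sm.coordFn (A : α ⊕ β) : Sm (coordFn A) x :=
  Eventually.of_forall fun _ => contDiffAt_coordFn A

theorem Sm.const (g : Grass β) : Sm (fun _ : α → ℝ => g) x :=
  Eventually.of_forall fun _ => contDiffAt_const

theorem Sm.pd_comm (A B : α ⊕ β) (hF : Sm F x) :
    Super.pd A (Super.pd B F) =ᶠ[𝓝 x]
      fun y => (-1 : ℝ) ^ (par A * par B) • Super.pd B (Super.pd A F) y :=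
  hF.mono fun _ hy => Super.pd_comm A B hy

end Calculus

/-! ### Pullback of superfunctions -/

section Pullback

open Filter Topology

variable {α β α' β' : Type} [Fintype α] [Fintype β] [DecidableEq α] [DecidableEq β]
  [Fintype α'] [Fintype β'] [DecidableEq α'] [DecidableEq β']

/-- The soul of an even component of a map of superdomains. -/
def soul (φ : α' ⊕ β' → SFun α β) (ν : α') : SFun α β := fun x =>
  φ (Sum.inl ν) x - algebraMap ℝ (Grass β) (bodyMap φ x ν)

/-- The homogeneous terms of the Taylor expansion which defines the pullback. -/
def tay (φ : α' ⊕ β' → SFun α β) : ℕ → SFun α' β' → SFun α β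
  | 0 => fun F x => subst (fun b => φ (Sum.inr b) x) (F (bodyMap φ x))
  | k + 1 => fun F x => ∑ ν, soul φ ν x * tay φ k (pd (Sum.inl ν) F) x

/-- The components of `φ` have the right parity at `x`. -/
def ParityAt (φ : α' ⊕ β' → SFun α β) (x : α → ℝ) : Prop := ∀ A, HasParity (par A) (φ A x)

variable {φ : α' ⊕ β' → SFun α β} {F G : SFun α' β'} {x : α → ℝ}

theorem body_soul (ν : α') : body (soul φ ν x) = 0 := by simp [soul, bodyMap]

theorem ParityAt.odd (h : ParityAt φ x) (b : β') : HasParity 1 (φ (Sum.inr b) x) := h (Sum.inr b)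

theorem ParityAt.soul (h : ParityAt φ x) (ν : α') : HasParity 0 (soul φ ν x) :=
  (h (Sum.inl ν)).sub (hasParity_algebraMap _)

theorem tay_congr (k : ℕ) (h : F =ᶠ[𝓝 (bodyMap φ x)] G) : tay φ k F x = tay φ k G x := by
  induction k generalizing F G with
  | zero => simp only [tay]; rw [h.self_of_nhds]
  | succ k ih =>
    simp only [tay]
    exact Finset.sum_congr rfl fun ν _ => by rw [ih (pd_eventuallyEq _ h)]

theorem iteratedFDeriv_succ_eq (k : ℕ) {y : α' → ℝ} (hF : Sm F y) (m : Fin k → α' → ℝ) (ν : α') :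
    iteratedFDeriv ℝ (k + 1) F y (Fin.snoc m (Pi.single ν 1) : Fin (k + 1) → α' → ℝ) =
      iteratedFDeriv ℝ k (pd (Sum.inl ν : α' ⊕ β') F) y m := by
  rw [iteratedFDeriv_succ_apply_right]
  have hd : ContDiffAt ℝ k (fderiv ℝ F) y :=
    (hF.contDiffAt.fderiv_right (m := ∞) (by simp)).of_le (WithTop.coe_le_coe.2 le_top)
  have h := (ContinuousLinearMap.apply ℝ (Grass β') (Pi.single ν (1 : ℝ) : α' → ℝ)
    ).iteratedFDeriv_comp_left (f := fderiv ℝ F) (x := y) hd (i := k) le_rfl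
  have h2 : iteratedFDeriv ℝ k (pd (Sum.inl ν : α' ⊕ β') F) y =
    iteratedFDeriv ℝ k ((ContinuousLinearMap.apply ℝ (Grass β') (Pi.single ν (1 : ℝ) : α' → ℝ)) ∘
      fderiv ℝ F) y := rfl
  rw [h2, h]
  simp

/-- The recursion for `tay` splits off the last entry of the multi-index $\mu$; its soul can be
moved to the front because it is even. So `tay` is the $k$-th term of the pullback without the
factor $1/k!$, in a form suited to induction. -/
theorem tay_eq (hφ : ParityAt φ x) (k : ℕ) (hF : Sm F (bodyMap φ x)) :
    tay φ k F x = ∑ μ : Fin k → α',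
      (List.ofFn fun j : Fin k =>
        φ (Sum.inl (μ j)) x - algebraMap ℝ (Grass β) (bodyMap φ x (μ j))).prod *
      subst (fun b => φ (Sum.inr b) x)
        (iteratedFDeriv ℝ k F (bodyMap φ x) (fun j => Pi.single (μ j) 1)) := by
  induction k generalizing F with
  | zero => simp [tay]
  | succ k ih =>
    rw [← (Fin.snocEquiv fun _ => α').sum_comp, Fintype.sum_prod_type]
    simp only [tay]
    refine Finset.sum_congr rfl fun ν _ => ?_
    rw [ih (hF.pd _), Finset.mul_sum]
    refine Finset.sum_congr rfl fun μ _ => ?_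
    rw [List.ofFn_succ', List.concat_eq_append, List.prod_append, List.prod_singleton]
    simp only [Fin.snocEquiv_apply, Fin.snoc_castSucc, Fin.snoc_last]
    change _ = _ * soul φ ν x * _
    rw [← (hφ.soul ν).mul_comm_of_even, mul_assoc]
    congr 3
    rw [← iteratedFDeriv_succ_eq k hF]
    congr 1
    funext j
    refine Fin.lastCases ?_ (fun i => ?_) j
    · simp
    · simp

theorem pullback_eq_tay (hφ : ParityAt φ x) (hF : Sm F (bodyMap φ x)) :
    pullback φ F x =
      ∑ k ∈ Finset.range (Fintype.card β + 1), (1 / (k.factorial : ℝ)) • tay φ k F x := by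
  unfold pullback
  exact Finset.sum_congr rfl fun k _ => by rw [tay_eq hφ k hF]

theorem pullback_congr (hφ : ParityAt φ x) (hF : Sm F (bodyMap φ x))
    (h : F =ᶠ[𝓝 (bodyMap φ x)] G) : pullback φ F x = pullback φ G x := by
  rw [pullback_eq_tay hφ hF, pullback_eq_tay hφ (hF.congr h.symm)]
  exact Finset.sum_congr rfl fun k _ => by rw [tay_congr k h]

/-- Each of the $k$ souls has zero body and raises the order by one. This makes the truncation of
the Taylor series at `Fintype.card β` exact. -/
theorem van_tay (k : ℕ) : Van k (tay φ k F x) := by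
  induction k generalizing F with
  | zero => trivial
  | succ k ih =>
    refine Van.sum fun ν _ => ?_
    rw [add_comm]
    exact (Van.one_of_body_eq_zero (body_soul ν)).mul ih

theorem body_pullback (hφ : ParityAt φ x) (hF : Sm F (bodyMap φ x)) :
    body (pullback φ F x) = body (F (bodyMap φ x)) := by
  rw [pullback_eq_tay hφ hF, map_sum, Finset.sum_eq_single 0]
  · simp [tay, body_subst hφ.odd]
  · intro k _ hk
    obtain ⟨k, rfl⟩ := Nat.exists_eq_succ_of_ne_zero hk
    rw [map_smul, (van_tay (k + 1)).1, smul_zero]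
  · simp

theorem tay_add (k : ℕ) (hF : Sm F (bodyMap φ x)) (hG : Sm G (bodyMap φ x)) :
    tay φ k (fun y => F y + G y) x = tay φ k F x + tay φ k G x := by
  induction k generalizing F G with
  | zero => simp [tay]
  | succ k ih =>
    simp only [tay]
    rw [← Finset.sum_add_distrib]
    refine Finset.sum_congr rfl fun ν _ => ?_
    rw [← mul_add, ← ih (hF.pd _) (hG.pd _)]
    congr 1
    exact tay_congr k ((hF.and hG).mono fun y hy => pd_add _ hy.1.sDiff hy.2.sDiff)

theorem tay_smul (k : ℕ) (c : ℝ) (hF : Sm F (bodyMap φ x)) :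
    tay φ k (fun y => c • F y) x = c • tay φ k F x := by
  induction k generalizing F with
  | zero => simp [tay]
  | succ k ih =>
    simp only [tay]
    rw [Finset.smul_sum]
    refine Finset.sum_congr rfl fun ν _ => ?_
    rw [← mul_smul_comm, ← ih (hF.pd _)]
    congr 1
    exact tay_congr k (hF.mono fun y hy => pd_smul _ c hy.sDiff)

theorem tay_sp (hφ : ParityAt φ x) (k e : ℕ) (hF : Sm F (bodyMap φ x)) :
    tay φ k (fun y => sp e (F y)) x = sp e (tay φ k F x) := by
  induction k generalizing F with
  | zero =>
    simp only [tay]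
    generalize F (bodyMap φ x) = g
    induction e generalizing g with
    | zero => simp [sp_zero]
    | succ e ih => rw [sp_succ, ih, sp_succ, gi_subst hφ.odd]
  | succ k ih =>
    simp only [tay]
    rw [map_sum]
    refine Finset.sum_congr rfl fun ν _ => ?_
    rw [map_mul, ← ih (hF.pd _), (hφ.soul ν).sp_eq, mul_zero, pow_zero, one_smul]
    congr 1
    refine tay_congr k (hF.mono fun y hy => ?_)
    simpa [par] using pd_sp (Sum.inl ν : α' ⊕ β') e hy.sDiff

theorem pullback_add (hφ : ParityAt φ x) (hF : Sm F (bodyMap φ x)) (hG : Sm G (bodyMap φ x)) :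
    pullback φ (fun y => F y + G y) x = pullback φ F x + pullback φ G x := by
  rw [pullback_eq_tay hφ hF, pullback_eq_tay hφ hG, pullback_eq_tay hφ (hF.add hG),
    ← Finset.sum_add_distrib]
  exact Finset.sum_congr rfl fun k _ => by rw [tay_add k hF hG, smul_add]

theorem pullback_smul (hφ : ParityAt φ x) (c : ℝ) (hF : Sm F (bodyMap φ x)) :
    pullback φ (fun y => c • F y) x = c • pullback φ F x := by
  rw [pullback_eq_tay hφ hF, pullback_eq_tay hφ (hF.smul c), Finset.smul_sum]
  exact Finset.sum_congr rfl fun k _ => by rw [tay_smul k c hF, smul_comm]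

theorem pullback_sp (hφ : ParityAt φ x) (e : ℕ) (hF : Sm F (bodyMap φ x)) :
    pullback φ (fun y => sp e (F y)) x = sp e (pullback φ F x) := by
  rw [pullback_eq_tay hφ hF, pullback_eq_tay hφ (hF.sp e), map_sum]
  exact Finset.sum_congr rfl fun k _ => by rw [tay_sp hφ k e hF, map_smul]

theorem pullback_const (hφ : ParityAt φ x) (r : ℝ) :
    pullback φ (fun _ => algebraMap ℝ (Grass β') r) x = algebraMap ℝ (Grass β) r := by
  rw [pullback_eq_tay hφ (Sm.const _), Finset.sum_eq_single 0]
  · simp [tay]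
  · intro k _ hk
    obtain ⟨k, rfl⟩ := Nat.exists_eq_succ_of_ne_zero hk
    simp only [tay]
    have h0 : ∀ k, tay φ k (fun _ => (0 : Grass β')) x = 0 := by
      intro k
      simpa using tay_smul (φ := φ) (x := x) k (0 : ℝ) (Sm.const (0 : Grass β'))
    rw [Finset.sum_eq_zero, smul_zero]
    intro ν _
    rw [tay_congr (G := fun _ => 0) k (Eventually.of_forall fun y => by simp [pd]), h0, mul_zero]
  · simp

theorem pullback_zero (hφ : ParityAt φ x) : pullback φ (fun _ => (0 : Grass β')) x = 0 := by
  simpa using pullback_const (β' := β') hφ 0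

theorem pullback_one (hφ : ParityAt φ x) : pullback φ (fun _ => (1 : Grass β')) x = 1 := by
  simpa using pullback_const (β' := β') hφ 1

theorem pullback_sum (hφ : ParityAt φ x) {ι : Type*} {s : Finset ι} {f : ι → SFun α' β'}
    (hf : ∀ i ∈ s, Sm (f i) (bodyMap φ x)) :
    pullback φ (fun y => ∑ i ∈ s, f i y) x = ∑ i ∈ s, pullback φ (f i) x := by
  classical
  induction s using Finset.induction_on with
  | empty => simpa using pullback_zero hφ
  | insert i s hi ih =>
    simp only [Finset.sum_insert hi]
    rw [pullback_add hφ (hf i (by simp)) (Sm.sum fun j hj => hf j (by simp [hj])),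
      ih fun j hj => hf j (by simp [hj])]

theorem hasParity_pullback (hφ : ParityAt φ x) {e : ℕ} (hF : Sm F (bodyMap φ x))
    (he : ∀ᶠ y in 𝓝 (bodyMap φ x), HasParity e (F y)) : HasParity e (pullback φ F x) := by
  rw [hasParity_iff, ← sp_one, ← pullback_sp hφ 1 hF, ← pullback_smul hφ _ hF]
  refine pullback_congr hφ (hF.sp 1) (he.mono fun y hy => ?_)
  change sp 1 (F y) = _
  rw [sp_one]
  exact hasParity_iff.1 hy

/-! ### The chain rule in the odd directions -/

/-- Differentiating a product of $k$ even souls gives $k$ equal contributions, and differentiating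
the substituted value gives the odd chain rule. For $k=0$ the index `k - 1` truncates to $0$,
harmlessly, since its coefficient is zero. -/
theorem dl_tay (hφ : ParityAt φ x) (b : β) (k : ℕ) (hF : Sm F (bodyMap φ x)) :
    dl b (tay φ k F x) =
      (k : ℝ) • ∑ ν, dl b (φ (Sum.inl ν) x) * tay φ (k - 1) (pd (Sum.inl ν) F) x +
        ∑ c, dl b (φ (Sum.inr c) x) * tay φ k (pd (Sum.inr c) F) x := by
  induction k generalizing F with
  | zero =>
    simp only [tay, Nat.cast_zero, zero_smul, zero_add]
    exact dl_subst hφ.odd b _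
  | succ k ih =>
    have hs : ∀ ν, dl b (soul φ ν x) = dl b (φ (Sum.inl ν) x) := fun ν => by
      rw [soul, map_sub, dl_algebraMap, sub_zero]
    have hp : ∀ A, HasParity (par A + 1) (dl b (φ A x)) := fun A => (hφ A).dl b
    have h1 : ∀ ν, dl b (soul φ ν x * tay φ k (pd (Sum.inl ν) F) x) =
        dl b (φ (Sum.inl ν) x) * tay φ k (pd (Sum.inl ν) F) x +
        ((k : ℝ) • ∑ l, dl b (φ (Sum.inl l) x) *
            (soul φ ν x * tay φ (k - 1) (pd (Sum.inl ν) (pd (Sum.inl l) F)) x) +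
          ∑ c, dl b (φ (Sum.inr c) x) *
            (soul φ ν x * tay φ k (pd (Sum.inl ν) (pd (Sum.inr c) F)) x)) := by
      intro ν
      rw [dl_mul, hs, hasParity_zero_iff.1 (hφ.soul ν), ih (hF.pd _), mul_add, mul_smul_comm,
        Finset.mul_sum, Finset.mul_sum]
      congr 2
      · congr 1
        refine Finset.sum_congr rfl fun l _ => ?_
        rw [← mul_assoc, (hφ.soul ν).mul_comm_of_even, mul_assoc]
        congr 2
        refine tay_congr _ ((hF.pd_comm (Sum.inl l) (Sum.inl ν)).mono fun y hy => ?_)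
        simpa [par] using hy
      · refine Finset.sum_congr rfl fun c _ => ?_
        rw [← mul_assoc, (hφ.soul ν).mul_comm_of_even, mul_assoc]
        congr 2
        refine tay_congr _ ((hF.pd_comm (Sum.inr c) (Sum.inl ν)).mono fun y hy => ?_)
        simpa [par] using hy
    have h2 : dl b (tay φ (k + 1) F x) =
        ∑ ν, dl b (soul φ ν x * tay φ k (pd (Sum.inl ν) F) x) := map_sum _ _ _
    rw [h2]
    simp only [h1, Finset.sum_add_distrib, Nat.add_sub_cancel]
    rw [← Finset.smul_sum]
    have h3 : ∑ ν, ∑ c, dl b (φ (Sum.inr c) x) *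
        (soul φ ν x * tay φ k (pd (Sum.inl ν) (pd (Sum.inr c) F)) x) =
        ∑ c, dl b (φ (Sum.inr c) x) * tay φ (k + 1) (pd (Sum.inr c) F) x := by
      rw [Finset.sum_comm]
      exact Finset.sum_congr rfl fun c _ => by rw [← Finset.mul_sum]; rfl
    have h4 : (k : ℝ) • ∑ ν, ∑ l, dl b (φ (Sum.inl l) x) *
        (soul φ ν x * tay φ (k - 1) (pd (Sum.inl ν) (pd (Sum.inl l) F)) x) =
        (k : ℝ) • ∑ l, dl b (φ (Sum.inl l) x) * tay φ k (pd (Sum.inl l) F) x := by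
      cases k with
      | zero => simp
      | succ k =>
        rw [Finset.sum_comm]
        congr 1
        exact Finset.sum_congr rfl fun c _ => by rw [← Finset.mul_sum]; rfl
    rw [h3, h4, ← add_assoc]
    congr 1
    push_cast
    rw [add_smul, one_smul, add_comm]

/-- The factor $k$ turns $1/k!$ into $1/(k-1)!$, so the even part of the sum is the Taylor series of
the derivatives with the index shifted by one. -/
theorem dl_pullback (hφ : ParityAt φ x) (b : β) (hF : Sm F (bodyMap φ x)) :
    dl b (pullback φ F x) = ∑ B, dl b (φ B x) * pullback φ (pd B F) x := by
  rw [pullback_eq_tay hφ hF, map_sum, Fintype.sum_sum_type]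
  simp only [map_smul, dl_tay hφ b _ hF, smul_add, Finset.sum_add_distrib]
  congr 1
  · rw [Finset.sum_range_succ']
    simp only [Nat.cast_zero, zero_smul, smul_zero, add_zero, Nat.add_sub_cancel]
    simp only [pullback_eq_tay hφ (hF.pd _), Finset.mul_sum, Finset.smul_sum]
    rw [Finset.sum_comm]
    refine Finset.sum_congr rfl fun ν _ => ?_
    rw [Finset.sum_range_succ]
    -- After the shift the top term of the series for $\partial_\nu F$ has no counterpart. It is
    -- zero: the odd factor in front adds one to its order, which then exceeds the number of
    -- generators.
    have hz : dl b (φ (Sum.inl ν) x) * tay φ (Fintype.card β) (pd (Sum.inl ν) F) x = 0 := by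
      have h1 : Van 1 (dl b (φ (Sum.inl ν) x)) :=
        Van.one_of_body_eq_zero ((hφ (Sum.inl ν)).dl b).body_eq_zero
      have h2 := h1.mul (van_tay (φ := φ) (x := x) (F := pd (Sum.inl ν) F) (Fintype.card β))
      rw [add_comm] at h2
      exact h2.eq_zero
    rw [mul_smul_comm, hz, smul_zero, add_zero]
    refine Finset.sum_congr rfl fun k _ => ?_
    rw [smul_smul, mul_smul_comm]
    congr 1
    rw [Nat.factorial_succ]
    push_cast
    have : ((k : ℝ) + 1) ≠ 0 := by positivity
    have : (k.factorial : ℝ) ≠ 0 := by positivity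
    field_simp
  · simp only [pullback_eq_tay hφ (hF.pd _), Finset.mul_sum, Finset.smul_sum]
    rw [Finset.sum_comm]
    refine Finset.sum_congr rfl fun c _ => Finset.sum_congr rfl fun k _ => ?_
    rw [mul_smul_comm]

/-! ### Multiplicativity -/

/-- The two sides have the same body. An odd derivative of their difference is a combination of
differences of the same kind, for the pairs $(\partial_B F, G)$ and $(\pm F,\partial_B G)$.
Induction, with $F$ and $G$ free, shows that the difference vanishes to every order. -/
theorem pullback_mul (hφ : ParityAt φ x) (hF : Sm F (bodyMap φ x)) (hG : Sm G (bodyMap φ x)) :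
    pullback φ (fun y => F y * G y) x = pullback φ F x * pullback φ G x := by
  suffices h : ∀ (k : ℕ) (F G : SFun α' β'), Sm F (bodyMap φ x) → Sm G (bodyMap φ x) →
      Van k (pullback φ (fun y => F y * G y) x - pullback φ F x * pullback φ G x) from
    sub_eq_zero.1 (h _ F G hF hG).eq_zero
  intro k
  induction k with
  | zero => intros; trivial
  | succ k ih =>
    intro F G hF hG
    refine ⟨?_, fun b => ?_⟩
    · rw [map_sub, map_mul, body_pullback hφ (hF.mul hG), body_pullback hφ hF,
        body_pullback hφ hG, map_mul, sub_self]
    have hB : ∀ B, pullback φ (pd B fun y => F y * G y) x =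
        pullback φ (fun y => pd B F y * G y) x +
          pullback φ (fun y => sp (par B) (F y) * pd B G y) x := by
      intro B
      rw [← pullback_add hφ ((hF.pd B).mul hG) ((hF.sp _).mul (hG.pd B))]
      exact pullback_congr hφ ((hF.mul hG).pd B)
        ((hF.and hG).mono fun y hy => pd_mul B hy.1.sDiff hy.2.sDiff)
    have hsw : ∀ B, gi (pullback φ F x) * dl b (φ B x) =
        dl b (φ B x) * pullback φ (fun y => sp (par B) (F y)) x := by
      intro B
      rw [((hφ B).dl b).mul_eq_sp_mul, pullback_sp hφ _ hF, ← sp_add,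
        show par B + 1 + par B = 1 + (par B + par B) by ring, sp_add 1, sp_add (par B), sp_sp,
        sp_one]
    rw [map_sub, dl_mul, dl_pullback hφ b (hF.mul hG), dl_pullback hφ b hF, dl_pullback hφ b hG,
      Finset.sum_mul, Finset.mul_sum, ← Finset.sum_add_distrib, ← Finset.sum_sub_distrib]
    refine Van.sum fun B _ => ?_
    rw [hB, ← mul_assoc (gi _), hsw, mul_assoc, mul_assoc, ← mul_add, ← mul_sub]
    refine Van.mul_left _ ?_
    rw [add_sub_add_comm]
    exact (ih _ _ (hF.pd B) hG).add (ih _ _ (hF.sp _) (hG.pd B))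

theorem pullback_coordFn (hφ : ParityAt φ x) (A : α' ⊕ β') :
    pullback φ (coordFn A) x = φ A x := by
  refine eq_of_body_eq_of_dl_eq ?_ fun b => ?_
  · rw [body_pullback hφ (Sm.coordFn A)]
    cases A with
    | inl a => simp [coordFn, bodyMap]
    | inr b => rw [(hφ.odd b).body_eq_zero, coordFn, body_ι]
  · rw [dl_pullback hφ b (Sm.coordFn A), Finset.sum_eq_single A]
    · have h : pd A (coordFn A) = fun _ : α' → ℝ => (1 : Grass β') := by
        funext y
        simp [pd_coordFn]
      rw [h, pullback_one hφ, mul_one]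
    · intro B _ hBA
      have h : pd B (coordFn A) = fun _ : α' → ℝ => (0 : Grass β') := by
        funext y
        simp [pd_coordFn, hBA]
      rw [h, pullback_zero hφ, mul_zero]
    · simp

/-! ### Smoothness and the chain rule -/

/-- `φ` gives a map from the superdomain over the open set `U`. -/
structure IsSuperMap (φ : α' ⊕ β' → SFun α β) (U : Set (α → ℝ)) : Prop where
  isOpen : IsOpen U
  smooth : ∀ A, ∀ x ∈ U, ContDiffAt ℝ ∞ (φ A) x
  parity : ∀ x ∈ U, ParityAt φ x

variable {U : Set (α → ℝ)}

theorem IsSuperMap.sm (h : IsSuperMap φ U) (A : α' ⊕ β') (hx : x ∈ U) : Sm (φ A) x :=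
  (h.isOpen.eventually_mem hx).mono fun y hy => h.smooth A y hy

/-- In the monomial basis the value is a sum of smooth scalar coefficients times substituted
monomials, and those are products of the smooth $\eta_b$. -/
theorem contDiffAt_subst {η : β' → SFun α β} {G : (α → ℝ) → Grass β'}
    (hp : ∀ᶠ y in 𝓝 x, ∀ b, HasParity 1 (η b y)) (hη : ∀ b, ContDiffAt ℝ ∞ (η b) x)
    (hG : ContDiffAt ℝ ∞ G x) : ContDiffAt ℝ ∞ (fun y => subst (fun b => η b y) (G y)) x := by
  have hc : ∀ g : Grass β', ContDiffAt ℝ ∞ (fun y => subst (fun b => η b y) g) x := by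
    intro g
    induction g using Grass.left_induction with
    | algebraMap r => simpa using contDiffAt_const
    | add g h hg hh => simpa only [map_add] using hg.add hh
    | ι_mul g v hg =>
      simp only [map_mul]
      refine contDiffAt_gmul ?_ hg
      have h1 : ContDiffAt ℝ ∞ (fun y => ∑ b, v b • η b y) x :=
        ContDiffAt.sum fun b _ => (hη b).const_smul (v b)
      exact h1.congr_of_eventuallyEq (hp.mono fun y hy => subst_ι hy v)
  have h1 : ∀ y, subst (fun b => η b y) (G y) =
      ∑ S, (grassBasis β').repr (G y) S • subst (fun b => η b y) (grassBasis β' S) := by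
    intro y
    conv_lhs => rw [← (grassBasis β').sum_repr (G y)]
    simp only [map_sum, map_smul]
  simp only [h1]
  exact ContDiffAt.sum fun S _ =>
    (contDiffAt_linear ((grassBasis β').coord S) hG).smul (hc _)

theorem IsSuperMap.contDiffAt_bodyMap (h : IsSuperMap φ U) (hx : x ∈ U) :
    ContDiffAt ℝ ∞ (bodyMap φ) x :=
  contDiffAt_pi.2 fun a => contDiffAt_linear (body (β := β)).toLinearMap (h.smooth (Sum.inl a) x hx)

theorem IsSuperMap.contDiffAt_tay (h : IsSuperMap φ U) (hx : x ∈ U) (k : ℕ)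
    (hF : Sm F (bodyMap φ x)) : ContDiffAt ℝ ∞ (tay φ k F) x := by
  induction k generalizing F with
  | zero =>
    exact contDiffAt_subst ((h.isOpen.eventually_mem hx).mono fun y hy => (h.parity y hy).odd)
      (fun b => h.smooth _ x hx) (hF.contDiffAt.comp x (h.contDiffAt_bodyMap hx))
  | succ k ih =>
    refine ContDiffAt.sum fun ν _ => contDiffAt_gmul ?_ (ih (hF.pd _))
    exact (h.smooth _ x hx).sub
      (contDiffAt_algebraMap (contDiffAt_pi.1 (h.contDiffAt_bodyMap hx) ν))

theorem IsSuperMap.sm_comp (h : IsSuperMap φ U) (hx : x ∈ U) (hF : Sm F (bodyMap φ x)) :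
    ∀ᶠ y in 𝓝 x, Sm F (bodyMap φ y) :=
  (h.contDiffAt_bodyMap hx).continuousAt.eventually hF.eventually_nhds

theorem IsSuperMap.sm_pullback (h : IsSuperMap φ U) (hx : x ∈ U) (hF : Sm F (bodyMap φ x)) :
    Sm (pullback φ F) x := by
  have key : ∀ x ∈ U, Sm F (bodyMap φ x) → ContDiffAt ℝ ∞ (pullback φ F) x := by
    intro x hx hF
    have h1 : ContDiffAt ℝ ∞ (fun y => ∑ k ∈ Finset.range (Fintype.card β + 1),
        (1 / (k.factorial : ℝ)) • tay φ k F y) x :=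
      ContDiffAt.sum fun k _ => (h.contDiffAt_tay hx k hF).const_smul _
    refine h1.congr_of_eventuallyEq ?_
    filter_upwards [h.sm_comp hx hF, h.isOpen.eventually_mem hx] with y hy hyU
    exact pullback_eq_tay (h.parity y hyU) hy
  filter_upwards [h.sm_comp hx hF, h.isOpen.eventually_mem hx] with y hy hyU
  exact key y hyU hy

/-- The odd directions are `dl_pullback`. For an even direction the difference of the two sides is
shown to vanish to every order: its body is the classical chain rule for the reduced map, since the
odd components contribute nothing to the body, and its odd derivatives are again such differences,
with $\partial_B F$ in place of $F$. -/
theorem IsSuperMap.pd_pullback (h : IsSuperMap φ U) (hx : x ∈ U) (A : α ⊕ β)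
    (hF : ∀ y ∈ U, Sm F (bodyMap φ y)) :
    pd A (pullback φ F) x = ∑ B, pd A (φ B) x * pullback φ (pd B F) x := by
  cases A with
  | inr b => exact dl_pullback (h.parity x hx) b (hF x hx)
  | inl a =>
  suffices H : ∀ (k : ℕ) (F : SFun α' β'), (∀ y ∈ U, Sm F (bodyMap φ y)) → ∀ x ∈ U,
      Van k (pd (Sum.inl a) (pullback φ F) x -
        ∑ B, pd (Sum.inl a) (φ B) x * pullback φ (pd B F) x) from
    sub_eq_zero.1 (H _ F hF x hx).eq_zero
  intro k
  induction k with
  | zero => intros; trivial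
  | succ k ih =>
    intro F hF x hx
    have hφ := h.parity x hx
    refine ⟨?_, fun b => ?_⟩
    · have hbF : DifferentiableAt ℝ (fun y => body (F y)) (bodyMap φ x) :=
        differentiableAt_linear (body (β := β')).toLinearMap (hF x hx).differentiableAt
      have hbφ : DifferentiableAt ℝ (bodyMap φ) x :=
        (h.contDiffAt_bodyMap hx).differentiableAt (by simp)
      have h1 : body (pd (Sum.inl a) (pullback φ F) x) =
          fderiv ℝ (fun y => body (F (bodyMap φ y))) x (Pi.single a 1) := by
        refine (fderiv_linear (body (β := β)).toLinearMap
          (h.sm_pullback hx (hF x hx)).differentiableAt _).symm.trans ?_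
        have he : (fun y => (body (β := β)).toLinearMap (pullback φ F y)) =ᶠ[𝓝 x]
            fun y => body (F (bodyMap φ y)) :=
          (h.isOpen.eventually_mem hx).mono fun y hy => body_pullback (h.parity y hy) (hF y hy)
        rw [he.fderiv_eq]
      have h2 : fderiv ℝ (fun y => body (F (bodyMap φ y))) x (Pi.single a 1) =
          fderiv ℝ (fun y => body (F y)) (bodyMap φ x)
            (fderiv ℝ (bodyMap φ) x (Pi.single a 1)) := by
        have := fderiv_comp x hbF hbφ
        rw [show (fun y => body (F (bodyMap φ y))) = (fun y => body (F y)) ∘ bodyMap φ from rfl,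
          this]
        rfl
      have h3 : ∀ v : α' → ℝ, fderiv ℝ (fun y => body (F y)) (bodyMap φ x) v =
          ∑ ν, v ν * body (pd (Sum.inl ν) F (bodyMap φ x)) := by
        intro v
        conv_lhs => rw [← Finset.univ_sum_single v]
        rw [map_sum]
        refine Finset.sum_congr rfl fun ν _ => ?_
        rw [show Pi.single ν (v ν) = v ν • (Pi.single ν (1 : ℝ) : α' → ℝ) by
          rw [← Pi.single_smul]; simp, map_smul, smul_eq_mul]
        congr 1
        exact fderiv_linear (body (β := β')).toLinearMap (hF x hx).differentiableAt _
      have h4 : ∀ ν, fderiv ℝ (bodyMap φ) x (Pi.single a 1) ν =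
          body (pd (Sum.inl a) (φ (Sum.inl ν)) x) := by
        intro ν
        have h5 := fderiv_linear (body (β := β)).toLinearMap
          (h.smooth (Sum.inl ν) x hx).sDiff (Pi.single a (1 : ℝ))
        refine Eq.trans ?_ h5
        have h6 := fderiv_pi (𝕜 := ℝ) (φ := fun ν y => bodyMap φ y ν) (x := x)
          (fun ν => (differentiableAt_pi.1 hbφ ν))
        have h7 : fderiv ℝ (bodyMap φ) x = _ := h6
        rw [h7]
        rfl
      rw [map_sub, h1, h2, h3, map_sum, Fintype.sum_sum_type, sub_eq_zero]
      have h8 : ∀ c, body (pd (Sum.inl a) (φ (Sum.inr c)) x *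
          pullback φ (pd (Sum.inr c) F) x) = 0 := by
        intro c
        have : HasParity 1 (pd (Sum.inl a) (φ (Sum.inr c)) x) :=
          hasParity_pd (e := 1) (Sum.inl a : α ⊕ β)
            ((h.isOpen.eventually_mem hx).mono fun y hy => (h.parity y hy).odd c)
        rw [map_mul, this.body_eq_zero, zero_mul]
      rw [Finset.sum_congr rfl fun c _ => h8 c, Finset.sum_const_zero, add_zero]
      refine Finset.sum_congr rfl fun ν _ => ?_
      rw [map_mul, h4, body_pullback hφ ((hF x hx).pd _)]
    · have hpp : ∀ B, HasParity (par B) (pd (Sum.inl a) (φ B) x) := fun B =>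
        hasParity_pd (e := par B) (Sum.inl a : α ⊕ β)
          ((h.isOpen.eventually_mem hx).mono fun y hy => h.parity y hy B)
      have hFB : ∀ B, ∀ y ∈ U, Sm (pd B F) (bodyMap φ y) := fun B y hy => (hF y hy).pd B
      have e1 : dl b (pd (Sum.inl a) (pullback φ F) x) =
          ∑ B, (dl b (pd (Sum.inl a) (φ B) x) * pullback φ (pd B F) x +
            dl b (φ B x) * pd (Sum.inl a) (pullback φ (pd B F)) x) := by
        rw [← pd_linear_inl a (dl b) (h.sm_pullback hx (hF x hx)).differentiableAt]
        have he : (fun y => dl b (pullback φ F y)) =ᶠ[𝓝 x]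
            fun y => ∑ B, dl b (φ B y) * pullback φ (pd B F) y :=
          (h.isOpen.eventually_mem hx).mono fun y hy => dl_pullback (h.parity y hy) b (hF y hy)
        have hd1 : ∀ B, DifferentiableAt ℝ (fun y => dl b (φ B y)) x := fun B =>
          differentiableAt_linear (dl b) (h.smooth B x hx).sDiff
        have hd2 : ∀ B, DifferentiableAt ℝ (pullback φ (pd B F)) x := fun B =>
          (h.sm_pullback hx (hFB B x hx)).differentiableAt
        rw [pd_congr _ he, pd_sum _ fun B _ => differentiableAt_gmul (hd1 B) (hd2 B)]
        refine Finset.sum_congr rfl fun B _ => ?_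
        rw [pd_mul _ (hd1 B) (hd2 B), pd_linear_inl a (dl b) (h.smooth B x hx).sDiff]
        rfl
      -- The terms with two derivatives of $F$ match after interchanging $B$ and $C$: the signs from
      -- swapping the coefficients and from swapping the derivatives cancel.
      have e2 : ∑ B, gi (pd (Sum.inl a) (φ B) x) * ∑ C, dl b (φ C x) *
            pullback φ (pd C (pd B F)) x =
          ∑ B, dl b (φ B x) * ∑ C, pd (Sum.inl a) (φ C) x * pullback φ (pd C (pd B F)) x := by
        simp only [Finset.mul_sum]
        rw [Finset.sum_comm]
        refine Finset.sum_congr rfl fun C _ => Finset.sum_congr rfl fun B _ => ?_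
        have e3 : pullback φ (pd C (pd B F)) x =
            (-1 : ℝ) ^ (par C * par B) • pullback φ (pd B (pd C F)) x := by
          rw [← pullback_smul hφ _ (((hF x hx).pd C).pd B)]
          exact pullback_congr hφ (((hF x hx).pd B).pd C) ((hF x hx).pd_comm C B)
        rw [e3, ← mul_assoc, ← mul_assoc, hasParity_iff.1 (hpp B), smul_mul_assoc,
          (hpp B).mul_swap ((hφ C).dl b), smul_smul, ← pow_add, smul_mul_assoc, mul_smul_comm,
          smul_smul, ← pow_add]
        rcases B <;> rcases C <;> norm_num [par]
      rw [map_sub, e1, map_sum]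
      simp only [dl_mul, dl_pullback hφ b (hFB _ x hx), Finset.sum_add_distrib]
      rw [e2, add_sub_add_left_eq_sub, ← Finset.sum_sub_distrib]
      refine Van.sum fun B _ => ?_
      rw [← mul_sub]
      exact (ih _ (hFB B) x hx).mul_left _

end Pullback

/-! ### Functions of one even superfunction -/

section ApplyFn

open Filter Topology

variable {α β : Type} [Fintype α] [Fintype β] [DecidableEq α] [DecidableEq β]
  {f : SFun α β} {x : α → ℝ} {g h : ℝ → ℝ}

/-- A superfunction as a map to the real line. -/
def lineMap (f : SFun α β) : Unit ⊕ Empty → SFun α β := Sum.elim (fun _ => f) Empty.elim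

/-- A function on the real line as a superfunction of `ℝ^{1|0}`. -/
def lineFn (g : ℝ → ℝ) : SFun Unit Empty := fun t => algebraMap ℝ (Grass Empty) (g (t ()))

theorem parityAt_lineMap (hf : HasParity 0 (f x)) : ParityAt (lineMap f) x := by
  rintro (_ | b)
  · exact hf
  · exact b.elim

theorem bodyMap_lineMap : bodyMap (lineMap f) x = fun _ => body (f x) := rfl

theorem contDiffAt_deriv {s : ℝ} (hg : ContDiffAt ℝ ∞ g s) : ContDiffAt ℝ ∞ (deriv g) s := by
  have h : ContDiffAt ℝ ∞ (fderiv ℝ g) s := hg.fderiv_right (by simp)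
  exact h.clm_apply contDiffAt_const

theorem pd_lineFn {t : Unit → ℝ} (hg : DifferentiableAt ℝ g (t ())) :
    pd (Sum.inl ()) (lineFn g) t = lineFn (deriv g) t := by
  have h1 : HasFDerivAt (fun t : Unit → ℝ => g (t ()))
      (deriv g (t ()) • (ContinuousLinearMap.proj () : (Unit → ℝ) →L[ℝ] ℝ)) t :=
    hg.hasDerivAt.comp_hasFDerivAt t (ContinuousLinearMap.proj () : (Unit → ℝ) →L[ℝ] ℝ).hasFDerivAt
  have h2 := (LinearMap.toContinuousLinearMap
    (Algebra.linearMap ℝ (Grass Empty))).hasFDerivAt.comp t h1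
  have h3 : HasFDerivAt (lineFn g) _ t := h2
  simp only [pd]
  rw [h3.fderiv]
  simp [lineFn, Algebra.smul_def]

theorem sm_lineFn {t : Unit → ℝ} (hg : ∀ᶠ s in 𝓝 (t ()), ContDiffAt ℝ ∞ g s) :
    Sm (lineFn g) t := by
  have hc : ContinuousAt (fun t : Unit → ℝ => t ()) t := continuousAt_apply () t
  refine (hc.eventually hg).mono fun s hs => contDiffAt_algebraMap ?_
  exact ContDiffAt.comp s hs (contDiff_apply ℝ ℝ ()).contDiffAt

theorem tay_lineMap (k : ℕ)
    (hg : ∀ᶠ s in 𝓝 (body (f x)), ContDiffAt ℝ ∞ g s) :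
    tay (lineMap f) k (lineFn g) x =
      iteratedDeriv k g (body (f x)) • (f x - algebraMap ℝ (Grass β) (body (f x))) ^ k := by
  induction k generalizing g with
  | zero => simp [tay, lineFn, bodyMap_lineMap, Algebra.smul_def]
  | succ k ih =>
    have hc : ContinuousAt (fun t : Unit → ℝ => t ()) (bodyMap (lineMap f) x) :=
      continuousAt_apply () _
    have hg' : ∀ᶠ s in 𝓝 (body (f x)), ContDiffAt ℝ ∞ (deriv g) s :=
      hg.mono fun s hs => contDiffAt_deriv hs
    have h1 : tay (lineMap f) k (pd (Sum.inl ()) (lineFn g)) x =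
        tay (lineMap f) k (lineFn (deriv g)) x :=
      tay_congr k ((hc.eventually hg).mono fun s hs => pd_lineFn (hs.differentiableAt (by simp)))
    simp only [tay, Finset.univ_unique, Finset.sum_singleton]
    rw [show (default : Unit) = () from rfl, h1, ih hg', iteratedDeriv_succ', mul_smul_comm]
    congr 1
    rw [pow_succ']
    rfl

/-- An even superfunction is a map to $\mathbb R^{1|0}$, and `applyFn` is pullback along it.
Products, inverses and derivatives of functions of $f$ are thereby special cases of the calculus of
pullbacks. -/
theorem applyFn_eq_pullback (hf : HasParity 0 (f x))
    (hg : ∀ᶠ s in 𝓝 (body (f x)), ContDiffAt ℝ ∞ g s) :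
    applyFn g f x = pullback (lineMap f) (lineFn g) x := by
  rw [pullback_eq_tay (parityAt_lineMap hf) (sm_lineFn hg)]
  unfold applyFn
  exact Finset.sum_congr rfl fun k _ => by rw [tay_lineMap k hg, smul_smul]

theorem applyFn_congr (hgh : g =ᶠ[𝓝 (body (f x))] h) : applyFn g f x = applyFn h f x := by
  unfold applyFn
  exact Finset.sum_congr rfl fun k _ => by rw [hgh.iteratedDeriv_eq]

theorem body_applyFn : body (applyFn g f x) = g (body (f x)) := by
  unfold applyFn
  rw [map_sum, Finset.sum_eq_single 0]
  · simp
  · intro k _ hk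
    rw [map_smul, map_pow, map_sub, body_algebraMap, sub_self, zero_pow hk, smul_zero]
  · simp

theorem applyFn_const_mul (c : ℝ) (hf : HasParity 0 (f x))
    (hg : ∀ᶠ s in 𝓝 (body (f x)), ContDiffAt ℝ ∞ g s) :
    applyFn (fun t => c * g t) f x = c • applyFn g f x := by
  rw [applyFn_eq_pullback hf (hg.mono fun s hs => contDiffAt_const.mul hs),
    applyFn_eq_pullback hf hg, ← pullback_smul (parityAt_lineMap hf) c (sm_lineFn hg)]
  congr 1
  funext t
  simp [lineFn, Algebra.smul_def]

theorem applyFn_mul (hf : HasParity 0 (f x))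
    (hg : ∀ᶠ s in 𝓝 (body (f x)), ContDiffAt ℝ ∞ g s)
    (hh : ∀ᶠ s in 𝓝 (body (f x)), ContDiffAt ℝ ∞ h s) :
    applyFn (fun t => g t * h t) f x = applyFn g f x * applyFn h f x := by
  rw [applyFn_eq_pullback hf ((hg.and hh).mono fun s hs => hs.1.mul hs.2),
    applyFn_eq_pullback hf hg, applyFn_eq_pullback hf hh,
    ← pullback_mul (parityAt_lineMap hf) (sm_lineFn hg) (sm_lineFn hh)]
  congr 1
  funext t
  simp [lineFn]

theorem applyFn_id (hf : HasParity 0 (f x)) : applyFn (fun t => t) f x = f x := by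
  rw [applyFn_eq_pullback (g := fun t => t) hf (Eventually.of_forall fun s => contDiffAt_id)]
  exact pullback_coordFn (parityAt_lineMap hf) (Sum.inl ())

theorem applyFn_one (hf : HasParity 0 (f x)) : applyFn (fun _ => 1) f x = 1 := by
  rw [applyFn_eq_pullback hf (Eventually.of_forall fun s => contDiffAt_const)]
  exact (pullback_const (parityAt_lineMap hf) 1).trans (map_one _)

theorem applyFn_inv (hf : HasParity 0 (f x)) (hu : IsUnit (f x)) :
    applyFn (fun t => t⁻¹) f x = Ring.inverse (f x) := by
  have hb := isUnit_iff_body_ne_zero.1 hu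
  have hn : ∀ᶠ s in 𝓝 (body (f x)), s ≠ 0 := isOpen_ne.eventually_mem hb
  have hi : ∀ᶠ s in 𝓝 (body (f x)), ContDiffAt ℝ ∞ (fun t : ℝ => t⁻¹) s :=
    hn.mono fun s hs => contDiffAt_inv ℝ hs
  have h1 : applyFn (fun t => t⁻¹) f x * f x = 1 := by
    refine Eq.trans (congrArg _ (applyFn_id hf).symm) ?_
    rw [← applyFn_mul (h := fun t => t) hf hi (Eventually.of_forall fun s => contDiffAt_id),
      ← applyFn_one hf]
    exact applyFn_congr (hn.mono fun s hs => inv_mul_cancel₀ hs)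
  rw [← Ring.inverse_mul_cancel _ hu] at h1
  exact hu.mul_right_cancel h1

theorem eventually_body (hf : ContinuousAt f x) {p : ℝ → Prop}
    (hp : ∀ᶠ s in 𝓝 (body (f x)), p s) : ∀ᶠ y in 𝓝 x, p (body (f y)) :=
  ((LinearMap.toContinuousLinearMap
    (body (β := β)).toLinearMap).continuous.continuousAt.comp hf).eventually hp

theorem exists_isSuperMap_lineMap (hs : Sm f x) (hf : ∀ᶠ y in 𝓝 x, HasParity 0 (f y))
    (hg : ∀ᶠ s in 𝓝 (body (f x)), ContDiffAt ℝ ∞ g s) :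
    ∃ U, x ∈ U ∧ IsSuperMap (lineMap f) U ∧
      ∀ y ∈ U, ∀ᶠ s in 𝓝 (body (f y)), ContDiffAt ℝ ∞ g s := by
  have h := (hs.and hf).and (eventually_body hs.contDiffAt.continuousAt hg.eventually_nhds)
  obtain ⟨U, hU, hUo, hxU⟩ := eventually_nhds_iff.1 h
  refine ⟨U, hxU, ⟨hUo, ?_, fun y hy => parityAt_lineMap (hU y hy).1.2⟩, fun y hy => (hU y hy).2⟩
  rintro (_ | b) y hy
  · exact (hU y hy).1.1
  · exact b.elim

theorem sm_applyFn (hs : Sm f x) (hf : ∀ᶠ y in 𝓝 x, HasParity 0 (f y))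
    (hg : ∀ᶠ s in 𝓝 (body (f x)), ContDiffAt ℝ ∞ g s) : Sm (applyFn g f) x := by
  obtain ⟨U, hx, hU, hgU⟩ := exists_isSuperMap_lineMap hs hf hg
  refine (hU.sm_pullback hx (F := lineFn g) (sm_lineFn hg)).congr ?_
  filter_upwards [hU.isOpen.eventually_mem hx] with y hy
  exact applyFn_eq_pullback (hU.parity y hy (Sum.inl ())) (hgU y hy)

theorem pd_applyFn (A : α ⊕ β) (hs : Sm f x) (hf : ∀ᶠ y in 𝓝 x, HasParity 0 (f y))
    (hg : ∀ᶠ s in 𝓝 (body (f x)), ContDiffAt ℝ ∞ g s) :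
    pd A (applyFn g f) x = pd A f x * applyFn (deriv g) f x := by
  obtain ⟨U, hx, hU, hgU⟩ := exists_isSuperMap_lineMap hs hf hg
  have h1 : applyFn g f =ᶠ[𝓝 x] pullback (lineMap f) (lineFn g) := by
    filter_upwards [hU.isOpen.eventually_mem hx] with y hy
    exact applyFn_eq_pullback (hU.parity y hy (Sum.inl ())) (hgU y hy)
  have hg' : ∀ᶠ s in 𝓝 (body (f x)), ContDiffAt ℝ ∞ (deriv g) s :=
    hg.mono fun s hs => contDiffAt_deriv hs
  rw [pd_congr A h1, hU.pd_pullback hx A fun y hy => sm_lineFn (hgU y hy), Fintype.sum_sum_type]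
  simp only [Finset.univ_unique, Finset.sum_singleton, Finset.univ_eq_empty, Finset.sum_empty,
    add_zero]
  rw [applyFn_eq_pullback hf.self_of_nhds hg']
  congr 1
  refine pullback_congr (hU.parity x hx) ((sm_lineFn hg).pd _) ?_
  have hc : ContinuousAt (fun t : Unit → ℝ => t ()) (bodyMap (lineMap f) x) :=
    continuousAt_apply () _
  exact (hc.eventually hg).mono fun s hs => pd_lineFn (hs.differentiableAt (by simp))

/-- The logarithmic derivative. -/
theorem pd_applyFn_log (A : α ⊕ β) (hs : Sm f x) (hf : ∀ᶠ y in 𝓝 x, HasParity 0 (f y))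
    (hu : IsUnit (f x)) :
    pd A (applyFn Real.log f) x = pd A f x * Ring.inverse (f x) := by
  have hn : ∀ᶠ s in 𝓝 (body (f x)), s ≠ 0 :=
    isOpen_ne.eventually_mem (isUnit_iff_body_ne_zero.1 hu)
  rw [pd_applyFn A hs hf (hn.mono fun s hs => Real.contDiffAt_log.2 hs), Real.deriv_log',
    applyFn_inv hf.self_of_nhds hu]

theorem sm_applyFn_log (hs : Sm f x) (hf : ∀ᶠ y in 𝓝 x, HasParity 0 (f y))
    (hu : IsUnit (f x)) : Sm (applyFn Real.log f) x := by
  have hn : ∀ᶠ s in 𝓝 (body (f x)), s ≠ 0 :=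
    isOpen_ne.eventually_mem (isUnit_iff_body_ne_zero.1 hu)
  exact sm_applyFn hs hf (hn.mono fun s hs => Real.contDiffAt_log.2 hs)

/-- Both sides have the same body, and their odd derivatives agree since each is a logarithmic
derivative. Odd derivatives do not involve neighbouring points, so it is enough that $r$ and the
pullback of $f$ agree at the single point $y$. -/
theorem pullback_applyFn_log {α' β' : Type} [Fintype α'] [Fintype β'] [DecidableEq α']
    [DecidableEq β'] {φ : α ⊕ β → SFun α' β'} {y : α' → ℝ} (hφ : ParityAt φ y)
    (hs : Sm f (bodyMap φ y)) (hf : ∀ᶠ z in 𝓝 (bodyMap φ y), HasParity 0 (f z))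
    (hu : IsUnit (f (bodyMap φ y))) {r : SFun α' β'} (hr : r y = pullback φ f y)
    (hrs : Sm r y) (hrf : ∀ᶠ z in 𝓝 y, HasParity 0 (r z)) :
    pullback φ (applyFn Real.log f) y = applyFn Real.log r y := by
  have hbody : body (pullback φ f y) = body (f (bodyMap φ y)) := body_pullback hφ hs
  have hru : IsUnit (r y) := by
    rw [isUnit_iff_body_ne_zero, hr, hbody]
    exact isUnit_iff_body_ne_zero.1 hu
  have hlog := sm_applyFn_log hs hf hu
  have hnear : ∀ᶠ z in 𝓝 (bodyMap φ y), Sm f z ∧ (∀ᶠ w in 𝓝 z, HasParity 0 (f w)) ∧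
      IsUnit (f z) := by
    filter_upwards [hs.eventually_nhds, hf.eventually_nhds,
      eventually_body hs.contDiffAt.continuousAt
        (isOpen_ne.eventually_mem (isUnit_iff_body_ne_zero.1 hu))] with z h1 h2 h3
    exact ⟨h1, h2, isUnit_iff_body_ne_zero.2 h3⟩
  have hinvs : Sm (fun z => Ring.inverse (f z)) (bodyMap φ y) :=
    hnear.mono fun z hz => contDiffAt_ringInverse hz.1.contDiffAt hz.2.2
  have hinv : pullback φ (fun z => Ring.inverse (f z)) y = Ring.inverse (r y) := by
    have h1 : pullback φ (fun z => Ring.inverse (f z)) y * r y = 1 := by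
      rw [hr, ← pullback_mul hφ hinvs hs, ← pullback_one (β' := β) hφ]
      exact pullback_congr hφ (hinvs.mul hs)
        (hnear.mono fun z hz => Ring.inverse_mul_cancel _ hz.2.2)
    rw [← Ring.inverse_mul_cancel _ hru] at h1
    exact hru.mul_right_cancel h1
  refine eq_of_body_eq_of_dl_eq ?_ fun b => ?_
  · rw [body_pullback hφ hlog, body_applyFn, body_applyFn, hr, hbody]
  · have h1 : ∀ B, pullback φ (pd B (applyFn Real.log f)) y =
        pullback φ (pd B f) y * Ring.inverse (r y) := by
      intro B
      rw [← hinv, ← pullback_mul hφ (hs.pd B) hinvs]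
      exact pullback_congr hφ (hlog.pd B)
        (hnear.mono fun z hz => pd_applyFn_log B hz.1 hz.2.1 hz.2.2)
    rw [dl_pullback hφ b hlog, ← pd_inr b (applyFn Real.log r), pd_applyFn_log _ hrs hrf hru,
      pd_inr, hr, dl_pullback hφ b hs, Finset.sum_mul, ← hr]
    exact Finset.sum_congr rfl fun B _ => by rw [h1, mul_assoc]

end ApplyFn

/-! ### Odd vector fields on a superdomain -/

section OddField

open Filter Topology

variable {α β : Type} [Fintype α] [Fintype β] [DecidableEq α] [DecidableEq β]
  {X : α ⊕ β → SFun α β} {F G : SFun α β} {x : α → ℝ}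

theorem eq_zero_of_eq_neg {g : Grass β} (h : g = -g) : g = 0 := by
  have h2 : (2 : ℝ) • g = 0 := by
    rw [two_smul]
    nth_rewrite 1 [h]
    exact neg_add_cancel g
  simpa using h2

/-- The components of `X` at `x` are those of an odd vector. -/
def OddAt (X : α ⊕ β → SFun α β) (x : α → ℝ) : Prop := ∀ A, HasParity (par A + 1) (X A x)

theorem actLocal_mul (hX : OddAt X x) (hF : DifferentiableAt ℝ F x) (hG : DifferentiableAt ℝ G x) :
    actLocal X (fun y => F y * G y) x = actLocal X F x * G x + gi (F x) * actLocal X G x := by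
  unfold actLocal
  rw [Finset.sum_mul, Finset.mul_sum, ← Finset.sum_add_distrib]
  refine Finset.sum_congr rfl fun A _ => ?_
  rw [pd_mul A hF hG, mul_add, ← mul_assoc, ← mul_assoc,
    (hX A).mul_eq_sp_mul (sp (par A) (F x)), ← sp_add,
    show par A + 1 + par A = 1 + (par A + par A) by ring, sp_add 1, sp_add (par A), sp_sp, sp_one,
    mul_assoc (gi (F x))]

theorem actLocal_congr (h : F =ᶠ[𝓝 x] G) : actLocal X F x = actLocal X G x := by
  unfold actLocal
  exact Finset.sum_congr rfl fun A _ => by rw [pd_congr A h]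

theorem actLocal_add (hF : DifferentiableAt ℝ F x) (hG : DifferentiableAt ℝ G x) :
    actLocal X (fun y => F y + G y) x = actLocal X F x + actLocal X G x := by
  unfold actLocal
  rw [← Finset.sum_add_distrib]
  exact Finset.sum_congr rfl fun A _ => by rw [pd_add A hF hG, mul_add]

theorem actLocal_sub (hF : DifferentiableAt ℝ F x) (hG : DifferentiableAt ℝ G x) :
    actLocal X (fun y => F y - G y) x = actLocal X F x - actLocal X G x := by
  unfold actLocal
  rw [← Finset.sum_sub_distrib]
  exact Finset.sum_congr rfl fun A _ => by rw [pd_sub A hF hG, mul_sub]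

theorem actLocal_smul (c : ℝ) (hF : DifferentiableAt ℝ F x) :
    actLocal X (fun y => c • F y) x = c • actLocal X F x := by
  unfold actLocal
  rw [Finset.smul_sum]
  exact Finset.sum_congr rfl fun A _ => by rw [pd_smul A c hF, mul_smul_comm]

theorem actLocal_sum {ι : Type*} {s : Finset ι} {f : ι → SFun α β}
    (hf : ∀ i ∈ s, DifferentiableAt ℝ (f i) x) :
    actLocal X (fun y => ∑ i ∈ s, f i y) x = ∑ i ∈ s, actLocal X (f i) x := by
  unfold actLocal
  rw [Finset.sum_comm]
  exact Finset.sum_congr rfl fun A _ => by rw [pd_sum A hf, Finset.mul_sum]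

theorem actLocal_const (g : Grass β) (hg0 : ∀ b, dl b g = 0) :
    actLocal X (fun _ => g) x = 0 := by
  unfold actLocal
  refine Finset.sum_eq_zero fun A _ => ?_
  rcases A with a | b
  · simp [pd]
  · rw [pd_inr, hg0, mul_zero]

theorem hasParity_actLocal (hX : OddAt X x) {e : ℕ} (hF : ∀ᶠ y in 𝓝 x, HasParity e (F y)) :
    HasParity (e + 1) (actLocal X F x) := by
  refine HasParity.sum fun A _ => ?_
  refine ((hX A).mul (hasParity_pd A hF)).congr ?_
  have h : (par A : ZMod 2) + par A = 0 := CharTwo.add_self_eq_zero _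
  push_cast
  linear_combination h

theorem sm_actLocal (hX : ∀ A, Sm (X A) x) (hF : Sm F x) : Sm (actLocal X F) x :=
  Sm.sum fun A _ => (hX A).mul (hF.pd A)

/-- The square of an odd vector field is a derivation. -/
theorem actLocal_actLocal (hX : OddAt X x) (hs : ∀ A, Sm (X A) x) (hF : Sm F x) :
    actLocal X (actLocal X F) x = ∑ A, actLocal X (X A) x * pd A F x := by
  have h1 : actLocal X (actLocal X F) x = ∑ A, (actLocal X (X A) x * pd A F x +
      gi (X A x) * actLocal X (pd A F) x) := by
    refine (actLocal_sum fun A _ =>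
      ((hs A).mul (hF.pd A)).differentiableAt).trans (Finset.sum_congr rfl fun A _ => ?_)
    exact actLocal_mul hX (hs A).differentiableAt (hF.pd A).differentiableAt
  rw [h1, Finset.sum_add_distrib, add_eq_left]
  -- The second-order part $\sum\pm X^AX^B\partial_B\partial_A F$ changes sign when $A$ and $B$ are
  -- interchanged, because $X$ is odd.
  have h2 : ∑ A, gi (X A x) * actLocal X (pd A F) x =
      -∑ A, gi (X A x) * actLocal X (pd A F) x := by
    unfold actLocal
    simp only [Finset.mul_sum]
    rw [← Finset.sum_neg_distrib]
    nth_rewrite 1 [Finset.sum_comm]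
    refine Finset.sum_congr rfl fun A _ => ?_
    rw [← Finset.sum_neg_distrib]
    refine Finset.sum_congr rfl fun B _ => ?_
    rw [hasParity_iff.1 (hX A), hasParity_iff.1 (hX B), pd_comm A B hF.contDiffAt, ← mul_assoc,
      ← mul_assoc, smul_mul_assoc, (hX B).mul_swap (hX A), mul_smul_comm, smul_mul_assoc,
      smul_mul_assoc, smul_mul_assoc, smul_mul_assoc, smul_smul, smul_smul, ← pow_add, ← pow_add,
      ← neg_smul]
    congr 1
    rcases A <;> rcases B <;> norm_num [par]
  exact eq_zero_of_eq_neg h2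

/-- The divergence of a vector field with respect to the coordinate volume. -/
def sdiv (X : α ⊕ β → SFun α β) : SFun α β := fun x => ∑ A, pd A (X A) x

theorem sm_sdiv (hs : ∀ A, Sm (X A) x) : Sm (sdiv X) x := Sm.sum fun A _ => (hs A).pd A

/-- For an odd field the sign in the Lie derivative has even exponent, and so does the sign
$(-1)^{\tilde A(\tilde A+1)}$ from moving $\partial_A$ past $X^A$. -/
theorem lieLocal_one (hX : OddAt X x) (hs : ∀ A, DifferentiableAt ℝ (X A) x)
    (hF : DifferentiableAt ℝ F x) :
    lieLocal 1 X F x = sdiv X x * F x + actLocal X F x := by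
  unfold lieLocal sdiv actLocal
  rw [Finset.sum_mul, ← Finset.sum_add_distrib]
  refine Finset.sum_congr rfl fun A _ => ?_
  rw [pd_mul A (hs A) hF, (hX A).sp_eq]
  rcases A <;> norm_num [par]

/-- The equation $X(X^A)=0$ is differentiated along $z^A$ and summed over $A$ with the sign
$(-1)^{\tilde A}$. This gives $X(\sum_A\partial_A X^A)$ plus a part quadratic in the matrix
$\partial_A X^B$. -/
theorem actLocal_sdiv (hX : ∀ᶠ y in 𝓝 x, OddAt X y) (hs : ∀ A, Sm (X A) x)
    (h0 : ∀ A, ∀ᶠ y in 𝓝 x, actLocal X (X A) y = 0) : actLocal X (sdiv X) x = 0 := by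
  have hXx := hX.self_of_nhds
  have hp : ∀ A B, HasParity (par B + 1 + par A) (pd A (X B) x) := fun A B =>
    hasParity_pd A (hX.mono fun y hy => hy B)
  have h1 : ∀ A, (-1 : ℝ) ^ par A • ∑ B, pd A (X B) x * pd B (X A) x +
      ∑ B, X B x * pd B (pd A (X A)) x = 0 := by
    intro A
    have h2 : pd A (actLocal X (X A)) x = 0 := by
      rw [pd_congr A (h0 A), pd_zero]
    have h3 : pd A (actLocal X (X A)) x = ∑ B, (pd A (X B) x * pd B (X A) x +
        sp (par A) (X B x) * pd A (pd B (X A)) x) := by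
      refine (pd_sum A fun B _ => ((hs B).mul ((hs A).pd B)).differentiableAt).trans
        (Finset.sum_congr rfl fun B _ => ?_)
      exact pd_mul A (hs B).differentiableAt ((hs A).pd B).differentiableAt
    have h4 := congrArg (fun g => (-1 : ℝ) ^ par A • g) (h3.symm.trans h2)
    simp only [smul_zero, Finset.sum_add_distrib, smul_add] at h4
    rw [← h4]
    congr 1
    rw [Finset.smul_sum]
    refine Finset.sum_congr rfl fun B _ => ?_
    rw [pd_comm A B (hs A).contDiffAt, (hXx B).sp_eq, smul_mul_assoc, mul_smul_comm, smul_smul,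
      smul_smul, ← pow_add, ← pow_add]
    rcases A <;> rcases B <;> norm_num [par]
  -- The quadratic part is the supertrace of the square of an odd matrix: interchanging $A$ and $B$
  -- reverses its sign.
  have h5 : ∑ A, (-1 : ℝ) ^ par A • ∑ B, pd A (X B) x * pd B (X A) x = 0 := by
    refine eq_zero_of_eq_neg ?_
    simp only [Finset.smul_sum (N := Grass β)]
    rw [← Finset.sum_neg_distrib]
    nth_rewrite 1 [Finset.sum_comm]
    refine Finset.sum_congr rfl fun A _ => ?_
    rw [← Finset.sum_neg_distrib]
    refine Finset.sum_congr rfl fun B _ => ?_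
    rw [(hp B A).mul_swap (hp A B), smul_smul, ← pow_add, ← neg_smul]
    congr 1
    rcases A <;> rcases B <;> norm_num [par]
  have h6 : ∑ A, ((-1 : ℝ) ^ par A • ∑ B, pd A (X B) x * pd B (X A) x +
      ∑ B, X B x * pd B (pd A (X A)) x) = 0 := Finset.sum_eq_zero fun A _ => h1 A
  rw [Finset.sum_add_distrib, h5, zero_add] at h6
  exact (actLocal_sum fun A _ => ((hs A).pd A).differentiableAt).trans h6

theorem actLocal_applyFn_log (hs : Sm F x) (hf : ∀ᶠ y in 𝓝 x, HasParity 0 (F y))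
    (hu : IsUnit (F x)) :
    actLocal X (applyFn Real.log F) x = actLocal X F x * Ring.inverse (F x) := by
  unfold actLocal
  rw [Finset.sum_mul]
  exact Finset.sum_congr rfl fun A _ => by rw [pd_applyFn_log A hs hf hu, mul_assoc]

/-- Dividing by the even $F$ leaves the coordinate divergence and the logarithmic derivative of $F$.
`Real.log` is $\log|t|$, so the sign of the body plays no role. -/
theorem ringInverse_mul_lieLocal (hX : OddAt X x) (hs : ∀ A, Sm (X A) x) (hF : Sm F x)
    (hf : ∀ᶠ y in 𝓝 x, HasParity 0 (F y)) (hu : IsUnit (F x)) :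
    Ring.inverse (F x) * lieLocal 1 X F x = sdiv X x + actLocal X (applyFn Real.log F) x := by
  have hi := hf.self_of_nhds.ringInverse
  rw [lieLocal_one hX (fun A => (hs A).differentiableAt) hF.differentiableAt,
    actLocal_applyFn_log hF hf hu, hi.mul_comm_of_even, add_mul, mul_assoc,
    Ring.mul_inverse_cancel _ hu, mul_one]

end OddField

/-! ### Matrices over Grassmann algebras -/

section EvenMatrix

open Filter Topology

variable {β ι : Type} [Fintype β] [DecidableEq β] [Fintype ι] [DecidableEq ι]

/-- The inclusion of the even subalgebra. -/
def evenVal (β : Type) : EvenGrass β →+* Grass β :=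
  (CliffordAlgebra.even (0 : QuadraticForm ℝ (β → ℝ))).val.toRingHom

theorem evenVal_injective : Function.Injective (evenVal β) := Subtype.val_injective

theorem hasParity_evenVal (a : EvenGrass β) : HasParity 0 (evenVal β a) := by
  have h : (a : Grass β) ∈ CliffordAlgebra.evenOdd (0 : QuadraticForm ℝ (β → ℝ)) 0 := a.2
  unfold HasParity
  exact_mod_cast h

theorem evenVal_toEven {g : Grass β} (hg : HasParity 0 g) : evenVal β (toEven g) = g := by
  have h : g ∈ CliffordAlgebra.even (0 : QuadraticForm ℝ (β → ℝ)) := by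
    have h' : g ∈ CliffordAlgebra.evenOdd (0 : QuadraticForm ℝ (β → ℝ)) 0 := by
      simpa [HasParity] using hg
    exact h'
  rw [toEven, dif_pos h]
  rfl

theorem isUnit_evenVal_iff {a : EvenGrass β} : IsUnit (evenVal β a) ↔ IsUnit a := by
  constructor
  · intro h
    refine IsUnit.of_mul_eq_one (toEven (Ring.inverse (evenVal β a))) (evenVal_injective ?_)
    rw [map_mul, evenVal_toEven (hasParity_evenVal a).ringInverse, Ring.mul_inverse_cancel _ h,
      map_one]
  · exact fun h => h.map _

theorem evenVal_ringInverse (a : EvenGrass β) :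
    evenVal β (Ring.inverse a) = Ring.inverse (evenVal β a) := by
  by_cases h : IsUnit a
  · have h' := isUnit_evenVal_iff.2 h
    refine h'.mul_left_cancel ?_
    rw [← map_mul, Ring.mul_inverse_cancel _ h, Ring.mul_inverse_cancel _ h', map_one]
  · rw [Ring.inverse_non_unit _ h, Ring.inverse_non_unit _ (mt isUnit_evenVal_iff.1 h), map_zero]

/-- All entries of the matrix have parity `e`. -/
def MatParity {p q : Type} (e : ℕ) (M : Matrix p q (Grass β)) : Prop :=
  ∀ i j, HasParity e (M i j)

theorem evenDet_eq (M : Matrix ι ι (Grass β)) : evenDet M = evenVal β (M.map toEven).det := rfl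

theorem hasParity_evenDet (M : Matrix ι ι (Grass β)) : HasParity 0 (evenDet M) :=
  hasParity_evenVal _

theorem MatParity.map_toEven {p q : Type} {M : Matrix p q (Grass β)} (hM : MatParity 0 M) :
    (M.map toEven).map (evenVal β) = M := by
  ext i j
  exact evenVal_toEven (hM i j)

/-- A matrix with even entries comes from the commutative ring of even elements, where determinants
and adjugates give the inverse; an inverse there is an inverse over the whole algebra. -/
theorem MatParity.ringInverse_eq {M : Matrix ι ι (Grass β)} (hM : MatParity 0 M)
    (hu : IsUnit (evenDet M)) : Ring.inverse M = ((M.map toEven)⁻¹).map (evenVal β) := by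
  have hu' : IsUnit (M.map toEven).det := isUnit_evenVal_iff.1 hu
  have h1 : M * ((M.map toEven)⁻¹).map (evenVal β) = 1 := by
    nth_rewrite 1 [← hM.map_toEven]
    rw [← Matrix.map_mul, Matrix.mul_nonsing_inv _ hu', Matrix.map_one _ (map_zero _) (map_one _)]
  have h2 : ((M.map toEven)⁻¹).map (evenVal β) * M = 1 := by
    nth_rewrite 2 [← hM.map_toEven]
    rw [← Matrix.map_mul, Matrix.nonsing_inv_mul _ hu', Matrix.map_one _ (map_zero _) (map_one _)]
  exact Ring.inverse_unit (⟨M, _, h1, h2⟩ : (Matrix ι ι (Grass β))ˣ)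

theorem MatParity.mul_ringInverse {M : Matrix ι ι (Grass β)} (hM : MatParity 0 M)
    (hu : IsUnit (evenDet M)) : M * Ring.inverse M = 1 := by
  rw [hM.ringInverse_eq hu]
  nth_rewrite 1 [← hM.map_toEven]
  rw [← Matrix.map_mul, Matrix.mul_nonsing_inv _ (isUnit_evenVal_iff.1 hu),
    Matrix.map_one _ (map_zero _) (map_one _)]

theorem MatParity.ringInverse_mul {M : Matrix ι ι (Grass β)} (hM : MatParity 0 M)
    (hu : IsUnit (evenDet M)) : Ring.inverse M * M = 1 := by
  rw [hM.ringInverse_eq hu]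
  nth_rewrite 2 [← hM.map_toEven]
  rw [← Matrix.map_mul, Matrix.nonsing_inv_mul _ (isUnit_evenVal_iff.1 hu),
    Matrix.map_one _ (map_zero _) (map_one _)]

theorem MatParity.ringInverse {M : Matrix ι ι (Grass β)} (hM : MatParity 0 M)
    (hu : IsUnit (evenDet M)) : MatParity 0 (Ring.inverse M) := by
  rw [hM.ringInverse_eq hu]
  exact fun i j => hasParity_evenVal ((M.map toEven)⁻¹ i j)

theorem MatParity.mul {p q r : Type} [Fintype q] {e f : ℕ} {M : Matrix p q (Grass β)}
    {N : Matrix q r (Grass β)} (hM : MatParity e M) (hN : MatParity f N) :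
    MatParity (e + f) (M * N) := by
  intro i j
  rw [Matrix.mul_apply]
  exact HasParity.sum fun k _ => (hM i k).mul (hN k j)

theorem MatParity.sub {p q : Type} {e : ℕ} {M N : Matrix p q (Grass β)} (hM : MatParity e M)
    (hN : MatParity e N) : MatParity e (M - N) := fun i j => (hM i j).sub (hN i j)

theorem trace_mul_comm_of_even {p q : Type} [Fintype p] [Fintype q] {M : Matrix p q (Grass β)}
    {N : Matrix q p (Grass β)} (hM : MatParity 0 M) : (M * N).trace = (N * M).trace := by
  simp only [Matrix.trace, Matrix.diag, Matrix.mul_apply]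
  rw [Finset.sum_comm]
  exact Finset.sum_congr rfl fun i _ => Finset.sum_congr rfl fun j _ => (hM j i).mul_comm_of_even _

/-- The entries do not commute, but the matrix ring is a finite-dimensional real vector space, and
the claim follows from the one for the linear maps of left multiplication. -/
theorem matrix_mul_eq_one_comm {J K : Matrix ι ι (Grass β)} (h : J * K = 1) : K * J = 1 := by
  have h1 : LinearMap.mulLeft ℝ J * LinearMap.mulLeft ℝ K = 1 := by
    ext1 x
    simp [← mul_assoc, h]
  have := mul_eq_one_comm.1 h1
  simpa using LinearMap.congr_fun this 1

/-! ### Derivatives of determinants -/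

variable {α : Type} [Fintype α] [DecidableEq α] {X : α ⊕ β → SFun α β} {x : α → ℝ}

/-- The entrywise action of a vector field on a matrix. -/
def actMatrix {p q : Type} (X : α ⊕ β → SFun α β) (M : (α → ℝ) → Matrix p q (Grass β))
    (x : α → ℝ) : Matrix p q (Grass β) :=
  Matrix.of fun i j => actLocal X (fun y => M y i j) x

/-- All entries of the matrix are smooth near the point. -/
def MatSm {p q : Type} (M : (α → ℝ) → Matrix p q (Grass β)) (x : α → ℝ) : Prop :=
  ∀ i j, Sm (fun y => M y i j) x

theorem MatSm.mul {p q r : Type} [Fintype q] {M : (α → ℝ) → Matrix p q (Grass β)}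
    {N : (α → ℝ) → Matrix q r (Grass β)} (hM : MatSm M x) (hN : MatSm N x) :
    MatSm (fun y => M y * N y) x := by
  intro i j
  simp only [Matrix.mul_apply]
  exact Sm.sum fun k _ => (hM i k).mul (hN k j)

theorem MatSm.sub {p q : Type} {M N : (α → ℝ) → Matrix p q (Grass β)} (hM : MatSm M x)
    (hN : MatSm N x) : MatSm (fun y => M y - N y) x := fun i j => (hM i j).sub (hN i j)

theorem actMatrix_mul {p q r : Type} [Fintype q] {M : (α → ℝ) → Matrix p q (Grass β)}
    {N : (α → ℝ) → Matrix q r (Grass β)} (hX : OddAt X x) {e : ℕ} (he : MatParity e (M x))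
    (hM : MatSm M x) (hN : MatSm N x) :
    actMatrix X (fun y => M y * N y) x =
      actMatrix X M x * N x + (-1 : ℝ) ^ e • (M x * actMatrix X N x) := by
  ext i j
  simp only [actMatrix, Matrix.of_apply, Matrix.add_apply, Matrix.smul_apply, Matrix.mul_apply]
  rw [actLocal_sum fun k _ => ((hM i k).mul (hN k j)).differentiableAt, Finset.smul_sum,
    ← Finset.sum_add_distrib]
  refine Finset.sum_congr rfl fun k _ => ?_
  rw [actLocal_mul hX (hM i k).differentiableAt (hN k j).differentiableAt,
    hasParity_iff.1 (he i k), smul_mul_assoc]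

theorem actMatrix_sub {p q : Type} {M N : (α → ℝ) → Matrix p q (Grass β)} (hM : MatSm M x)
    (hN : MatSm N x) :
    actMatrix X (fun y => M y - N y) x = actMatrix X M x - actMatrix X N x := by
  ext i j
  exact actLocal_sub (hM i j).differentiableAt (hN i j).differentiableAt

theorem sm_evenVal_prod {κ : Type} (s : Finset κ) {f : κ → (α → ℝ) → EvenGrass β}
    (hf : ∀ i, Sm (fun y => evenVal β (f i y)) x) : Sm (fun y => evenVal β (∏ i ∈ s, f i y)) x := by
  classical
  induction s using Finset.induction_on with
  | empty => simpa using Sm.const (x := x) (1 : Grass β)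
  | insert i s hi ih =>
    simp only [Finset.prod_insert hi, map_mul]
    exact (hf i).mul ih

theorem actLocal_evenVal_prod (hX : OddAt X x) {κ : Type} [DecidableEq κ] (s : Finset κ)
    {f : κ → (α → ℝ) → EvenGrass β} (hf : ∀ i, Sm (fun y => evenVal β (f i y)) x) :
    actLocal X (fun y => evenVal β (∏ i ∈ s, f i y)) x =
      ∑ i ∈ s, evenVal β (∏ j ∈ s.erase i, f j x) * actLocal X (fun y => evenVal β (f i y)) x := by
  induction s using Finset.induction_on with
  | empty =>
    simp only [Finset.prod_empty, map_one, Finset.sum_empty]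
    exact actLocal_const 1 dl_one
  | insert i s hi ih =>
    simp only [Finset.prod_insert hi, map_mul]
    rw [actLocal_mul hX (hf i).differentiableAt (sm_evenVal_prod s hf).differentiableAt, ih,
      Finset.sum_insert hi, Finset.erase_insert hi, hasParity_zero_iff.1 (hasParity_evenVal _)]
    congr 1
    · have h1 := (hasParity_evenVal (∏ j ∈ s, f j x)).mul_comm_of_even
        (actLocal X (fun y => evenVal β (f i y)) x)
      exact h1.symm
    · rw [Finset.mul_sum]
      refine Finset.sum_congr rfl fun j hj => ?_
      have hij : i ≠ j := fun h => hi (h ▸ hj)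
      rw [Finset.erase_insert_of_ne hij, Finset.prod_insert (by simp [hi]), map_mul, mul_assoc]

theorem sm_evenVal_det {m : (α → ℝ) → Matrix ι ι (EvenGrass β)}
    (hm : ∀ i j, Sm (fun y => evenVal β (m y i j)) x) : Sm (fun y => evenVal β (m y).det) x := by
  simp only [Matrix.det_apply, map_sum]
  refine Sm.sum fun σ _ => ?_
  have h1 := (sm_evenVal_prod Finset.univ (f := fun i y => m y (σ i) i) fun i => hm (σ i) i)
  rcases Int.units_eq_one_or (Equiv.Perm.sign σ) with h | h
  · simpa [h] using h1
  · simpa [h] using h1.smul (-1)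

/-- Jacobi's formula for an odd derivation. Even factors are unaffected by the sign of the Leibniz
rule and can be collected to the left of the derived entry; the sum over permutations with
$\sigma(i)=k$ is then an entry of the adjugate. -/
theorem actLocal_evenVal_det (hX : OddAt X x) {m : (α → ℝ) → Matrix ι ι (EvenGrass β)}
    (hm : ∀ i j, Sm (fun y => evenVal β (m y i j)) x) :
    actLocal X (fun y => evenVal β (m y).det) x =
      ∑ i, ∑ k, evenVal β ((m x).adjugate i k) * actLocal X (fun y => evenVal β (m y k i)) x := by
  have hsgn : ∀ (σ : Equiv.Perm ι) (a : EvenGrass β), evenVal β (Equiv.Perm.sign σ • a) =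
      ((Equiv.Perm.sign σ : ℤ) : ℝ) • evenVal β a := by
    intro σ a
    rcases Int.units_eq_one_or (Equiv.Perm.sign σ) with h | h <;> simp [h]
  simp only [Matrix.det_apply, map_sum, hsgn]
  rw [actLocal_sum fun σ _ => ((sm_evenVal_prod Finset.univ (f := fun i y => m y (σ i) i)
    fun i => hm (σ i) i).smul _).differentiableAt]
  have h1 : ∀ σ : Equiv.Perm ι, actLocal X (fun y => ((Equiv.Perm.sign σ : ℤ) : ℝ) •
      evenVal β (∏ i, m y (σ i) i)) x = ∑ i, ((Equiv.Perm.sign σ : ℤ) : ℝ) •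
        (evenVal β (∏ j ∈ Finset.univ.erase i, m x (σ j) j) *
          actLocal X (fun y => evenVal β (m y (σ i) i)) x) := by
    intro σ
    rw [actLocal_smul _ (sm_evenVal_prod Finset.univ (f := fun i y => m y (σ i) i)
      fun i => hm (σ i) i).differentiableAt, actLocal_evenVal_prod hX _ fun i => hm (σ i) i,
      Finset.smul_sum]
  rw [Finset.sum_congr rfl fun σ _ => h1 σ, Finset.sum_comm]
  refine Finset.sum_congr rfl fun i _ => ?_
  have h2 : ∀ k, evenVal β ((m x).adjugate i k) = ∑ σ : Equiv.Perm ι,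
      if σ i = k then ((Equiv.Perm.sign σ : ℤ) : ℝ) •
        evenVal β (∏ j ∈ Finset.univ.erase i, m x (σ j) j) else 0 := by
    intro k
    rw [Matrix.adjugate_apply, Matrix.det_apply, map_sum]
    refine Finset.sum_congr rfl fun σ _ => ?_
    rw [hsgn, ← Finset.mul_prod_erase Finset.univ _ (Finset.mem_univ i)]
    split_ifs with h
    · subst h
      rw [Matrix.updateRow_self, Pi.single_eq_same, one_mul]
      congr 2
      refine Finset.prod_congr rfl fun j hj => ?_
      rw [Matrix.updateRow_ne]
      exact fun h => Finset.ne_of_mem_erase hj (σ.injective h)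
    · have hj : σ.symm k ∈ Finset.univ.erase i := by
        refine Finset.mem_erase.2 ⟨fun h' => h ?_, Finset.mem_univ _⟩
        rw [← h', Equiv.apply_symm_apply]
      rw [Finset.prod_eq_zero hj, mul_zero, map_zero, smul_zero]
      rw [Equiv.apply_symm_apply, Matrix.updateRow_self]
      exact Pi.single_eq_of_ne (Finset.ne_of_mem_erase hj) _
  simp only [h2, Finset.sum_mul]
  rw [Finset.sum_comm]
  refine Finset.sum_congr rfl fun σ _ => ?_
  simp only [ite_mul, zero_mul, Finset.sum_ite_eq, Finset.mem_univ, if_true, smul_mul_assoc]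

theorem MatSm.evenVal_toEven {M : (α → ℝ) → Matrix ι ι (Grass β)} (hM : MatSm M x)
    (hp : ∀ᶠ y in 𝓝 x, MatParity 0 (M y)) (i j : ι) :
    Sm (fun y => evenVal β ((M y).map toEven i j)) x :=
  (hM i j).congr (hp.mono fun _ hy => Super.evenVal_toEven (hy i j))

theorem MatSm.evenDet {M : (α → ℝ) → Matrix ι ι (Grass β)} (hM : MatSm M x)
    (hp : ∀ᶠ y in 𝓝 x, MatParity 0 (M y)) : Sm (fun y => evenDet (M y)) x :=
  sm_evenVal_det fun i j => hM.evenVal_toEven hp i j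

theorem eventually_isUnit {f : SFun α β} (hf : Sm f x) (hu : IsUnit (f x)) :
    ∀ᶠ y in 𝓝 x, IsUnit (f y) :=
  (eventually_body hf.contDiffAt.continuousAt
    (isOpen_ne.eventually_mem (isUnit_iff_body_ne_zero.1 hu))).mono
    fun _ hy => isUnit_iff_body_ne_zero.2 hy

theorem sm_ringInverse {f : SFun α β} (hf : Sm f x) (hu : IsUnit (f x)) :
    Sm (fun y => Ring.inverse (f y)) x :=
  (hf.and (eventually_isUnit hf hu)).mono fun _ hy => contDiffAt_ringInverse hy.1 hy.2

/-- Cramer's rule: near $x$ the inverse is the adjugate, polynomial in the entries, divided by the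
determinant. -/
theorem MatSm.ringInverse {M : (α → ℝ) → Matrix ι ι (Grass β)} (hM : MatSm M x)
    (hp : ∀ᶠ y in 𝓝 x, MatParity 0 (M y)) (hu : IsUnit (Super.evenDet (M x))) :
    MatSm (fun y => Ring.inverse (M y)) x := by
  intro i j
  have hd := hM.evenDet hp
  have h1 : Sm (fun y => Ring.inverse (Super.evenDet (M y)) *
      evenVal β (((M y).map toEven).adjugate i j)) x := by
    refine (sm_ringInverse hd hu).mul ?_
    simp only [Matrix.adjugate_apply]
    refine sm_evenVal_det fun k l => ?_
    by_cases hk : k = j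
    · subst hk
      simp only [Matrix.updateRow_self]
      exact Sm.const _
    · simp only [Matrix.updateRow_ne hk]
      exact hM.evenVal_toEven hp k l
  refine h1.congr ?_
  filter_upwards [hp, eventually_isUnit hd hu] with y hy hyu
  rw [hy.ringInverse_eq hyu, Matrix.map_apply, Matrix.inv_def, Matrix.smul_apply, smul_eq_mul,
    map_mul, evenVal_ringInverse]
  rfl

theorem actLocal_evenDet (hX : OddAt X x) {M : (α → ℝ) → Matrix ι ι (Grass β)} (hM : MatSm M x)
    (hp : ∀ᶠ y in 𝓝 x, MatParity 0 (M y)) (hu : IsUnit (evenDet (M x))) :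
    actLocal X (fun y => evenDet (M y)) x =
      evenDet (M x) * (Ring.inverse (M x) * actMatrix X M x).trace := by
  have h1 := actLocal_evenVal_det hX fun i j => hM.evenVal_toEven hp i j
  refine h1.trans ?_
  simp only [Matrix.trace, Matrix.diag, Matrix.mul_apply, Finset.mul_sum]
  refine Finset.sum_congr rfl fun i _ => Finset.sum_congr rfl fun k _ => ?_
  rw [hp.self_of_nhds.ringInverse_eq hu, Matrix.map_apply, Matrix.inv_def, Matrix.smul_apply,
    smul_eq_mul, map_mul, evenVal_ringInverse, ← mul_assoc, ← mul_assoc, ← evenDet_eq,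
    Ring.mul_inverse_cancel _ hu, one_mul]
  congr 1
  exact actLocal_congr (hp.mono fun y hy => evenVal_toEven (hy k i))

/-- Differentiate $M^{-1}M=1$ and multiply by $M^{-1}$ on the right. -/
theorem actMatrix_ringInverse (hX : OddAt X x) {M : (α → ℝ) → Matrix ι ι (Grass β)}
    (hM : MatSm M x) (hp : ∀ᶠ y in 𝓝 x, MatParity 0 (M y)) (hu : IsUnit (evenDet (M x))) :
    actMatrix X (fun y => Ring.inverse (M y)) x =
      -(Ring.inverse (M x) * actMatrix X M x * Ring.inverse (M x)) := by
  have hpx := hp.self_of_nhds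
  have hi := hM.ringInverse hp hu
  have h1 := actMatrix_mul hX (hpx.ringInverse hu) hi hM
  have h2 : actMatrix X (fun y => Ring.inverse (M y) * M y) x = 0 := by
    ext i j
    have h3 : (fun y => (Ring.inverse (M y) * M y) i j) =ᶠ[𝓝 x]
        fun _ => (1 : Matrix ι ι (Grass β)) i j := by
      filter_upwards [hp, eventually_isUnit (hM.evenDet hp) hu] with y hy hyu
      rw [hy.ringInverse_mul hyu]
    refine (actLocal_congr h3).trans (actLocal_const _ fun b => ?_)
    by_cases hij : i = j
    · subst hij; rw [Matrix.one_apply_eq, dl_one]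
    · rw [Matrix.one_apply_ne hij, map_zero]
  rw [h2, pow_zero, one_smul] at h1
  have h4 := congrArg (fun N => N * Ring.inverse (M x)) h1
  simp only [zero_mul, add_mul] at h4
  rw [mul_assoc, hpx.mul_ringInverse hu, mul_one] at h4
  exact eq_neg_of_add_eq_zero_left h4.symm

end EvenMatrix

/-! ### The derivative of the Berezinian -/

section Berezinian

open Filter Topology

variable {α β p q : Type} [Fintype α] [Fintype β] [DecidableEq α] [DecidableEq β]
  [Fintype p] [Fintype q] [DecidableEq p] [DecidableEq q]
  {X : α ⊕ β → SFun α β} {x : α → ℝ}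

/-- `J` is an even supermatrix. -/
def EvenSuper (J : Matrix (p ⊕ q) (p ⊕ q) (Grass β)) : Prop :=
  ∀ A B, HasParity (par A + par B) (J A B)

/-- The Schur complement of the odd-odd block. -/
def schur (J : Matrix (p ⊕ q) (p ⊕ q) (Grass β)) : Matrix p p (Grass β) :=
  J.toBlocks₁₁ - J.toBlocks₁₂ * Ring.inverse J.toBlocks₂₂ * J.toBlocks₂₁

/-- The inverse of a supermatrix, in blocks. -/
def superInv (J : Matrix (p ⊕ q) (p ⊕ q) (Grass β)) : Matrix (p ⊕ q) (p ⊕ q) (Grass β) :=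
  let S := Ring.inverse (schur J)
  let D := Ring.inverse J.toBlocks₂₂
  Matrix.fromBlocks S (-(S * J.toBlocks₁₂ * D)) (-(D * J.toBlocks₂₁ * S))
    (D + D * J.toBlocks₂₁ * S * J.toBlocks₁₂ * D)

variable {J : Matrix (p ⊕ q) (p ⊕ q) (Grass β)}

theorem EvenSuper.block₁₁ (h : EvenSuper J) : MatParity 0 J.toBlocks₁₁ := fun i j =>
  h (Sum.inl i) (Sum.inl j)

theorem EvenSuper.block₁₂ (h : EvenSuper J) : MatParity 1 J.toBlocks₁₂ := fun i j =>
  h (Sum.inl i) (Sum.inr j)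

theorem EvenSuper.block₂₁ (h : EvenSuper J) : MatParity 1 J.toBlocks₂₁ := fun i j =>
  h (Sum.inr i) (Sum.inl j)

theorem EvenSuper.block₂₂ (h : EvenSuper J) : MatParity 0 J.toBlocks₂₂ := fun i j =>
  hasParity_add_two.1 (h (Sum.inr i) (Sum.inr j))

theorem Ber_eq (J : Matrix (p ⊕ q) (p ⊕ q) (Grass β)) :
    Ber J = evenDet (schur J) * Ring.inverse (evenDet J.toBlocks₂₂) := rfl

theorem hasParity_Ber (J : Matrix (p ⊕ q) (p ⊕ q) (Grass β)) : HasParity 0 (Ber J) := by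
  rw [Ber_eq]
  exact HasParity.mul (e := 0) (f := 0) (hasParity_evenDet _) (hasParity_evenDet _).ringInverse

theorem isUnit_of_isUnit_Ber (h : IsUnit (Ber J)) :
    IsUnit (evenDet (schur J)) ∧ IsUnit (evenDet J.toBlocks₂₂) := by
  rw [Ber_eq, isUnit_iff_body_ne_zero, map_mul] at h
  refine ⟨isUnit_iff_body_ne_zero.2 (left_ne_zero_of_mul h), ?_⟩
  by_contra h2
  rw [Ring.inverse_non_unit _ h2, map_zero, mul_zero] at h
  exact h rfl

theorem EvenSuper.schur (h : EvenSuper J) (hu : IsUnit (Ber J)) : MatParity 0 (schur J) := by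
  refine h.block₁₁.sub fun i j => ?_
  exact hasParity_add_two.1
    (((h.block₁₂.mul (h.block₂₂.ringInverse (isUnit_of_isUnit_Ber hu).2)).mul h.block₂₁) i j)

/-- Block elimination: the upper left block is the Schur complement plus $BD^{-1}C$, and then the
blocks multiply out using only the inverses of the Schur complement and of $D$. -/
theorem EvenSuper.mul_superInv (h : EvenSuper J) (hu : IsUnit (Ber J)) : J * superInv J = 1 := by
  have hS := (h.schur hu).mul_ringInverse (isUnit_of_isUnit_Ber hu).1
  have hD := h.block₂₂.mul_ringInverse (isUnit_of_isUnit_Ber hu).2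
  nth_rewrite 1 [← Matrix.fromBlocks_toBlocks J]
  unfold superInv
  set S := Ring.inverse (Super.schur J)
  set D := Ring.inverse J.toBlocks₂₂
  have hA : J.toBlocks₁₁ = Super.schur J + J.toBlocks₁₂ * D * J.toBlocks₂₁ := by
    simp [Super.schur, D]
  simp only
  rw [Matrix.fromBlocks_multiply, ← Matrix.fromBlocks_one]
  congr 1
  · rw [hA, add_mul, hS]
    simp [Matrix.mul_assoc]
  · rw [hA]
    simp only [Matrix.add_mul, Matrix.mul_neg, Matrix.mul_add, Matrix.mul_assoc]
    rw [← Matrix.mul_assoc (Super.schur J), hS, Matrix.one_mul]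
    abel
  · simp only [Matrix.mul_neg, Matrix.mul_assoc]
    rw [← Matrix.mul_assoc _ D, hD, Matrix.one_mul, add_neg_cancel]
  · simp only [Matrix.mul_neg, Matrix.mul_assoc, Matrix.mul_add]
    rw [← Matrix.mul_assoc _ D, hD, Matrix.one_mul]
    abel

theorem EvenSuper.superInv_mul (h : EvenSuper J) (hu : IsUnit (Ber J)) : superInv J * J = 1 :=
  matrix_mul_eq_one_comm (h.mul_superInv hu)

theorem EvenSuper.superInv (h : EvenSuper J) (hu : IsUnit (Ber J)) : EvenSuper (superInv J) := by
  have hS := (h.schur hu).ringInverse (isUnit_of_isUnit_Ber hu).1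
  have hD := h.block₂₂.ringInverse (isUnit_of_isUnit_Ber hu).2
  have h12 := (hS.mul h.block₁₂).mul hD
  have h21 := (hD.mul h.block₂₁).mul hS
  have h22 := (h21.mul h.block₁₂).mul hD
  rintro (i | i) (j | j)
  · exact hS i j
  · exact (h12 i j).neg
  · exact (h21 i j).neg
  · exact hasParity_add_two.2 ((hD i j).add (hasParity_add_two.1 (h22 i j)))

/-- The logarithmic derivative of the Berezinian is the supertrace of $J^{-1}X(J)$. By Jacobi's
formula it is the trace for the Schur complement minus the trace for $D$; expanding the derivative
of $A-BD^{-1}C$ produces the four blocks of the inverse supermatrix. -/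
theorem actLocal_Ber {J : (α → ℝ) → Matrix (p ⊕ q) (p ⊕ q) (Grass β)} (hX : OddAt X x)
    (hs : MatSm J x) (hp : ∀ᶠ y in 𝓝 x, EvenSuper (J y)) (hu : IsUnit (Ber (J x))) :
    Sm (fun y => Ber (J y)) x ∧ actLocal X (fun y => Ber (J y)) x =
      Ber (J x) * ∑ A, ∑ B, (-1 : ℝ) ^ par A •
        (superInv (J x) B A * actLocal X (fun y => J y A B) x) := by
  have hA : MatSm (fun y => (J y).toBlocks₁₁) x := fun i j => hs _ _
  have hB : MatSm (fun y => (J y).toBlocks₁₂) x := fun i j => hs _ _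
  have hC : MatSm (fun y => (J y).toBlocks₂₁) x := fun i j => hs _ _
  have hD : MatSm (fun y => (J y).toBlocks₂₂) x := fun i j => hs _ _
  have hpx := hp.self_of_nhds
  obtain ⟨huS, huD⟩ := isUnit_of_isUnit_Ber hu
  have hpD : ∀ᶠ y in 𝓝 x, MatParity 0 (J y).toBlocks₂₂ := hp.mono fun y hy => hy.block₂₂
  have hDi := hD.ringInverse hpD huD
  have hS : MatSm (fun y => schur (J y)) x := hA.sub ((hB.mul hDi).mul hC)
  have hdD := hD.evenDet hpD
  have hdDi := sm_ringInverse hdD huD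
  have hpS : ∀ᶠ y in 𝓝 x, MatParity 0 (schur (J y)) := by
    filter_upwards [hp, eventually_isUnit hdD huD] with y hy hyu
    refine hy.block₁₁.sub fun i j => ?_
    exact hasParity_add_two.1 (((hy.block₁₂.mul (hy.block₂₂.ringInverse hyu)).mul hy.block₂₁) i j)
  have hdS := hS.evenDet hpS
  refine ⟨hdS.mul hdDi, ?_⟩
  have e1 : actMatrix X (fun y => schur (J y)) x =
      actMatrix X (fun y => (J y).toBlocks₁₁) x -
        (actMatrix X (fun y => (J y).toBlocks₁₂) x *
            (Ring.inverse (J x).toBlocks₂₂ * (J x).toBlocks₂₁) -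
          (J x).toBlocks₁₂ * (-(Ring.inverse (J x).toBlocks₂₂ *
            actMatrix X (fun y => (J y).toBlocks₂₂) x * Ring.inverse (J x).toBlocks₂₂) *
              (J x).toBlocks₂₁ +
            Ring.inverse (J x).toBlocks₂₂ * actMatrix X (fun y => (J y).toBlocks₂₁) x)) := by
    have h1 := actMatrix_mul hX (hpx.block₂₂.ringInverse huD) hDi hC
    have h2 := actMatrix_mul hX hpx.block₁₂ hB (hDi.mul hC)
    have h3 := actMatrix_sub (X := X) hA (hB.mul (hDi.mul hC))
    rw [h2, h1, actMatrix_ringInverse hX hD hpD huD] at h3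
    simp only [← Matrix.mul_assoc] at h3 ⊢
    refine h3.trans ?_
    simp [sub_eq_add_neg]
  have e2 : actLocal X (fun y => Ring.inverse (evenDet (J y).toBlocks₂₂)) x =
      -(Ring.inverse (evenDet (J x).toBlocks₂₂) *
        (Ring.inverse (J x).toBlocks₂₂ * actMatrix X (fun y => (J y).toBlocks₂₂) x).trace) := by
    have h1 := actLocal_mul hX hdDi.differentiableAt hdD.differentiableAt
    have h2 : actLocal X (fun y => Ring.inverse (evenDet (J y).toBlocks₂₂) *
        evenDet (J y).toBlocks₂₂) x = 0 := by
      have h3 : (fun y => Ring.inverse (evenDet (J y).toBlocks₂₂) * evenDet (J y).toBlocks₂₂)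
          =ᶠ[𝓝 x] fun _ => 1 := by
        filter_upwards [eventually_isUnit hdD huD] with y hy
        exact Ring.inverse_mul_cancel _ hy
      exact (actLocal_congr h3).trans (actLocal_const _ dl_one)
    have hpi := (hasParity_evenDet (J x).toBlocks₂₂).ringInverse
    rw [h2, hasParity_zero_iff.1 hpi, actLocal_evenDet hX hD hpD huD, ← mul_assoc,
      Ring.inverse_mul_cancel _ huD, one_mul] at h1
    have h4 := congrArg (fun g => g * Ring.inverse (evenDet (J x).toBlocks₂₂)) h1
    simp only [zero_mul, add_mul] at h4
    rw [mul_assoc, Ring.mul_inverse_cancel _ huD, mul_one, ← hpi.mul_comm_of_even] at h4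
    exact eq_neg_of_add_eq_zero_left h4.symm
  have e3 : actLocal X (fun y => Ber (J y)) x = Ber (J x) *
      ((Ring.inverse (schur (J x)) * actMatrix X (fun y => schur (J y)) x).trace -
        (Ring.inverse (J x).toBlocks₂₂ * actMatrix X (fun y => (J y).toBlocks₂₂) x).trace) := by
    have hpi := (hasParity_evenDet (J x).toBlocks₂₂).ringInverse
    refine (actLocal_mul hX hdS.differentiableAt hdDi.differentiableAt).trans ?_
    rw [e2, hasParity_zero_iff.1 (hasParity_evenDet _), actLocal_evenDet hX hS hpS huS, mul_assoc,
      ← hpi.mul_comm_of_even, Ber_eq, mul_neg, mul_sub, ← mul_assoc, ← mul_assoc, sub_eq_add_neg]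
  have e4 : ∑ A, ∑ B, (-1 : ℝ) ^ par A •
        (superInv (J x) B A * actLocal X (fun y => J y A B) x) =
      ((superInv (J x)).toBlocks₁₁ * actMatrix X (fun y => (J y).toBlocks₁₁) x).trace +
        ((superInv (J x)).toBlocks₂₁ * actMatrix X (fun y => (J y).toBlocks₁₂) x).trace -
        ((superInv (J x)).toBlocks₁₂ * actMatrix X (fun y => (J y).toBlocks₂₁) x).trace -
        ((superInv (J x)).toBlocks₂₂ * actMatrix X (fun y => (J y).toBlocks₂₂) x).trace := by
    simp only [Fintype.sum_sum_type, par, pow_zero, one_smul, pow_one, neg_smul,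
      Finset.sum_add_distrib, Finset.sum_neg_distrib]
    have ht : ∀ {a b : Type} [Fintype a] [Fintype b] (M : Matrix a b (Grass β))
        (N : Matrix b a (Grass β)), (M * N).trace = ∑ j, ∑ i, M i j * N j i := by
      intro a b _ _ M N
      simp only [Matrix.trace, Matrix.diag, Matrix.mul_apply]
      exact Finset.sum_comm
    rw [ht, ht, ht, ht, sub_sub, sub_eq_add_neg _ (_ + _), neg_add]
    exact add_add_add_comm _ _ _ _
  rw [e3, e4, e1]
  congr 1
  have hSi := (hpx.schur hu).ringInverse huS
  have hDi' := hpx.block₂₂.ringInverse huD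
  have hactB : MatParity 2 (actMatrix X (fun y => (J y).toBlocks₁₂) x) := fun i j =>
    hasParity_actLocal hX (hp.mono fun y hy => hy.block₁₂ i j)
  have hactD : MatParity 1 (actMatrix X (fun y => (J y).toBlocks₂₂) x) := fun i j =>
    hasParity_actLocal hX (hp.mono fun y hy => hy.block₂₂ i j)
  simp only [superInv, Matrix.toBlocks_fromBlocks₁₁, Matrix.toBlocks_fromBlocks₁₂,
    Matrix.toBlocks_fromBlocks₂₁, Matrix.toBlocks_fromBlocks₂₂]
  set S := Ring.inverse (schur (J x))
  set D := Ring.inverse (J x).toBlocks₂₂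
  set B := (J x).toBlocks₁₂
  set C := (J x).toBlocks₂₁
  set dA := actMatrix X (fun y => (J y).toBlocks₁₁) x
  set dB := actMatrix X (fun y => (J y).toBlocks₁₂) x
  set dC := actMatrix X (fun y => (J y).toBlocks₂₁) x
  set dD := actMatrix X (fun y => (J y).toBlocks₂₂) x
  -- Cyclicity without a sign needs one even factor. The odd field makes the derivative of the odd
  -- block $B$ even, and that of the even block $D$ odd; in both cases the left factor is even.
  have c1 : (S * dB * (D * C)).trace = ((D * C) * (S * dB)).trace :=
    trace_mul_comm_of_even fun i j => hasParity_add_two.1 ((hSi.mul hactB) i j)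
  have c2 : (S * B * D * dD * (D * C)).trace = ((D * C) * (S * B * D * dD)).trace :=
    trace_mul_comm_of_even fun i j =>
      hasParity_add_two.1 ((((hSi.mul hpx.block₁₂).mul hDi').mul hactD) i j)
  simp only [Matrix.mul_sub, Matrix.mul_add, Matrix.mul_neg, Matrix.neg_mul, Matrix.add_mul,
    Matrix.trace_add, Matrix.trace_sub, Matrix.trace_neg, Matrix.mul_assoc] at c1 c2 ⊢
  rw [c1, c2]
  abel

end Berezinian

/-! ### Coordinate changes and the divergence -/

section CoordinateChange

open Filter Topology

variable {α β : Type} [Fintype α] [Fintype β] [DecidableEq α] [DecidableEq β]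
  {φ : α ⊕ β → SFun α β} {X X' : α ⊕ β → SFun α β} {U : Set (α → ℝ)} {x : α → ℝ}

theorem IsSuperMap.evenSuper_jacobian (h : IsSuperMap φ U) (hx : x ∈ U) :
    EvenSuper (jacobian φ x) := fun A B => by
  rw [add_comm]
  exact hasParity_pd A ((h.isOpen.eventually_mem hx).mono fun y hy => h.parity y hy B)

theorem IsSuperMap.matSm_jacobian (h : IsSuperMap φ U) (hx : x ∈ U) : MatSm (jacobian φ) x :=
  fun A B => (h.sm B hx).pd A

/-- With $J$ the Jacobian and $K=J^{-1}$, the pullback of $\partial'_BX'^B$ is $\sum_A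
K_{BA}\,\partial_A(X\varphi^B)$. Derivatives falling on the components of $X$ give its divergence
because $JK=1$; those falling on $\varphi$ give the supertrace $K\,X(J)$, the logarithmic derivative
of the Berezinian. -/
theorem IsSuperMap.sdiv_eq (h : IsSuperMap φ U) (hx : x ∈ U) (hX : ∀ᶠ y in 𝓝 x, OddAt X y)
    (hs : ∀ A, Sm (X A) x) (hs' : ∀ A, ∀ y ∈ U, Sm (X' A) (bodyMap φ y))
    (hXX' : ∀ B, ∀ y ∈ U, actLocal X (φ B) y = pullback φ (X' B) y)
    (hu : IsUnit (Ber (jacobian φ x))) :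
    pullback φ (sdiv X') x = sdiv X x +
      Ring.inverse (Ber (jacobian φ x)) * actLocal X (fun y => Ber (jacobian φ y)) x := by
  have hJ := h.evenSuper_jacobian hx
  have hK := hJ.superInv hu
  have hKJ := hJ.superInv_mul hu
  have hJK := hJ.mul_superInv hu
  rw [(actLocal_Ber hX.self_of_nhds (h.matSm_jacobian hx) ((h.isOpen.eventually_mem hx).mono fun y hy =>
    h.evenSuper_jacobian hy) hu).2, ← mul_assoc, Ring.inverse_mul_cancel _ hu, one_mul]
  set J := jacobian φ x with hJdef
  set K := superInv J
  have e1 : ∀ B, pullback φ (pd B (X' B)) x = ∑ A, K B A * pd A (actLocal X (φ B)) x := by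
    intro B
    have h1 : ∀ A, pd A (actLocal X (φ B)) x = ∑ C, J A C * pullback φ (pd C (X' B)) x := by
      intro A
      rw [pd_congr A ((h.isOpen.eventually_mem hx).mono fun y hy => hXX' B y hy),
        h.pd_pullback hx A (hs' B)]
      rfl
    simp only [h1, Finset.mul_sum]
    rw [Finset.sum_comm]
    have h2 : ∀ C, ∑ A, K B A * (J A C * pullback φ (pd C (X' B)) x) =
        (1 : Matrix (α ⊕ β) (α ⊕ β) (Grass β)) B C * pullback φ (pd C (X' B)) x := by
      intro C
      rw [← hKJ, Matrix.mul_apply, Finset.sum_mul]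
      exact Finset.sum_congr rfl fun A _ => (mul_assoc _ _ _).symm
    simp only [h2]
    rw [Finset.sum_eq_single B]
    · rw [Matrix.one_apply_eq, one_mul]
    · intro C _ hC
      rw [Matrix.one_apply_ne hC.symm, zero_mul]
    · simp
  have e2 : ∀ A B, pd A (actLocal X (φ B)) x = ∑ C, pd A (X C) x * J C B +
      (-1 : ℝ) ^ par A • actLocal X (fun y => jacobian φ y A B) x := by
    intro A B
    refine (pd_sum A fun C _ => ((hs C).mul ((h.sm B hx).pd C)).differentiableAt).trans ?_
    unfold actLocal
    rw [Finset.smul_sum, ← Finset.sum_add_distrib]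
    refine Finset.sum_congr rfl fun C _ => ?_
    rw [pd_mul A (hs C).differentiableAt ((h.sm B hx).pd C).differentiableAt]
    congr 1
    rw [pd_comm A C (h.smooth B x hx), (hX.self_of_nhds C).sp_eq, smul_mul_assoc, mul_smul_comm,
      smul_smul, ← pow_add]
    change _ • (X C x * pd C (pd A (φ B)) x) = _ • (X C x * pd C (pd A (φ B)) x)
    congr 1
    rcases A <;> rcases C <;> norm_num [par]
  -- No sign appears: the two factors being exchanged have opposite parities, $\tilde B+\tilde C+1$
  -- and $\tilde B+\tilde C$ modulo $2$.
  have e3 : ∀ A B C, K B A * (pd A (X C) x * J C B) = J C B * K B A * pd A (X C) x := by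
    intro A B C
    have hp : HasParity (par C + 1 + par A) (pd A (X C) x) :=
      hasParity_pd A (hX.mono fun y hy => hy C)
    rw [← mul_assoc, ((hK B A).mul hp).mul_swap (hJ C B), mul_assoc (J C B)]
    rcases A <;> rcases B <;> rcases C <;> norm_num [par]
  have e4 : pullback φ (sdiv X') x = ∑ B, pullback φ (pd B (X' B)) x :=
    pullback_sum (h.parity x hx) fun B _ => (hs' B x hx).pd B
  rw [e4]
  simp only [e1, e2, mul_add, Finset.sum_add_distrib, Finset.mul_sum, e3, mul_smul_comm]
  congr 1
  · unfold sdiv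
    rw [Finset.sum_comm]
    refine Finset.sum_congr rfl fun A _ => ?_
    rw [Finset.sum_comm]
    have h2 : ∀ C, ∑ B, J C B * K B A * pd A (X C) x =
        (1 : Matrix (α ⊕ β) (α ⊕ β) (Grass β)) C A * pd A (X C) x := by
      intro C
      rw [← hJK, Matrix.mul_apply, Finset.sum_mul]
    simp only [h2]
    rw [Finset.sum_eq_single A]
    · rw [Matrix.one_apply_eq, one_mul]
    · intro C _ hC
      rw [Matrix.one_apply_ne hC, zero_mul]
    · simp
  · exact Finset.sum_comm

end CoordinateChange

/-! ### The Schouten bracket and the cotangent lift of a coordinate change -/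

section Cotangent

open Filter Topology

variable {α β : Type} [Fintype α] [Fintype β] [DecidableEq α] [DecidableEq β]
  {F : SFun α β} {z : α ⊕ β → ℝ}

theorem par_ix (A : α ⊕ β) : par (ix A) = par A := by cases A <;> rfl

theorem sum_ix_ixs {M : Type*} [AddCommMonoid M] (f : (α ⊕ β) ⊕ (β ⊕ α) → M) :
    ∑ Z, f Z = ∑ a, (f (ix a) + f (ixs a)) := by
  simp only [Fintype.sum_sum_type, Finset.sum_add_distrib, ix, ixs]
  abel

theorem ix_or_ixs (Z : (α ⊕ β) ⊕ (β ⊕ α)) : (∃ a, Z = ix a) ∨ ∃ a, Z = ixs a := by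
  rcases Z with (a | b) | (b | a)
  · exact Or.inl ⟨Sum.inl a, rfl⟩
  · exact Or.inr ⟨Sum.inr b, rfl⟩
  · exact Or.inl ⟨Sum.inr b, rfl⟩
  · exact Or.inr ⟨Sum.inl a, rfl⟩

theorem ix_inj {a b : α ⊕ β} : ix a = ix b ↔ a = b := by
  cases a <;> cases b <;> simp [ix]

theorem ixs_inj {a b : α ⊕ β} : ixs a = ixs b ↔ a = b := by
  cases a <;> cases b <;> simp [ixs]

theorem ix_ne_ixs (a b : α ⊕ β) : ix a ≠ ixs b := by
  cases a <;> cases b <;> simp [ix, ixs]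

/-- The inclusion of Grassmann algebras underlying `lift`. -/
def emb (α β : Type) : Grass β →ₐ[ℝ] Grass (β ⊕ α) :=
  ExteriorAlgebra.map (LinearMap.pi (Sum.elim (fun b => LinearMap.proj b) fun _ => 0) :
    (β → ℝ) →ₗ[ℝ] (β ⊕ α → ℝ))

theorem emb_ι_mul (v : β → ℝ) (g : Grass β) : emb α β (ExteriorAlgebra.ι ℝ v * g) =
    ExteriorAlgebra.ι ℝ (Sum.elim v fun _ => 0) * emb α β g := by
  rw [map_mul]
  congr 1
  refine (ExteriorAlgebra.map_apply_ι _ _).trans (congrArg _ ?_)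
  funext c
  cases c <;> rfl

theorem lift_eq (F : SFun α β) (z : α ⊕ β → ℝ) : lift F z = emb α β (F (basePt z)) := rfl

theorem gi_emb (g : Grass β) : gi (emb α β g) = emb α β (gi g) := by
  induction g using Grass.left_induction with
  | algebraMap r => simp
  | add x y hx hy => simp only [map_add, hx, hy]
  | ι_mul x v hx =>
    rw [emb_ι_mul, map_mul, map_mul, gi_ι, gi_ι, hx, neg_mul, neg_mul, map_neg, emb_ι_mul]

theorem HasParity.emb {e : ℕ} {g : Grass β} (hg : HasParity e g) : HasParity e (emb α β g) := by
  rw [hasParity_iff] at *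
  rw [gi_emb, hg, map_smul]

theorem dl_emb_inl (b : β) (g : Grass β) : dl (Sum.inl b) (emb α β g) = emb α β (dl b g) := by
  induction g using Grass.left_induction with
  | algebraMap r => simp [dl_algebraMap]
  | add x y hx hy => simp only [map_add, hx, hy]
  | ι_mul x v hx =>
    rw [emb_ι_mul, dl_ι_mul, dl_ι_mul, hx, map_sub, map_smul, emb_ι_mul, Sum.elim_inl]

theorem dl_emb_inr (a : α) (g : Grass β) : dl (Sum.inr a) (emb α β g) = 0 := by
  induction g using Grass.left_induction with
  | algebraMap r => simp [dl_algebraMap]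
  | add x y hx hy => simp only [map_add, hx, hy, add_zero]
  | ι_mul x v hx =>
    rw [emb_ι_mul, dl_ι_mul, hx, Sum.elim_inr, zero_smul, mul_zero, sub_zero]

/-- `basePt` as a continuous linear map. -/
def baseCLM (α β : Type) : (α ⊕ β → ℝ) →L[ℝ] (α → ℝ) :=
  ContinuousLinearMap.pi fun a => ContinuousLinearMap.proj (Sum.inl a)

theorem sm_lift (hF : Sm F (basePt z)) : Sm (lift F) z := by
  have hc : ContinuousAt (fun z : α ⊕ β → ℝ => basePt z) z := (baseCLM α β).continuous.continuousAt
  refine (hc.eventually hF).mono fun w hw => ?_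
  exact contDiffAt_linear (emb α β).toLinearMap
    (ContDiffAt.comp w hw (baseCLM α β).contDiff.contDiffAt)

theorem fderiv_lift (hF : DifferentiableAt ℝ F (basePt z)) (v : α ⊕ β → ℝ) :
    fderiv ℝ (lift F) z v = emb α β (fderiv ℝ F (basePt z) (basePt v)) := by
  have h1 : HasFDerivAt (fun z : α ⊕ β → ℝ => F (basePt z))
      ((fderiv ℝ F (basePt z)).comp (baseCLM α β)) z :=
    HasFDerivAt.comp (f := baseCLM α β) z hF.hasFDerivAt (baseCLM α β).hasFDerivAt
  have h2 := fderiv_linear (emb α β).toLinearMap h1.differentiableAt v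
  rw [h1.fderiv] at h2
  exact h2

theorem pd_ix_lift (A : α ⊕ β) (hF : DifferentiableAt ℝ F (basePt z)) :
    pd (ix A) (lift F) z = lift (pd A F) z := by
  rcases A with a | b
  · have h : basePt (Pi.single (Sum.inl a) (1 : ℝ) : α ⊕ β → ℝ) = Pi.single a 1 := by
      funext c
      simp [basePt, Pi.single_apply]
    simp only [ix, pd]
    rw [fderiv_lift hF, h]
    rfl
  · exact dl_emb_inl b _

theorem pd_ixs_lift (A : α ⊕ β) (hF : DifferentiableAt ℝ F (basePt z)) :
    pd (ixs A) (lift F) z = 0 := by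
  rcases A with a | b
  · exact dl_emb_inr a _
  · have h : basePt (Pi.single (Sum.inr b) (1 : ℝ) : α ⊕ β → ℝ) = 0 := by
      funext c
      simp [basePt]
    simp only [ixs, pd]
    rw [fderiv_lift hF, h, map_zero, map_zero]

/-! ### The Hamiltonian vector field in Darboux coordinates -/

/-- The components of `[[P, ·]]`. -/
def hamLocal (P : SFun (α ⊕ β) (β ⊕ α)) : (α ⊕ β) ⊕ (β ⊕ α) → SFun (α ⊕ β) (β ⊕ α) :=
  fun A => schouten 0 P (coordFn A)

variable {P G : SFun (α ⊕ β) (β ⊕ α)}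

/-- For even $P$ the second sign absorbs the minus in front of it, and both terms carry
$(-1)^{\tilde a+1}$. -/
theorem schouten_zero_apply : schouten 0 P G z =
    ∑ a : α ⊕ β, (-1 : ℝ) ^ (par a + 1) •
      (pd (ixs a) P z * pd (ix a) G z + pd (ix a) P z * pd (ixs a) G z) := by
  unfold schouten
  refine Finset.sum_congr rfl fun a _ => ?_
  rw [zero_add, mul_one, mul_one, pow_succ, mul_neg_one, neg_smul, neg_smul, smul_add, neg_add,
    sub_eq_add_neg]

theorem hamLocal_ix (a : α ⊕ β) :
    hamLocal P (ix a) = fun z => (-1 : ℝ) ^ (par a + 1) • pd (ixs a) P z := by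
  funext z
  rw [hamLocal, schouten_zero_apply, Finset.sum_eq_single a]
  · simp [pd_coordFn, (ix_ne_ixs a a).symm]
  · intro b _ hb
    simp [pd_coordFn, (ix_ne_ixs a b).symm, ix_inj, hb]
  · simp

theorem hamLocal_ixs (a : α ⊕ β) :
    hamLocal P (ixs a) = fun z => (-1 : ℝ) ^ (par a + 1) • pd (ix a) P z := by
  funext z
  rw [hamLocal, schouten_zero_apply, Finset.sum_eq_single a]
  · simp [pd_coordFn, ix_ne_ixs a a]
  · intro b _ hb
    simp [pd_coordFn, ix_ne_ixs b a, ixs_inj, hb]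
  · simp

theorem actLocal_hamLocal : actLocal (hamLocal P) G z = schouten 0 P G z := by
  unfold actLocal
  rw [sum_ix_ixs, schouten_zero_apply]
  refine Finset.sum_congr rfl fun a _ => ?_
  rw [hamLocal_ix, hamLocal_ixs, smul_add, smul_mul_assoc, smul_mul_assoc]

theorem sm_hamLocal (hP : Sm P z) (A : (α ⊕ β) ⊕ (β ⊕ α)) : Sm (hamLocal P A) z := by
  rcases ix_or_ixs A with ⟨a, rfl⟩ | ⟨a, rfl⟩
  · rw [hamLocal_ix]; exact (hP.pd _).smul _
  · rw [hamLocal_ixs]; exact (hP.pd _).smul _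

theorem oddAt_hamLocal (hp : ∀ᶠ y in 𝓝 z, HasParity 0 (P y)) : OddAt (hamLocal P) z := by
  intro A
  rcases ix_or_ixs A with ⟨a, rfl⟩ | ⟨a, rfl⟩
  · rw [hamLocal_ix]
    have h := (hasParity_pd (ixs a) hp).smul ((-1 : ℝ) ^ (par a + 1))
    rcases a with a | b
    · exact h
    · exact hasParity_add_two.2 h
  · rw [hamLocal_ixs]
    have h := (hasParity_pd (ix a) hp).smul ((-1 : ℝ) ^ (par a + 1))
    rcases a with a | b
    · exact hasParity_add_two.2 h
    · exact h

/-- The coordinates $x^a$ and $x^*_a$ have opposite parities, so their derivatives commute and the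
two contributions coincide. This is the factor $2$ that the modular class of $(M,P)$ divides out. -/
theorem sdiv_hamLocal (hP : Sm P z) : sdiv (hamLocal P) z =
    (2 : ℝ) • ∑ a : α ⊕ β, (-1 : ℝ) ^ (par a + 1) • pd (ix a) (pd (ixs a) P) z := by
  unfold sdiv
  rw [sum_ix_ixs, Finset.smul_sum]
  refine Finset.sum_congr rfl fun a _ => ?_
  rw [hamLocal_ix, hamLocal_ixs, pd_smul _ _ (hP.pd _).differentiableAt,
    pd_smul _ _ (hP.pd _).differentiableAt, pd_comm (ixs a) (ix a) hP.contDiffAt, two_smul]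
  congr 2
  rcases a <;> simp [par, ix, ixs]

/-- The components of `[[P, ·]]` are killed by it when `[[P, P]] = 0`. -/
theorem actLocal_hamLocal_hamLocal (hP : Sm P z) (hp : ∀ᶠ y in 𝓝 z, HasParity 0 (P y))
    (h0 : ∀ᶠ y in 𝓝 z, schouten 0 P P y = 0) (A : (α ⊕ β) ⊕ (β ⊕ α)) :
    actLocal (hamLocal P) (hamLocal P A) z = 0 := by
  have hpz : ∀ Z, HasParity (par Z) (pd Z P z) := fun Z => by
    simpa using hasParity_pd Z hp
  have hpzz : ∀ Z W, HasParity (par W + par Z) (pd Z (pd W P) z) := fun Z W => by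
    refine hasParity_pd Z ?_
    filter_upwards [hp.eventually_nhds] with y hy
    simpa using hasParity_pd W hy
  have key : ∀ Z : (α ⊕ β) ⊕ (β ⊕ α), schouten 0 P (pd Z P) z = 0 := by
    intro Z
    have h1 : pd Z (schouten 0 P P) z = 0 := by rw [pd_congr Z h0, pd_zero]
    have h2 : pd Z (schouten 0 P P) z = ∑ a : α ⊕ β, (-1 : ℝ) ^ (par a + 1) •
        ((pd Z (pd (ixs a) P) z * pd (ix a) P z +
            sp (par Z) (pd (ixs a) P z) * pd Z (pd (ix a) P) z) +
          (pd Z (pd (ix a) P) z * pd (ixs a) P z +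
            sp (par Z) (pd (ix a) P z) * pd Z (pd (ixs a) P) z)) := by
      have h3 : schouten 0 P P = fun z => ∑ a : α ⊕ β, (-1 : ℝ) ^ (par a + 1) •
          (pd (ixs a) P z * pd (ix a) P z + pd (ix a) P z * pd (ixs a) P z) := by
        funext z
        exact schouten_zero_apply
      rw [h3, pd_sum]
      · refine Finset.sum_congr rfl fun a _ => ?_
        have d1 := (hP.pd (ixs a)).differentiableAt
        have d2 := (hP.pd (ix a)).differentiableAt
        rw [pd_smul _ _ (by exact (differentiableAt_gmul d1 d2).add (differentiableAt_gmul d2 d1)),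
          pd_add _ (differentiableAt_gmul d1 d2) (differentiableAt_gmul d2 d1), pd_mul _ d1 d2,
          pd_mul _ d2 d1]
      · intro a _
        exact ((((hP.pd (ixs a)).mul (hP.pd (ix a))).add
          ((hP.pd (ix a)).mul (hP.pd (ixs a)))).smul _).differentiableAt
    -- Graded commutativity matches each term with the derivative on the left factor to one with it
    -- on the right factor, whence the factor $2$; the sign comes from moving $\partial_Z$ past
    -- first derivatives of $P$.
    have h4 : pd Z (schouten 0 P P) z = ((-1 : ℝ) ^ par Z * 2) • schouten 0 P (pd Z P) z := by
      rw [h2, schouten_zero_apply, Finset.smul_sum]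
      refine Finset.sum_congr rfl fun a _ => ?_
      rw [smul_comm]
      congr 1
      rw [(hpzz Z (ixs a)).mul_swap (hpz (ix a)), (hpzz Z (ix a)).mul_swap (hpz (ixs a)),
        (hpz _).sp_eq, (hpz _).sp_eq, pd_comm Z (ixs a) hP.contDiffAt,
        pd_comm Z (ix a) hP.contDiffAt]
      simp only [mul_smul_comm, smul_mul_assoc, smul_smul, ← pow_add]
      rcases a with a | b <;> rcases Z with Z | Z <;> norm_num [par, ix, ixs, two_smul] <;> abel
    rw [h1] at h4
    exact (smul_eq_zero.1 h4.symm).resolve_left (by simp)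
  rw [actLocal_hamLocal]
  have hsm : ∀ (c : ℝ) Z, schouten 0 P (fun y => c • pd Z P y) z = 0 := by
    intro c Z
    rw [← actLocal_hamLocal, actLocal_smul _ (hP.pd Z).differentiableAt, actLocal_hamLocal, key,
      smul_zero]
  rcases ix_or_ixs A with ⟨a, rfl⟩ | ⟨a, rfl⟩
  · rw [hamLocal_ix]; exact hsm _ _
  · rw [hamLocal_ixs]; exact hsm _ _

end Cotangent

/-! ### The cotangent lift of a coordinate change. -/

section CotangentLift

open Filter Topology

variable {α β : Type} [Fintype α] [Fintype β] [DecidableEq α] [DecidableEq β]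
  {φ ψ : α ⊕ β → SFun α β} {V : Set (α → ℝ)} {x : α → ℝ} {z : α ⊕ β → ℝ}

/-- The Jacobian matrix of the inverse coordinate change, in the source coordinates. -/
def invJac (φ ψ : α ⊕ β → SFun α β) (A B : α ⊕ β) : SFun α β := pullback φ (pd A (ψ B))

/-- The cotangent lift of the coordinate change `φ` with inverse `ψ`. -/
def cotMap (φ ψ : α ⊕ β → SFun α β) : (α ⊕ β) ⊕ (β ⊕ α) → SFun (α ⊕ β) (β ⊕ α) :=
  let base : α ⊕ β → SFun (α ⊕ β) (β ⊕ α) := fun A => lift (φ A)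
  let fibre : α ⊕ β → SFun (α ⊕ β) (β ⊕ α) := fun A z =>
    ∑ B, lift (invJac φ ψ A B) z * coordFn (ixs B) z
  Sum.elim (Sum.elim (fun a => base (Sum.inl a)) (fun b => fibre (Sum.inr b)))
    (Sum.elim (fun b => base (Sum.inr b)) (fun a => fibre (Sum.inl a)))

theorem cotMap_ix (A : α ⊕ β) : cotMap φ ψ (ix A) = lift (φ A) := by cases A <;> rfl

theorem cotMap_ixs (A : α ⊕ β) : cotMap φ ψ (ixs A) =
    fun z => ∑ B, lift (invJac φ ψ A B) z * coordFn (ixs B) z := by cases A <;> rfl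

/-- `φ` is a coordinate change over `V` with inverse `ψ`. -/
structure IsCoordChange (φ ψ : α ⊕ β → SFun α β) (V : Set (α → ℝ)) : Prop where
  superMap : IsSuperMap φ V
  sm : ∀ x ∈ V, ∀ B, Sm (ψ B) (bodyMap φ x)
  parity : ∀ x ∈ V, ∀ B, ∀ᶠ y in 𝓝 (bodyMap φ x), HasParity (par B) (ψ B y)
  inverse : ∀ x ∈ V, ∀ B, pullback φ (ψ B) x = coordFn B x

theorem IsCoordChange.sm_invJac (h : IsCoordChange φ ψ V) (hx : x ∈ V) (A B : α ⊕ β) :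
    Sm (invJac φ ψ A B) x :=
  h.superMap.sm_pullback hx ((h.sm x hx B).pd A)

theorem IsCoordChange.hasParity_invJac (h : IsCoordChange φ ψ V) (hx : x ∈ V) (A B : α ⊕ β) :
    HasParity (par B + par A) (invJac φ ψ A B x) := by
  refine hasParity_pullback (h.superMap.parity x hx) ((h.sm x hx B).pd A) ?_
  filter_upwards [(h.parity x hx B).eventually_nhds] with y hy
  exact hasParity_pd A hy

/-- Differentiating $\psi\circ\varphi=\mathrm{id}$ by the chain rule gives the product in the
opposite order; `matrix_mul_eq_one_comm` turns it around. -/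
theorem IsCoordChange.invJac_mul (h : IsCoordChange φ ψ V) (hx : x ∈ V) (A B : α ⊕ β) :
    ∑ C, invJac φ ψ A C x * pd C (φ B) x = if A = B then 1 else 0 := by
  have h1 : (Matrix.of fun C B => pd C (φ B) x : Matrix (α ⊕ β) (α ⊕ β) (Grass β)) *
      (Matrix.of fun A C => invJac φ ψ A C x) = 1 := by
    ext C B
    have h2 := h.superMap.pd_pullback hx C fun y hy => h.sm y hy B
    rw [pd_congr C ((h.superMap.isOpen.eventually_mem hx).mono fun y hy => h.inverse y hy B),
      pd_coordFn] at h2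
    rw [Matrix.mul_apply, Matrix.one_apply, h2]
    rfl
  have h3 := congrFun (congrFun (matrix_mul_eq_one_comm h1) A) B
  rw [Matrix.mul_apply, Matrix.one_apply] at h3
  exact h3

theorem IsCoordChange.isSuperMap_cotMap (h : IsCoordChange φ ψ V) :
    IsSuperMap (cotMap φ ψ) {z | basePt z ∈ V} where
  isOpen := h.superMap.isOpen.preimage (baseCLM α β).continuous
  smooth A z hz := by
    rcases ix_or_ixs A with ⟨a, rfl⟩ | ⟨a, rfl⟩
    · rw [cotMap_ix]
      exact (sm_lift (h.superMap.sm a hz)).contDiffAt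
    · rw [cotMap_ixs]
      exact (Sm.sum fun B _ => (sm_lift (h.sm_invJac hz a B)).mul (Sm.coordFn _)).contDiffAt
  parity z hz A := by
    rcases ix_or_ixs A with ⟨a, rfl⟩ | ⟨a, rfl⟩
    · rw [cotMap_ix, par_ix]
      exact (h.superMap.parity _ hz a).emb
    · rw [cotMap_ixs]
      refine HasParity.sum fun B _ => ?_
      have h1 := (h.hasParity_invJac hz a B).emb (α := α)
      refine (h1.mul (hasParity_coordFn (ixs B))).congr ?_
      rcases a <;> rcases B <;> simp [par, ixs] <;> rfl

theorem pd_ix_cotMap_ix (h : IsCoordChange φ ψ V) (hz : basePt z ∈ V) (a b : α ⊕ β) :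
    pd (ix a) (cotMap φ ψ (ix b)) z = lift (pd a (φ b)) z := by
  rw [cotMap_ix, pd_ix_lift _ (h.superMap.sm b hz).differentiableAt]

theorem pd_ixs_cotMap_ix (h : IsCoordChange φ ψ V) (hz : basePt z ∈ V) (a b : α ⊕ β) :
    pd (ixs a) (cotMap φ ψ (ix b)) z = 0 := by
  rw [cotMap_ix, pd_ixs_lift _ (h.superMap.sm b hz).differentiableAt]

theorem pd_ixs_cotMap_ixs (h : IsCoordChange φ ψ V) (hz : basePt z ∈ V) (a b : α ⊕ β) :
    pd (ixs a) (cotMap φ ψ (ixs b)) z =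
      (-1 : ℝ) ^ ((par a + 1) * (par a + par b)) • lift (invJac φ ψ b a) z := by
  have hs : ∀ B, Sm (lift (invJac φ ψ b B)) z := fun B => sm_lift (h.sm_invJac hz b B)
  rw [cotMap_ixs, pd_sum _ fun B _ => ((hs B).mul (Sm.coordFn _)).differentiableAt,
    Finset.sum_eq_single a]
  · rw [pd_mul _ (hs a).differentiableAt (Sm.coordFn _).differentiableAt,
      pd_ixs_lift _ (h.sm_invJac hz b a).differentiableAt, zero_mul, zero_add, pd_coordFn,
      if_pos rfl, mul_one, lift_eq, ((h.hasParity_invJac hz b a).emb (α := α)).sp_eq]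
    congr 1
    rcases a <;> rcases b <;> norm_num [par, ixs]
  · intro B _ hB
    rw [pd_mul _ (hs B).differentiableAt (Sm.coordFn _).differentiableAt,
      pd_ixs_lift _ (h.sm_invJac hz b B).differentiableAt, zero_mul, zero_add, pd_coordFn,
      if_neg (mt ixs_inj.1 hB.symm), mul_zero]
  · simp

/-- The fibre-linear part of the mixed derivatives of the cotangent lift. -/
def fibreHess (φ ψ : α ⊕ β → SFun α β) (d b : α ⊕ β) : SFun (α ⊕ β) (β ⊕ α) := fun z =>
  ∑ B, lift (pullback φ (pd d (pd b (ψ B)))) z * coordFn (ixs B) z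

/-- Graded symmetry of the second derivatives of the inverse change. It is what makes the cotangent
lift compatible with the bracket. -/
theorem fibreHess_comm (h : IsCoordChange φ ψ V) (hz : basePt z ∈ V) (d b : α ⊕ β) :
    fibreHess φ ψ d b z = (-1 : ℝ) ^ (par d * par b) • fibreHess φ ψ b d z := by
  unfold fibreHess
  rw [Finset.smul_sum]
  refine Finset.sum_congr rfl fun B _ => ?_
  have hφ := h.superMap.parity _ hz
  have hs := h.sm _ hz B
  rw [lift_eq, lift_eq, pullback_congr hφ ((hs.pd b).pd d) (hs.pd_comm d b),
    pullback_smul hφ _ ((hs.pd d).pd b), map_smul, smul_mul_assoc]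

theorem hasParity_fibreHess (h : IsCoordChange φ ψ V) (hz : basePt z ∈ V) (d b : α ⊕ β) :
    HasParity (par d + par b + 1) (fibreHess φ ψ d b z) := by
  refine HasParity.sum fun B _ => ?_
  have h1 : HasParity (par B + par b + par d) (pullback φ (pd d (pd b (ψ B))) (basePt z)) := by
    refine hasParity_pullback (h.superMap.parity _ hz) (((h.sm _ hz B).pd b).pd d) ?_
    filter_upwards [(h.parity _ hz B).eventually_nhds.eventually_nhds] with y hy
    refine hasParity_pd d ?_
    filter_upwards [hy] with w hw
    exact hasParity_pd b hw
  refine (h1.emb.mul (hasParity_coordFn (ixs B))).congr ?_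
  rcases d <;> rcases b <;> rcases B <;> simp [par, ixs]

theorem pd_ix_cotMap_ixs (h : IsCoordChange φ ψ V) (hz : basePt z ∈ V) (a b : α ⊕ β) :
    pd (ix a) (cotMap φ ψ (ixs b)) z =
      ∑ d, lift (pd a (φ d)) z * fibreHess φ ψ d b z := by
  have hs : ∀ B, Sm (lift (invJac φ ψ b B)) z := fun B => sm_lift (h.sm_invJac hz b B)
  rw [cotMap_ixs, pd_sum _ fun B _ => ((hs B).mul (Sm.coordFn _)).differentiableAt]
  unfold fibreHess
  simp only [Finset.mul_sum]
  rw [Finset.sum_comm]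
  refine Finset.sum_congr rfl fun B _ => ?_
  rw [pd_mul _ (hs B).differentiableAt (Sm.coordFn _).differentiableAt, pd_coordFn,
    if_neg (ix_ne_ixs a B), mul_zero, add_zero,
    pd_ix_lift _ (h.sm_invJac hz b B).differentiableAt, lift_eq]
  have h1 : pd a (invJac φ ψ b B) (basePt z) =
      ∑ d, pd a (φ d) (basePt z) * pullback φ (pd d (pd b (ψ B))) (basePt z) :=
    h.superMap.pd_pullback hz a fun y hy => (h.sm y hy B).pd b
  rw [h1, map_sum, Finset.sum_mul]
  refine Finset.sum_congr rfl fun d _ => ?_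
  rw [map_mul, mul_assoc]
  rfl

/-- The cotangent lift of a coordinate change respects the Schouten bracket. -/
theorem IsCoordChange.actLocal_hamLocal_cotMap (h : IsCoordChange φ ψ V) (hz : basePt z ∈ V)
    {P P' : SFun (α ⊕ β) (β ⊕ α)}
    (hP' : ∀ w, basePt w ∈ V → Sm P' (bodyMap (cotMap φ ψ) w))
    (hp' : ∀ᶠ y in 𝓝 (bodyMap (cotMap φ ψ) z), HasParity 0 (P' y))
    (hPP' : ∀ w, basePt w ∈ V → P w = pullback (cotMap φ ψ) P' w)
    (B : (α ⊕ β) ⊕ (β ⊕ α)) :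
    actLocal (hamLocal P) (cotMap φ ψ B) z = pullback (cotMap φ ψ) (hamLocal P' B) z := by
  have hΦ := h.isSuperMap_cotMap
  have hzU : z ∈ {z | basePt z ∈ V} := hz
  have hpd : ∀ Z, pd Z P z =
      ∑ c, (pd Z (cotMap φ ψ (ix c)) z * pullback (cotMap φ ψ) (pd (ix c) P') z +
        pd Z (cotMap φ ψ (ixs c)) z * pullback (cotMap φ ψ) (pd (ixs c) P') z) := by
    intro Z
    rw [pd_congr Z ((hΦ.isOpen.eventually_mem hzU).mono fun w hw => hPP' w hw),
      hΦ.pd_pullback hzU Z hP', sum_ix_ixs]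
  have hπ : ∀ Z, HasParity (par Z) (pullback (cotMap φ ψ) (pd Z P') z) := by
    intro Z
    refine hasParity_pullback (hΦ.parity z hzU) ((hP' z hz).pd Z) ?_
    filter_upwards [hp'.eventually_nhds] with y hy
    simpa using hasParity_pd Z hy
  have hj : ∀ a b, HasParity (par b + par a) (lift (pd a (φ b)) z) := fun a b =>
    (hasParity_pd a ((h.superMap.isOpen.eventually_mem hz).mono fun y hy =>
      h.superMap.parity y hy b)).emb
  have hk : ∀ a b, HasParity (par b + par a) (lift (invJac φ ψ a b) z) := fun a b =>
    (h.hasParity_invJac hz a b).emb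
  have hθ := hasParity_fibreHess h hz
  have hkj : ∀ A B, ∑ C, lift (invJac φ ψ A C) z * lift (pd C (φ B)) z =
      if A = B then 1 else 0 := by
    intro A B
    have h1 := congrArg (emb α β) (h.invJac_mul hz A B)
    rw [map_sum] at h1
    simp only [map_mul] at h1
    refine h1.trans ?_
    split_ifs <;> simp
  have hkjs : ∀ A (f : α ⊕ β → Grass (β ⊕ α)),
      ∑ C, ∑ B, lift (invJac φ ψ A C) z * lift (pd C (φ B)) z * f B = f A := by
    intro A f
    rw [Finset.sum_comm]
    simp only [← Finset.sum_mul, hkj]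
    simp
  rw [actLocal_hamLocal, schouten_zero_apply]
  rcases ix_or_ixs B with ⟨b, rfl⟩ | ⟨b, rfl⟩
  · have hr : pullback (cotMap φ ψ) (hamLocal P' (ix b)) z =
        (-1 : ℝ) ^ (par b + 1) • pullback (cotMap φ ψ) (pd (ixs b) P') z := by
      rw [hamLocal_ix, pullback_smul (hΦ.parity z hzU) _ ((hP' z hz).pd _)]
    rw [hr]
    simp only [hpd, pd_ixs_cotMap_ix h hz, pd_ix_cotMap_ix h hz, pd_ixs_cotMap_ixs h hz, zero_mul,
      zero_add, mul_zero, add_zero, Finset.sum_mul, Finset.smul_sum]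
    rw [Finset.sum_comm]
    -- Once the Jacobian is moved next to its inverse, the remaining sign is independent of $a$, and
    -- the sum over $a$ contracts to a Kronecker delta.
    have h1 : ∀ c, ∑ a, (-1 : ℝ) ^ (par a + 1) •
        ((-1 : ℝ) ^ ((par a + 1) * (par a + par c)) • lift (invJac φ ψ c a) z *
          pullback (cotMap φ ψ) (pd (ixs c) P') z * lift (pd a (φ b)) z) =
        (-1 : ℝ) ^ (1 + par c + par c * par b + par b) •
          ((∑ a, lift (invJac φ ψ c a) z * lift (pd a (φ b)) z) *
            pullback (cotMap φ ψ) (pd (ixs c) P') z) := by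
      intro c
      rw [Finset.sum_mul, Finset.smul_sum]
      refine Finset.sum_congr rfl fun a _ => ?_
      rw [mul_assoc, (hπ (ixs c)).mul_swap (hj a b), mul_smul_comm, smul_mul_assoc, smul_smul,
        smul_smul, ← pow_add, ← pow_add, mul_assoc]
      congr 1
      rcases a <;> rcases b <;> rcases c <;> norm_num [par, ixs]
    rw [Finset.sum_congr rfl fun c _ => h1 c, Finset.sum_eq_single b]
    · rw [hkj, if_pos rfl, one_mul]
      congr 1
      rcases b <;> norm_num [par]
    · intro c _ hc
      rw [hkj, if_neg hc, zero_mul, smul_zero]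
    · simp
  · have hr : pullback (cotMap φ ψ) (hamLocal P' (ixs b)) z =
        (-1 : ℝ) ^ (par b + 1) • pullback (cotMap φ ψ) (pd (ix b) P') z := by
      rw [hamLocal_ixs, pullback_smul (hΦ.parity z hzU) _ ((hP' z hz).pd _)]
    rw [hr]
    -- The identities `t1`, `t2`, `t3` bring the inverse Jacobian and the Jacobian together at the
    -- left. The signs that remain involve neither $a$ nor $d$, so the sums over $a$ can be
    -- contracted.
    have t1 : ∀ a c d, (-1 : ℝ) ^ (par a + 1) •
        (((-1 : ℝ) ^ ((par a + 1) * (par a + par c)) • lift (invJac φ ψ c a) z *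
          pullback (cotMap φ ψ) (pd (ixs c) P') z) *
            (lift (pd a (φ d)) z * fibreHess φ ψ d b z)) =
        (-1 : ℝ) ^ (par b * par c + par b) • (lift (invJac φ ψ c a) z * lift (pd a (φ d)) z *
          (fibreHess φ ψ d b z * pullback (cotMap φ ψ) (pd (ixs c) P') z)) := by
      intro a c d
      rw [mul_assoc, (hπ (ixs c)).mul_swap ((hj a d).mul (hθ d b)), mul_smul_comm,
        smul_mul_assoc, smul_smul, smul_smul, ← pow_add, ← pow_add]
      simp only [mul_assoc]
      congr 1
      rcases a <;> rcases b <;> rcases c <;> rcases d <;> norm_num [par, ixs]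
    have t2 : ∀ a c, (-1 : ℝ) ^ (par a + 1) •
        ((lift (pd a (φ c)) z * pullback (cotMap φ ψ) (pd (ix c) P') z) *
          ((-1 : ℝ) ^ ((par a + 1) * (par a + par b)) • lift (invJac φ ψ b a) z)) =
        (-1 : ℝ) ^ (par b + 1) • (lift (invJac φ ψ b a) z * lift (pd a (φ c)) z *
          pullback (cotMap φ ψ) (pd (ix c) P') z) := by
      intro a c
      rw [mul_smul_comm, ((hj a c).mul (hπ (ix c))).mul_swap (hk b a), smul_smul, smul_smul,
        ← pow_add, ← pow_add, ← mul_assoc]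
      congr 1
      rcases a <;> rcases b <;> rcases c <;> norm_num [par, ix]
    have t3 : ∀ a c d, (-1 : ℝ) ^ (par a + 1) •
        (((lift (pd a (φ d)) z * fibreHess φ ψ d c z) *
          pullback (cotMap φ ψ) (pd (ixs c) P') z) *
            ((-1 : ℝ) ^ ((par a + 1) * (par a + par b)) • lift (invJac φ ψ b a) z)) =
        (-1 : ℝ) ^ (par b + 1) • (lift (invJac φ ψ b a) z * lift (pd a (φ d)) z *
          (fibreHess φ ψ d c z * pullback (cotMap φ ψ) (pd (ixs c) P') z)) := by
      intro a c d
      rw [mul_smul_comm, (((hj a d).mul (hθ d c)).mul (hπ (ixs c))).mul_swap (hk b a), smul_smul,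
        smul_smul, ← pow_add, ← pow_add]
      simp only [mul_assoc]
      congr 1
      rcases a <;> rcases b <;> rcases c <;> rcases d <;> norm_num [par, ixs]
    have e1 : ∀ a, (-1 : ℝ) ^ (par a + 1) •
        (pd (ixs a) P z * pd (ix a) (cotMap φ ψ (ixs b)) z) =
        ∑ c, ∑ d, (-1 : ℝ) ^ (par b * par c + par b) •
          (lift (invJac φ ψ c a) z * lift (pd a (φ d)) z *
            (fibreHess φ ψ d b z * pullback (cotMap φ ψ) (pd (ixs c) P') z)) := by
      intro a
      rw [hpd, pd_ix_cotMap_ixs h hz, Finset.sum_mul, Finset.smul_sum]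
      refine Finset.sum_congr rfl fun c _ => ?_
      rw [pd_ixs_cotMap_ix h hz, pd_ixs_cotMap_ixs h hz, zero_mul, zero_add, Finset.mul_sum,
        Finset.smul_sum]
      exact Finset.sum_congr rfl fun d _ => t1 a c d
    have e2 : ∀ a, (-1 : ℝ) ^ (par a + 1) •
        (pd (ix a) P z * pd (ixs a) (cotMap φ ψ (ixs b)) z) =
        ∑ c, (-1 : ℝ) ^ (par b + 1) • (lift (invJac φ ψ b a) z * lift (pd a (φ c)) z *
          pullback (cotMap φ ψ) (pd (ix c) P') z) +
        ∑ c, ∑ d, (-1 : ℝ) ^ (par b + 1) • (lift (invJac φ ψ b a) z * lift (pd a (φ d)) z *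
          (fibreHess φ ψ d c z * pullback (cotMap φ ψ) (pd (ixs c) P') z)) := by
      intro a
      rw [hpd, pd_ixs_cotMap_ixs h hz, Finset.sum_mul, Finset.smul_sum, ← Finset.sum_add_distrib]
      refine Finset.sum_congr rfl fun c _ => ?_
      rw [pd_ix_cotMap_ix h hz, pd_ix_cotMap_ixs h hz, add_mul, smul_add, t2, Finset.sum_mul,
        Finset.sum_mul, Finset.smul_sum]
      exact congrArg _ (Finset.sum_congr rfl fun d _ => t3 a c d)
    simp only [smul_add, e1, e2, Finset.sum_add_distrib]
    have f1 : ∑ a, ∑ c, ∑ d, (-1 : ℝ) ^ (par b * par c + par b) •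
          (lift (invJac φ ψ c a) z * lift (pd a (φ d)) z *
            (fibreHess φ ψ d b z * pullback (cotMap φ ψ) (pd (ixs c) P') z)) =
        ∑ c, (-1 : ℝ) ^ par b •
          (fibreHess φ ψ b c z * pullback (cotMap φ ψ) (pd (ixs c) P') z) := by
      rw [Finset.sum_comm]
      refine Finset.sum_congr rfl fun c _ => ?_
      simp only [← Finset.smul_sum]
      rw [hkjs c fun d => fibreHess φ ψ d b z * pullback (cotMap φ ψ) (pd (ixs c) P') z,
        fibreHess_comm h hz c b, smul_mul_assoc, smul_smul, ← pow_add]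
      congr 1
      rcases b <;> rcases c <;> norm_num [par]
    have f2 : ∑ a, ∑ c, (-1 : ℝ) ^ (par b + 1) • (lift (invJac φ ψ b a) z * lift (pd a (φ c)) z *
          pullback (cotMap φ ψ) (pd (ix c) P') z) =
        (-1 : ℝ) ^ (par b + 1) • pullback (cotMap φ ψ) (pd (ix b) P') z := by
      simp only [← Finset.smul_sum]
      rw [hkjs b fun c => pullback (cotMap φ ψ) (pd (ix c) P') z]
    have f3 : ∑ a, ∑ c, ∑ d, (-1 : ℝ) ^ (par b + 1) •
          (lift (invJac φ ψ b a) z * lift (pd a (φ d)) z *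
            (fibreHess φ ψ d c z * pullback (cotMap φ ψ) (pd (ixs c) P') z)) =
        ∑ c, (-1 : ℝ) ^ (par b + 1) •
          (fibreHess φ ψ b c z * pullback (cotMap φ ψ) (pd (ixs c) P') z) := by
      rw [Finset.sum_comm]
      refine Finset.sum_congr rfl fun c _ => ?_
      simp only [← Finset.smul_sum]
      rw [hkjs b fun d => fibreHess φ ψ d c z * pullback (cotMap φ ψ) (pd (ixs c) P') z]
    -- The Hessian sums `f1` and `f3` cancel: `fibreHess_comm` has put them in the same form with
    -- opposite signs. Only `f2` is left.
    rw [f1, f2, f3, add_left_comm, ← Finset.sum_add_distrib, Finset.sum_eq_zero, add_zero]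
    intro c _
    rw [pow_succ, mul_neg_one, neg_smul, add_neg_cancel]

end CotangentLift

/-! ### Transformation of the divergence -/

section Divergence

open Filter Topology

variable {α β : Type} [Fintype α] [Fintype β] [DecidableEq α] [DecidableEq β]
  {φ : α ⊕ β → SFun α β} {X X' : α ⊕ β → SFun α β} {U : Set (α → ℝ)} {x : α → ℝ}
  {F G : SFun α β}

theorem isUnit_gmul {g h : Grass β} : IsUnit (g * h) ↔ IsUnit g ∧ IsUnit h := by
  simp only [isUnit_iff_body_ne_zero, map_mul, mul_ne_zero_iff]

theorem ringInverse_gmul {g h : Grass β} (hg : IsUnit g) (hh : IsUnit h) :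
    Ring.inverse (g * h) = Ring.inverse h * Ring.inverse g := by
  refine (isUnit_gmul.2 ⟨hg, hh⟩).mul_left_cancel ?_
  rw [Ring.mul_inverse_cancel _ (isUnit_gmul.2 ⟨hg, hh⟩), mul_assoc, ← mul_assoc h,
    Ring.mul_inverse_cancel _ hh, one_mul, Ring.mul_inverse_cancel _ hg]

/-- The logarithmic derivative of a product is the sum of those of the factors. Evenness of $F$
removes the sign of the Leibniz rule and lets $F$ pass the derivative of $G$. -/
theorem actLocal_mul_ringInverse (hX : OddAt X x) (hF : Sm F x) (hG : Sm G x)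
    (pF : HasParity 0 (F x)) (uF : IsUnit (F x)) (uG : IsUnit (G x)) :
    actLocal X (fun y => F y * G y) x * Ring.inverse (F x * G x) =
      actLocal X F x * Ring.inverse (F x) + actLocal X G x * Ring.inverse (G x) := by
  rw [actLocal_mul hX hF.differentiableAt hG.differentiableAt, hasParity_zero_iff.1 pF,
    ringInverse_gmul uF uG, add_mul, mul_assoc, ← mul_assoc (G x), Ring.mul_inverse_cancel _ uG,
    one_mul, pF.mul_comm_of_even, mul_assoc, ← mul_assoc (F x), pF.mul_comm_of_even, mul_assoc,
    Ring.mul_inverse_cancel _ uF, mul_one]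

theorem ringInverse_mul_lieLocal' (hX : OddAt X x) (hs : ∀ A, Sm (X A) x) (hF : Sm F x)
    (pF : ∀ᶠ y in 𝓝 x, HasParity 0 (F y)) (uF : IsUnit (F x)) :
    Ring.inverse (F x) * lieLocal 1 X F x = sdiv X x + actLocal X F x * Ring.inverse (F x) := by
  rw [ringInverse_mul_lieLocal hX hs hF pF uF, actLocal_applyFn_log hF pF uF]

theorem pullback_ringInverse (hφ : ParityAt φ x) (hF : Sm F (bodyMap φ x))
    (uF : IsUnit (F (bodyMap φ x))) :
    IsUnit (pullback φ F x) ∧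
      pullback φ (fun y => Ring.inverse (F y)) x = Ring.inverse (pullback φ F x) := by
  have hu : IsUnit (pullback φ F x) := by
    rw [isUnit_iff_body_ne_zero, body_pullback hφ hF]
    exact isUnit_iff_body_ne_zero.1 uF
  refine ⟨hu, hu.mul_right_cancel ?_⟩
  rw [Ring.inverse_mul_cancel _ hu, ← pullback_mul hφ (sm_ringInverse hF uF) hF,
    ← pullback_one (β' := β) hφ]
  exact pullback_congr hφ ((sm_ringInverse hF uF).mul hF)
    ((eventually_isUnit hF uF).mono fun z hz => Ring.inverse_mul_cancel _ hz)

theorem IsSuperMap.actLocal_pullback (h : IsSuperMap φ U) (hx : x ∈ U)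
    (hs' : ∀ A, Sm (X' A) (bodyMap φ x)) (hF : ∀ y ∈ U, Sm F (bodyMap φ y))
    (hXX' : ∀ B, actLocal X (φ B) x = pullback φ (X' B) x) :
    actLocal X (pullback φ F) x = pullback φ (actLocal X' F) x := by
  have h1 : pullback φ (actLocal X' F) x = ∑ B, pullback φ (X' B) x * pullback φ (pd B F) x := by
    refine (pullback_sum (h.parity x hx) fun B _ => (hs' B).mul ((hF x hx).pd B)).trans
      (Finset.sum_congr rfl fun B _ => ?_)
    exact pullback_mul (h.parity x hx) (hs' B) ((hF x hx).pd B)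
  rw [h1]
  simp only [← hXX']
  unfold actLocal
  simp only [h.pd_pullback hx _ hF, Finset.mul_sum, Finset.sum_mul]
  rw [Finset.sum_comm]
  exact Finset.sum_congr rfl fun B _ => Finset.sum_congr rfl fun A _ => (mul_assoc _ _ _).symm

/-- The divergence of an odd vector field does not depend on the coordinates. -/
theorem IsSuperMap.pullback_divergence (h : IsSuperMap φ U) (hx : x ∈ U)
    (hX : ∀ y ∈ U, OddAt X y) (hX' : ∀ᶠ y in 𝓝 (bodyMap φ x), OddAt X' y)
    (hs : ∀ A, Sm (X A) x) (hs' : ∀ A, ∀ y ∈ U, Sm (X' A) (bodyMap φ y))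
    (hXX' : ∀ B, ∀ y ∈ U, actLocal X (φ B) y = pullback φ (X' B) y)
    (hF : Sm F x) (pF : ∀ᶠ y in 𝓝 x, HasParity 0 (F y)) (uF : IsUnit (F x))
    (hG : ∀ y ∈ U, Sm G (bodyMap φ y)) (pG : ∀ᶠ y in 𝓝 (bodyMap φ x), HasParity 0 (G y))
    (uG : IsUnit (G (bodyMap φ x)))
    (hFG : ∀ y ∈ U, F y = Ber (jacobian φ y) * pullback φ G y) :
    Ring.inverse (F x) * lieLocal 1 X F x =
      pullback φ (fun y => Ring.inverse (G y) * lieLocal 1 X' G y) x := by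
  have hφ := h.parity x hx
  have hXx := hX x hx
  have hXe : ∀ᶠ y in 𝓝 x, OddAt X y := (h.isOpen.eventually_mem hx).mono hX
  have hu : IsUnit (Ber (jacobian φ x)) := by
    rw [hFG x hx] at uF
    exact (isUnit_gmul.1 uF).1
  have hJ : ∀ᶠ y in 𝓝 x, EvenSuper (jacobian φ y) :=
    (h.isOpen.eventually_mem hx).mono fun y hy => h.evenSuper_jacobian hy
  have hBs := (actLocal_Ber hXx (h.matSm_jacobian hx) hJ hu).1
  have hπ := h.sm_pullback hx (hG x hx)
  obtain ⟨hπu, hπi⟩ := pullback_ringInverse hφ (hG x hx) uG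
  have hact : Sm (actLocal X' G) (bodyMap φ x) := sm_actLocal (fun A => hs' A x hx) (hG x hx)
  have hinv := sm_ringInverse (hG x hx) uG
  have hev : (fun y => Ring.inverse (G y) * lieLocal 1 X' G y) =ᶠ[𝓝 (bodyMap φ x)]
      fun y => sdiv X' y + actLocal X' G y * Ring.inverse (G y) := by
    filter_upwards [hX', (hG x hx).eventually_nhds, pG.eventually_nhds,
      eventually_isUnit (hG x hx) uG,
      eventually_all.2 fun A => (hs' A x hx).eventually_nhds] with y h1 h2 h3 h4 h5
    exact ringInverse_mul_lieLocal' h1 h5 h2 h3 h4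
  have hsd : Sm (sdiv X') (bodyMap φ x) := sm_sdiv fun A => hs' A x hx
  rw [ringInverse_mul_lieLocal' hXx hs hF pF uF,
    pullback_congr hφ ((hsd.add (hact.mul hinv)).congr hev) hev,
    pullback_add hφ hsd (hact.mul hinv), pullback_mul hφ hact hinv, hπi,
    ← h.actLocal_pullback hx (fun A => hs' A x hx) hG (fun B => hXX' B x hx),
    h.sdiv_eq hx hXe hs hs' hXX' hu,
    actLocal_congr ((h.isOpen.eventually_mem hx).mono hFG), hFG x hx,
    actLocal_mul_ringInverse hXx hBs hπ (hasParity_Ber _) hu hπu,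
    (hasParity_Ber _).ringInverse.mul_comm_of_even, add_assoc]

end Divergence

/-! ### Higher Poisson manifolds -/

section HigherPoisson

open Filter Topology

variable {n m : ℕ} {M : Supermanifold.{u, v} n m}

/-- The inverse relation is the cocycle condition for the charts $i,j,i$ combined with the
triviality of the change from $i$ to $i$. -/
theorem Supermanifold.isCoordChange (M : Supermanifold.{u, v} n m) (i j : M.Idx) :
    IsCoordChange (M.trans i j) (M.trans j i) ((M.chart i).symm.trans (M.chart j)).source := by
  have hmem : ∀ x ∈ ((M.chart i).symm.trans (M.chart j)).source,
      bodyMap (M.trans i j) x ∈ ((M.chart j).symm.trans (M.chart i)).source := by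
    intro x hx
    rw [M.body_eq i j x hx]
    have h := ((M.chart i).symm.trans (M.chart j)).map_source hx
    rw [← OpenPartialHomeomorph.symm_source] at h
    simpa using h
  have hopen := ((M.chart i).symm.trans (M.chart j)).open_source
  have hopen' := ((M.chart j).symm.trans (M.chart i)).open_source
  refine ⟨⟨hopen, fun A x hx => (M.smooth i j A).contDiffAt (hopen.mem_nhds hx),
    fun x hx A => M.parity i j A x hx⟩, fun x hx B => ?_, fun x hx B => ?_, fun x hx B => ?_⟩
  · exact Sm.of_contDiffOn hopen' (M.smooth j i B) (hmem x hx)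
  · exact (hopen'.eventually_mem (hmem x hx)).mono fun y hy => M.parity j i B y hy
  · have hx1 : x ∈ (M.chart i).target := by
      rw [OpenPartialHomeomorph.trans_source] at hx
      exact hx.1
    rw [← M.cocycle i j i B x hx (by
      rw [OpenPartialHomeomorph.trans_source]
      exact ⟨hx1, (M.chart i).map_target hx1⟩), M.refl i B x hx1]

theorem isSuperMap_piTstar (i j : M.Idx) :
    IsSuperMap ((PiTstar M).trans i j) ((PiTstar M).ovl i j) :=
  (M.isCoordChange i j).isSuperMap_cotMap

variable {P ρ ρ' : Fam (PiTstar M)} {i j : M.Idx} {z : Fin n ⊕ Fin m → ℝ}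

theorem sm_of_contDiffOn {F : Fam (PiTstar M)}
    (hF : ∀ i, ContDiffOn ℝ ∞ (F i) ((PiTstar M).dom i)) (hz : z ∈ (PiTstar M).dom i) :
    Sm (F i) z := Sm.of_contDiffOn ((PiTstar M).isOpen_dom i) (hF i) hz

theorem eventually_of_dom {p : (Fin n ⊕ Fin m → ℝ) → Prop} (h : ∀ y ∈ (PiTstar M).dom i, p y)
    (hz : z ∈ (PiTstar M).dom i) : ∀ᶠ y in 𝓝 z, p y :=
  (((PiTstar M).isOpen_dom i).eventually_mem hz).mono h

theorem hamiltonian_eq (i : M.Idx) : hamiltonian M P i = hamLocal (P i) := rfl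

theorem IsHigherPoisson.sm (hP : IsHigherPoisson M P) (hz : z ∈ (PiTstar M).dom i) :
    Sm (P i) z := sm_of_contDiffOn hP.mem.1 hz

theorem IsHigherPoisson.parity (hP : IsHigherPoisson M P) (hz : z ∈ (PiTstar M).dom i) :
    ∀ᶠ y in 𝓝 z, HasParity 0 (P i y) := eventually_of_dom (hP.even i) hz

theorem IsHigherPoisson.sm_ham (hP : IsHigherPoisson M P) (hz : z ∈ (PiTstar M).dom i)
    (A : (Fin n ⊕ Fin m) ⊕ (Fin m ⊕ Fin n)) : Sm (hamiltonian M P i A) z :=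
  sm_hamLocal (hP.sm hz) A

theorem IsHigherPoisson.odd_ham (hP : IsHigherPoisson M P) (hz : z ∈ (PiTstar M).dom i) :
    OddAt (hamiltonian M P i) z := oddAt_hamLocal (hP.parity hz)

theorem IsHigherPoisson.ham_ham (hP : IsHigherPoisson M P) (hz : z ∈ (PiTstar M).dom i)
    (A : (Fin n ⊕ Fin m) ⊕ (Fin m ⊕ Fin n)) :
    actLocal (hamiltonian M P i) (hamiltonian M P i A) z = 0 :=
  actLocal_hamLocal_hamLocal (hP.sm hz) (hP.parity hz) (eventually_of_dom (hP.bracket i) hz) A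

theorem IsHigherPoisson.sq_zero (hP : IsHigherPoisson M P) (hz : z ∈ (PiTstar M).dom i)
    {f : SFun (Fin n ⊕ Fin m) (Fin m ⊕ Fin n)} (hf : Sm f z) :
    actLocal (hamiltonian M P i) (actLocal (hamiltonian M P i) f) z = 0 := by
  rw [actLocal_actLocal (hP.odd_ham hz) (hP.sm_ham hz) hf]
  exact Finset.sum_eq_zero fun A _ => by rw [hP.ham_ham hz, zero_mul]

theorem IsHigherPoisson.compat (hP : IsHigherPoisson M P)
    (B : (Fin n ⊕ Fin m) ⊕ (Fin m ⊕ Fin n)) (hz : z ∈ (PiTstar M).ovl i j) :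
    actLocal (hamiltonian M P i) ((PiTstar M).trans i j B) z =
      pullback ((PiTstar M).trans i j) (hamiltonian M P j B) z :=
  (M.isCoordChange i j).actLocal_hamLocal_cotMap hz
    (fun w hw => hP.sm ((PiTstar M).body_mem i j w hw))
    (hP.parity ((PiTstar M).body_mem i j z hz)) (fun w hw => hP.mem.2 i j w hw) B

theorem IsHigherPoisson.isHomological (hP : IsHigherPoisson M P) :
    IsHomological (PiTstar M) (hamiltonian M P) where
  isVectorField :=
    { smooth := fun _ A _ hz => (hP.sm_ham hz A).contDiffAt.contDiffWithinAt
      parity := fun _ A _ hz => hP.odd_ham hz A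
      compat := fun _ _ B _ hz => hP.compat B hz }
  sq_zero := fun i _ hf _ hz =>
    hP.sq_zero hz (Sm.of_contDiffOn ((PiTstar M).isOpen_dom i) hf hz)

theorem IsBerezinVolume.sm (hρ : IsBerezinVolume (PiTstar M) ρ) (hz : z ∈ (PiTstar M).dom i) :
    Sm (ρ i) z := sm_of_contDiffOn hρ.smooth hz

theorem IsBerezinVolume.parity (hρ : IsBerezinVolume (PiTstar M) ρ)
    (hz : z ∈ (PiTstar M).dom i) : ∀ᶠ y in 𝓝 z, HasParity 0 (ρ i y) :=
  eventually_of_dom (hρ.even i) hz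

theorem IsHigherPoisson.divergence_eq (hP : IsHigherPoisson M P)
    (hρ : IsBerezinVolume (PiTstar M) ρ) (hz : z ∈ (PiTstar M).dom i) :
    divergence 1 ρ (hamiltonian M P) i z = sdiv (hamiltonian M P i) z +
      actLocal (hamiltonian M P i) (applyFn Real.log (ρ i)) z :=
  ringInverse_mul_lieLocal (hP.odd_ham hz) (hP.sm_ham hz) (hρ.sm hz) (hρ.parity hz)
    (hρ.invertible i z hz)

theorem IsHigherPoisson.divergence_mem_functions (hP : IsHigherPoisson M P)
    (hρ : IsBerezinVolume (PiTstar M) ρ) :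
    divergence 1 ρ (hamiltonian M P) ∈ functions (PiTstar M) := by
  refine ⟨fun i z hz => ?_, fun i j z hz => ?_⟩
  · have h1 := (sm_sdiv (hP.sm_ham hz)).add (sm_actLocal (hP.sm_ham hz)
      (sm_applyFn_log (hρ.sm hz) (hρ.parity hz) (hρ.invertible i z hz)))
    exact (h1.congr (eventually_of_dom (fun y hy => hP.divergence_eq hρ hy)
      hz)).contDiffAt.contDiffWithinAt
  · have hd := (PiTstar M).ovl_subset i j
    have hb := (PiTstar M).body_mem i j
    exact (isSuperMap_piTstar i j).pullback_divergence hz (fun y hy => hP.odd_ham (hd hy))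
      (eventually_of_dom (fun y hy => hP.odd_ham hy) (hb z hz)) (hP.sm_ham (hd hz))
      (fun A y hy => hP.sm_ham (hb y hy) A) (fun B y hy => hP.compat B hy) (hρ.sm (hd hz))
      (hρ.parity (hd hz)) (hρ.invertible i z (hd hz)) (fun y hy => hρ.sm (hb y hy))
      (hρ.parity (hb z hz)) (hρ.invertible j _ (hb z hz)) (fun y hy => hρ.compat i j y hy)

/-- The divergence is the coordinate divergence, killed by `actLocal_sdiv`, plus $Q(\log|\rho|)$,
killed by $Q^2=0$. The split is made in each chart separately; neither summand need be a global
function. -/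
theorem IsHigherPoisson.divergence_mem_cocycles (hP : IsHigherPoisson M P)
    (hρ : IsBerezinVolume (PiTstar M) ρ) :
    divergence 1 ρ (hamiltonian M P) ∈ cocycles (PiTstar M) (hamiltonian M P) := by
  refine ⟨hP.divergence_mem_functions hρ, fun i z hz => ?_⟩
  have hlog := sm_applyFn_log (hρ.sm hz) (hρ.parity hz) (hρ.invertible i z hz)
  refine (actLocal_congr (eventually_of_dom (fun y hy => hP.divergence_eq hρ hy) hz)).trans ?_
  rw [actLocal_add (sm_sdiv (hP.sm_ham hz)).differentiableAt
    (sm_actLocal (hP.sm_ham hz) hlog).differentiableAt, hP.sq_zero hz hlog, add_zero]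
  exact actLocal_sdiv (eventually_of_dom (fun y hy => hP.odd_ham hy) hz) (hP.sm_ham hz)
    fun A => eventually_of_dom (fun y hy => hP.ham_ham hy A) hz

/-- The quotient of two Berezin volumes. -/
def volumeRatio (ρ ρ' : Fam (PiTstar M)) : Fam (PiTstar M) :=
  fun i z => ρ i z * Ring.inverse (ρ' i z)

theorem IsBerezinVolume.ratio (hρ : IsBerezinVolume (PiTstar M) ρ)
    (hρ' : IsBerezinVolume (PiTstar M) ρ') (hz : z ∈ (PiTstar M).dom i) :
    Sm (volumeRatio ρ ρ' i) z ∧ HasParity 0 (volumeRatio ρ ρ' i z) ∧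
      IsUnit (volumeRatio ρ ρ' i z) :=
  ⟨(hρ.sm hz).mul (sm_ringInverse (hρ'.sm hz) (hρ'.invertible i z hz)),
    HasParity.mul (e := 0) (f := 0) (hρ.even i z hz) (hρ'.even i z hz).ringInverse,
    (hρ.invertible i z hz).mul (hρ'.invertible i z hz).ringInverse⟩

/-- Both volumes acquire the same Berezinian, which is even and cancels in the quotient. -/
theorem IsBerezinVolume.ratio_compat (hρ : IsBerezinVolume (PiTstar M) ρ)
    (hρ' : IsBerezinVolume (PiTstar M) ρ') (hz : z ∈ (PiTstar M).ovl i j) :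
    volumeRatio ρ ρ' i z = pullback ((PiTstar M).trans i j) (volumeRatio ρ ρ' j) z := by
  have hb := (PiTstar M).body_mem i j z hz
  have hφ := (isSuperMap_piTstar i j).parity z hz
  have hu' := hρ'.invertible j _ hb
  obtain ⟨hπ, hi⟩ := pullback_ringInverse hφ (hρ'.sm hb) hu'
  have hB : IsUnit (Ber (jacobian ((PiTstar M).trans i j) z)) := by
    have h := hρ.invertible i z ((PiTstar M).ovl_subset i j hz)
    rw [hρ.compat i j z hz] at h
    exact (isUnit_gmul.1 h).1
  have h1 : pullback ((PiTstar M).trans i j) (volumeRatio ρ ρ' j) z =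
      pullback ((PiTstar M).trans i j) (ρ j) z *
        pullback ((PiTstar M).trans i j) (fun y => Ring.inverse (ρ' j y)) z :=
    pullback_mul hφ (hρ.sm hb) (sm_ringInverse (hρ'.sm hb) hu')
  rw [h1, hi]
  change ρ i z * Ring.inverse (ρ' i z) = _
  rw [hρ.compat i j z hz, hρ'.compat i j z hz, ringInverse_gmul hB hπ,
    (hasParity_Ber _).mul_comm_of_even, mul_assoc, ← mul_assoc (Ber _),
    (hasParity_Ber _).mul_comm_of_even, mul_assoc, Ring.mul_inverse_cancel _ hB, mul_one]

theorem IsBerezinVolume.log_ratio_mem (hρ : IsBerezinVolume (PiTstar M) ρ)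
    (hρ' : IsBerezinVolume (PiTstar M) ρ') :
    (fun i => applyFn Real.log (volumeRatio ρ ρ' i) : Fam (PiTstar M)) ∈
      functions (PiTstar M) := by
  have hpar : ∀ {i : M.Idx} {z : Fin n ⊕ Fin m → ℝ}, z ∈ (PiTstar M).dom i →
      ∀ᶠ y in 𝓝 z, HasParity 0 (volumeRatio ρ ρ' i y) := fun hz =>
    eventually_of_dom (fun y hy => (hρ.ratio hρ' hy).2.1) hz
  refine ⟨fun i z hz => ?_, fun i j z hz => ?_⟩
  · obtain ⟨h1, _, h3⟩ := hρ.ratio hρ' hz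
    exact (sm_applyFn_log h1 (hpar hz) h3).contDiffAt.contDiffWithinAt
  · have hb := (PiTstar M).body_mem i j z hz
    have hd := (PiTstar M).ovl_subset i j hz
    exact (pullback_applyFn_log ((isSuperMap_piTstar i j).parity z hz) (hρ.ratio hρ' hb).1
      (hpar hb) (hρ.ratio hρ' hb).2.2 (hρ.ratio_compat hρ' hz) (hρ.ratio hρ' hd).1
      (hpar hd)).symm

/-- The divergences with respect to two Berezin volumes are cohomologous. -/
theorem IsHigherPoisson.divergence_sub_mem (hP : IsHigherPoisson M P)
    (hρ : IsBerezinVolume (PiTstar M) ρ) (hρ' : IsBerezinVolume (PiTstar M) ρ') :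
    divergence 1 ρ (hamiltonian M P) - divergence 1 ρ' (hamiltonian M P) ∈
      coboundaries (PiTstar M) (hamiltonian M P) := by
  refine ⟨(functions _).sub_mem (hP.divergence_mem_functions hρ)
    (hP.divergence_mem_functions hρ'), _, hρ.log_ratio_mem hρ', fun i z hz => ?_⟩
  obtain ⟨hrs, hrp, hru⟩ := hρ.ratio hρ' hz
  have hu' := hρ'.invertible i z hz
  have hpar : ∀ᶠ y in 𝓝 z, HasParity 0 (volumeRatio ρ ρ' i y) :=
    eventually_of_dom (fun y hy => (hρ.ratio hρ' hy).2.1) hz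
  have hmul : ∀ y ∈ (PiTstar M).dom i, ρ i y = volumeRatio ρ ρ' i y * ρ' i y := by
    intro y hy
    change _ = ρ i y * Ring.inverse (ρ' i y) * ρ' i y
    rw [mul_assoc, Ring.inverse_mul_cancel _ (hρ'.invertible i y hy), mul_one]
  change divergence 1 ρ (hamiltonian M P) i z - divergence 1 ρ' (hamiltonian M P) i z =
    actLocal (hamiltonian M P i) (applyFn Real.log (volumeRatio ρ ρ' i)) z
  rw [hP.divergence_eq hρ hz, hP.divergence_eq hρ' hz, add_sub_add_left_eq_sub,
    actLocal_applyFn_log (hρ.sm hz) (hρ.parity hz) (hρ.invertible i z hz),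
    actLocal_applyFn_log (hρ'.sm hz) (hρ'.parity hz) hu', actLocal_applyFn_log hrs hpar hru,
    actLocal_congr (eventually_of_dom hmul hz), hmul z hz,
    actLocal_mul_ringInverse (hP.odd_ham hz) hrs (hρ'.sm hz) hrp hru hu', add_sub_cancel_right]

/-- Since $\log\sqrt{|t|}=\frac12\log|t|$, and `Real.log` already contains the absolute value, half
of the split divergence is the asserted expression. -/
theorem IsHigherPoisson.bvLaplacian_eq (hP : IsHigherPoisson M P)
    (hρ : IsBerezinVolume (PiTstar M) ρ) (hz : z ∈ (PiTstar M).dom i) :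
    bvLaplacian M ρ P i z =
      ∑ a : Fin n ⊕ Fin m, ((-1 : ℝ) ^ (par a + 1)) • pd (ix a) (pd (ixs a) (P i)) z +
        schouten 0 (P i) (applyFn (fun t : ℝ => Real.log (Real.sqrt |t|)) (ρ i)) z := by
  have hfn : (fun t : ℝ => Real.log (Real.sqrt |t|)) = fun t => (1 / 2 : ℝ) * Real.log t := by
    funext t
    rw [Real.log_sqrt (abs_nonneg t), Real.log_abs]
    ring
  have hlog := sm_applyFn_log (hρ.sm hz) (hρ.parity hz) (hρ.invertible i z hz)
  have h1 : applyFn (fun t : ℝ => Real.log (Real.sqrt |t|)) (ρ i) =ᶠ[𝓝 z]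
      fun y => (1 / 2 : ℝ) • applyFn Real.log (ρ i) y := by
    refine eventually_of_dom (fun y hy => ?_) hz
    rw [hfn]
    exact applyFn_const_mul _ (hρ.even i y hy) ((isOpen_ne.eventually_mem
      (isUnit_iff_body_ne_zero.1 (hρ.invertible i y hy))).mono fun s hs =>
        Real.contDiffAt_log.2 hs)
  rw [← actLocal_hamLocal, actLocal_congr h1, actLocal_smul _ hlog.differentiableAt]
  change (1 / 2 : ℝ) • divergence 1 ρ (hamiltonian M P) i z = _
  rw [hP.divergence_eq hρ hz, hamiltonian_eq, sdiv_hamLocal (hP.sm hz), smul_add, smul_smul]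
  norm_num

/-- The definition of the modular class picks some volume; $\rho$ shows that one exists, so the
dummy values are not used, and the picked volume gives a divergence cohomologous to that of $\rho$.
-/
theorem IsHigherPoisson.poissonModularClass_eq (hP : IsHigherPoisson M P)
    (hρ : IsBerezinVolume (PiTstar M) ρ)
    (h : bvLaplacian M ρ P ∈ cocycles (PiTstar M) (hamiltonian M P)) :
    poissonModularClass M P = stdClass (PiTstar M) (hamiltonian M P) (bvLaplacian M ρ P) h := by
  have hex : ∃ ρ : Fam (PiTstar M), IsBerezinVolume (PiTstar M) ρ := ⟨ρ, hρ⟩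
  have hmem := hP.divergence_mem_cocycles hex.choose_spec
  rw [poissonModularClass, modularClass, dif_pos hex, dif_pos hmem]
  unfold stdClass
  rw [← Submodule.Quotient.mk_smul, Submodule.Quotient.eq]
  have h1 := (coboundaries (PiTstar M) (hamiltonian M P)).smul_mem (1 / 2 : ℝ)
    (hP.divergence_sub_mem hex.choose_spec hρ)
  rw [smul_sub] at h1
  exact h1

end HigherPoisson

end Super

end

/-! ### The modular class of a higher Poisson manifold. -/

theorem mainTheorem1 {n m : ℕ} (M : Super.Supermanifold.{u, v} n m)
    (P : Super.Fam (Super.PiTstar M)) (hP : Super.IsHigherPoisson M P)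
    (ρ : Super.Fam (Super.PiTstar M)) (hρ : Super.IsBerezinVolume (Super.PiTstar M) ρ) :
    -- `(ΠT*M, Q_P)` is a Q-manifold, and `Q_P = [[P, ·]]`
    Super.IsHomological (Super.PiTstar M) (Super.hamiltonian M P) ∧
    (∀ i (f : Super.SFun (Fin n ⊕ Fin m) (Fin m ⊕ Fin n)),
      ContDiffOn ℝ ∞ f ((Super.PiTstar M).dom i) → ∀ z ∈ (Super.PiTstar M).dom i,
        Super.actLocal (Super.hamiltonian M P i) f z = Super.schouten 0 (P i) f z) ∧
    -- the modular class of `(M, P)` is the standard cohomology class of `Δ_ρ P`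
    (∃ h : Super.bvLaplacian M ρ P ∈
        Super.cocycles (Super.PiTstar M) (Super.hamiltonian M P),
      Super.poissonModularClass M P =
        Super.stdClass (Super.PiTstar M) (Super.hamiltonian M P) (Super.bvLaplacian M ρ P) h) ∧
    -- the expression of `Δ_ρ P` in Darboux coordinates
    (∀ i, ∀ z ∈ (Super.PiTstar M).dom i,
      Super.bvLaplacian M ρ P i z =
        ∑ a : Fin n ⊕ Fin m, ((-1 : ℝ) ^ (Super.par a + 1)) •
            Super.pd (Super.ix a) (Super.pd (Super.ixs a) (P i)) z +
          Super.schouten 0 (P i)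
            (Super.applyFn (fun t : ℝ => Real.log (Real.sqrt |t|)) (ρ i)) z) := by
  have h := (Super.cocycles _ _).smul_mem (1 / 2 : ℝ) (hP.divergence_mem_cocycles hρ)
  exact ⟨hP.isHomological, fun _ _ _ _ _ => Super.actLocal_hamLocal,
    ⟨h, hP.poissonModularClass_eq hρ h⟩, fun _ _ hz => hP.bvLaplacian_eq hρ hz⟩
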